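/- For $\alpha\in\mathbb{R}$ and $n\ge 0$ let $$L^{(\alpha)}_n(x)=\sum_{i=0}^n(-1)^i\binom{n+\alpha}{n-i}\frac{x^i}{i!}$$ be the generalized Laguerre polynomial, where $\binom{r}{m}=\frac{r(r-1)\cdots(r-m+1)}{m!}$. For a partition $\lambda=(\lambda_1,\dots,\lambda_\ell)$, written as a sequence of integers $0\le\lambda_1\le\dots\le\lambda_\ell$, put $k_j=\lambda_j+j-1$ for $j=1,\dots,\ell$, so that $0\le k_1<\dots<k_\ell$, and let $L_\lambda=\operatorname{Wr}\bigl[L^{(\alpha)}_{k_1},\dots,L^{(\alpha)}_{k_\ell}\bigr]$ be the Wronskian determinant, that is, the determinant of the $\ell\times\ell$ matrix whose $(i,j)$ entry is the $(i-1)$-st derivative of $L^{(\alpha)}_{k_j}$. Then for Lebesgue-almost every $\alpha\in(-1,\infty)$ the following holds for every $\ell$ and every such $\lambda$: all zeros of $L_\lambda$ in $(0,\infty)$ are simple, and their number is exactly $$n(L_\lambda)=\sum_{j=1}^{\ell}(-1)^{\ell-j}\lambda_j.$$ -/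

import Mathlib

open Polynomial MeasureTheory

/-- The generalized Laguerre polynomial
`L_n^{(α)}(x) = ∑_{i=0}^{n} (-1)^i * binom (n + α) (n - i) * x^i / i!`,
where `binom r m = r (r - 1) ⋯ (r - m + 1) / m!` is the generalized binomial coefficient. -/
noncomputable def laguerrePoly (α : ℝ) (n : ℕ) : ℝ[X] :=
  ∑ i ∈ Finset.range (n + 1),
    C ((-1 : ℝ) ^ i * Ring.choose ((n : ℝ) + α) (n - i) / (Nat.factorial i : ℝ)) * X ^ i

/-- The Wronskian determinant of the polynomials `f 0, …, f (ℓ - 1)`: the determinant of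
the `ℓ × ℓ` matrix whose `i`-th row (counted from `0`) consists of the `i`-th derivatives. -/
noncomputable def wronskianDet {ℓ : ℕ} (f : Fin ℓ → ℝ[X]) : ℝ[X] :=
  Matrix.det (Matrix.of fun i j : Fin ℓ => derivative^[(i : ℕ)] (f j))

/-- The Wronskian `Wr[L_{k_1}^{(α)}, …, L_{k_ℓ}^{(α)}]`, with `k_j = lam_j + j - 1` for the
partition `lam = (lam_1 ≤ … ≤ lam_ℓ)`. With indices counted from `0` as in `Fin ℓ`,
`k_j = lam_j + j`. -/
noncomputable def laguerreWronskian (α : ℝ) {ℓ : ℕ} (lam : Fin ℓ → ℕ) : ℝ[X] :=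
  wronskianDet fun j : Fin ℓ => laguerrePoly α (lam j + (j : ℕ))

/-! Put P(m) = ∏_j (m - k_j) and let N be the finite set of naturals m with P(m) < 0. Distinct
positive zeros number at most |N| for every α > -1, and at least |N| when the positive zeros are
simple; for each λ all zeros are simple outside finitely many α > -1. There are countably many λ,
and `card_negSet` evaluates |N| as the alternating sum.

Upper bound (`card_le_of_isRoot_wronskianDet`). At a zero z some nonzero s_z in the span of the
L_{k_j} vanishes to order ℓ. Let f = ∑ a_z s_z 1_{(z,∞)} have pairings c_m with L_m. By Parseval the
form ∑ P(m) c_m² / ‖L_m‖² is a combination of weighted norms of derivatives of f, and integration by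
parts shows that it is zero, because P vanishes at every k_j. With more than |N| zeros, some nonzero
a makes c_m = 0 on N. Then c_m = 0 whenever P(m) ≠ 0, so f agrees a.e. with a polynomial that
vanishes near 0, and the first s_z that occurs must be zero.

Lower bound (`card_le_of_simple_seqWronskian`). Let w = x^α e^{-x}, let y = ∑ a_m L_m over m ∈ N,
let P act by L_m ↦ P(m) L_m, and let A y be the Wronskian of the L_{k_j} and y divided by that of
the L_{k_j}. Then x^ℓ (A y)² w = y (P y) w + (x w R)' with R rational (`exists_crumQuot_mul_eq`).
The Wronskians do not vanish at 0, so these quotients can be handled as power series. With fewer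
than |N| zeros, a nonzero y exists for which the numerator of A y vanishes at each of them; by
simplicity R has no pole on [0,∞), and integrating gives 0 ≤ ∑ P(m) a_m² ‖L_m‖² < 0.

Simplicity (`not_sq_dvd_wronskianPencil`). After clearing denominators the Wronskian is an explicit
polynomial in x and α. If G² divided it, the x-free coefficient of G would vanish at some α = -c
with c a positive integer. In ε = α + c the relevant Newton polygon has vertices among the strictly
convex points ((n - u)(c - u), u), so its edges have height one in ε, while G² forces an edge of
height at least two. Hence the Wronskian is separable over ℝ(α), and a Bézout relation specialises
to all but finitely many α. -/

/-! ### Laguerre polynomials: coefficients, derivatives, differential equation. -/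

theorem ringChoose_eq_prod (r : ℝ) (n : ℕ) :
    Ring.choose r n = (∏ s ∈ Finset.range n, (r - s)) / n.factorial := by
  have h := Ring.descPochhammer_eq_factorial_smul_choose r n
  have h2 : (descPochhammer ℤ n).smeval r = ∏ s ∈ Finset.range n, (r - s) := by
    induction n with
    | zero => simp
    | succ n ih =>
      rw [descPochhammer_succ_right, smeval_mul, smeval_sub, smeval_X, smeval_natCast,
        ih (Ring.descPochhammer_eq_factorial_smul_choose r n), Finset.prod_range_succ]
      simp
  rw [eq_div_iff (by positivity), ← h2, h, nsmul_eq_mul, mul_comm]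

/-- The coefficient of `x ^ i` in `L_n^{(α)}` as an explicit product. -/
noncomputable def lagCoeff (α : ℝ) (n i : ℕ) : ℝ :=
  if i ≤ n then
    (-1) ^ i / (i.factorial * (n - i).factorial) * ∏ s ∈ Finset.Ico i n, (α + s + 1)
  else 0

theorem coeff_laguerrePoly (α : ℝ) (n i : ℕ) :
    (laguerrePoly α n).coeff i = lagCoeff α n i := by
  unfold laguerrePoly lagCoeff
  simp only [finsetSum_coeff, coeff_C_mul_X_pow]
  rw [Finset.sum_ite_eq]
  simp only [Finset.mem_range, Nat.lt_succ_iff]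
  split_ifs with h
  · rw [ringChoose_eq_prod, Finset.prod_Ico_eq_prod_range, ← Finset.prod_range_reflect]
    have : ∀ j ∈ Finset.range (n - i),
        ((n : ℝ) + α - ((n - i - 1 - j : ℕ) : ℝ)) = α + ((i + j : ℕ) : ℝ) + 1 := by
      intro j hj
      rw [Finset.mem_range] at hj
      have h1 : (n - i - 1 - j) + (i + j + 1) = n := by omega
      have h2 : ((n - i - 1 - j : ℕ) : ℝ) + (i + j + 1) = n := by exact_mod_cast h1
      push_cast
      linarith
    rw [Finset.prod_congr rfl this]
    field_simp
  · rfl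

theorem lagCoeff_self (α : ℝ) (n : ℕ) : lagCoeff α n n = (-1) ^ n / n.factorial := by
  simp [lagCoeff]

theorem natDegree_laguerrePoly (α : ℝ) (n : ℕ) : (laguerrePoly α n).natDegree = n := by
  apply le_antisymm
  · rw [natDegree_le_iff_coeff_eq_zero]
    intro i hi
    rw [coeff_laguerrePoly, lagCoeff, if_neg (by omega)]
  · apply le_natDegree_of_ne_zero
    rw [coeff_laguerrePoly, lagCoeff_self]
    positivity

theorem laguerrePoly_ne_zero (α : ℝ) (n : ℕ) : laguerrePoly α n ≠ 0 := by
  intro h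
  have := coeff_laguerrePoly α n n
  rw [h, lagCoeff_self] at this
  simp only [coeff_zero] at this
  exact absurd this.symm (by positivity)

theorem laguerrePoly_zero (α : ℝ) : laguerrePoly α 0 = 1 := by
  simp [laguerrePoly]

theorem derivative_laguerrePoly_succ (α : ℝ) (n : ℕ) :
    derivative (laguerrePoly α (n + 1)) = -laguerrePoly (α + 1) n := by
  ext i
  rw [coeff_derivative, coeff_neg, coeff_laguerrePoly, coeff_laguerrePoly, lagCoeff, lagCoeff]
  by_cases h : i ≤ n
  · rw [if_pos (by omega), if_pos h, show n + 1 - (i + 1) = n - i by omega,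
      ← Finset.prod_Ico_add' (fun s : ℕ => α + (s : ℝ) + 1) i n 1, Nat.factorial_succ]
    have : ∀ s ∈ Finset.Ico i n, α + ((s + 1 : ℕ) : ℝ) + 1 = α + 1 + s + 1 := by
      intro s _; push_cast; ring
    rw [Finset.prod_congr rfl this]
    push_cast
    field_simp
    ring
  · rw [if_neg (by omega), if_neg h]; simp

/-- The adjoint first-order relation `x L_n^{(α+1)}' + (α+1-x) L_n^{(α+1)} = (n+1) L_{n+1}^{(α)}`. -/
theorem laguerrePoly_raise (α : ℝ) (n : ℕ) :
    X * derivative (laguerrePoly (α + 1) n) + (C (α + 1) - X) * laguerrePoly (α + 1) n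
      = C ((n : ℝ) + 1) * laguerrePoly α (n + 1) := by
  ext i
  rw [sub_mul, coeff_add, coeff_sub, coeff_C_mul, coeff_C_mul]
  cases i with
  | zero =>
    simp only [coeff_X_mul_zero, coeff_laguerrePoly, lagCoeff]
    rw [if_pos (by omega), if_pos (by omega), Finset.prod_eq_prod_Ico_succ_bot (by omega : 0 < n + 1),
      ← Finset.prod_Ico_add' (fun s : ℕ => α + (s : ℝ) + 1) 0 n 1]
    have : ∀ s ∈ Finset.Ico 0 n, α + ((s + 1 : ℕ) : ℝ) + 1 = α + 1 + s + 1 := by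
      intro s _; push_cast; ring
    rw [Finset.prod_congr rfl this]
    simp only [Nat.sub_zero, Nat.factorial_succ]
    push_cast
    field_simp
    ring
  | succ i =>
    rw [coeff_X_mul, coeff_X_mul, coeff_derivative]
    simp only [coeff_laguerrePoly, lagCoeff]
    rcases lt_trichotomy i n with h | h | h
    · rw [if_pos (by omega), if_pos (by omega), if_pos (by omega),
        show n + 1 - (i + 1) = (n - (i + 1)) + 1 by omega,
        show n - i = (n - (i + 1)) + 1 by omega,
        Finset.prod_eq_prod_Ico_succ_bot (by omega : i < n),
        Finset.prod_eq_prod_Ico_succ_bot (by omega : i + 1 < n + 1),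
        ← Finset.prod_Ico_add' (fun s : ℕ => α + (s : ℝ) + 1) (i + 1) n 1]
      have : ∀ s ∈ Finset.Ico (i + 1) n, α + ((s + 1 : ℕ) : ℝ) + 1 = α + 1 + s + 1 := by
        intro s _; push_cast; ring
      rw [Finset.prod_congr rfl this]
      have hn : (n : ℝ) = ((n - (i + 1) : ℕ) : ℝ) + (i + 1) := by
        have : n = (n - (i + 1)) + (i + 1) := by omega
        exact_mod_cast this
      generalize (n - (i + 1)) = d at *
      rw [hn]
      simp only [Nat.factorial_succ]
      push_cast
      field_simp
      ring
    · subst h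
      rw [if_neg (by omega), if_pos (by omega), if_pos (by omega)]
      simp only [Nat.sub_self, Nat.factorial_succ, Finset.Ico_self, Finset.prod_empty]
      push_cast
      field_simp
      ring
    · rw [if_neg (by omega), if_neg (by omega), if_neg (by omega)]; ring

theorem iterate_derivative_laguerrePoly (α : ℝ) (n j : ℕ) :
    derivative^[j] (laguerrePoly α (n + j)) = (-1) ^ j * laguerrePoly (α + j) n := by
  induction j generalizing α n with
  | zero => simp
  | succ j ih =>
    rw [Function.iterate_succ_apply, ← add_assoc, derivative_laguerrePoly_succ,
      iterate_derivative_neg, ih, pow_succ]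
    push_cast
    rw [add_assoc α, add_comm (1 : ℝ)]
    ring

theorem iterate_derivative_laguerrePoly_of_lt (α : ℝ) {n j : ℕ} (h : n < j) :
    derivative^[j] (laguerrePoly α n) = 0 :=
  iterate_derivative_eq_zero (by rwa [natDegree_laguerrePoly])

/-- The Laguerre differential equation. -/
theorem laguerrePoly_ode (α : ℝ) (n : ℕ) :
    X * derivative (derivative (laguerrePoly α n))
      + (C (α + 1) - X) * derivative (laguerrePoly α n) + C (n : ℝ) * laguerrePoly α n = 0 := by
  cases n with
  | zero => simp [laguerrePoly_zero]
  | succ n =>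
    have h := laguerrePoly_raise α n
    rw [derivative_laguerrePoly_succ, derivative_neg]
    push_cast at h ⊢
    linear_combination -h

/-! ### The Laguerre weight, integration by parts and orthogonality. -/

/-- The Laguerre weight `x ^ β * exp (-x)`. -/
noncomputable def lagWeight (β x : ℝ) : ℝ := x ^ β * Real.exp (-x)

theorem lagWeight_pos (β : ℝ) {x : ℝ} (hx : 0 < x) : 0 < lagWeight β x :=
  mul_pos (Real.rpow_pos_of_pos hx _) (Real.exp_pos _)

theorem lagWeight_add_one (β : ℝ) {x : ℝ} (hx : 0 < x) :
    lagWeight (β + 1) x = x * lagWeight β x := by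
  unfold lagWeight
  rw [Real.rpow_add_one hx.ne']; ring

theorem pow_mul_lagWeight (β : ℝ) (n : ℕ) {x : ℝ} (hx : 0 < x) :
    x ^ n * lagWeight β x = lagWeight (β + n) x := by
  unfold lagWeight
  rw [Real.rpow_add_natCast hx.ne']; ring

theorem continuous_lagWeight {β : ℝ} (hβ : 0 ≤ β) : Continuous (lagWeight β) :=
  (Real.continuous_rpow_const hβ).mul (by fun_prop)

theorem measurable_lagWeight (β : ℝ) : Measurable (lagWeight β) := by
  unfold lagWeight; fun_prop

theorem hasDerivAt_lagWeight_add_one (β : ℝ) {x : ℝ} (hx : 0 < x) :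
    HasDerivAt (lagWeight (β + 1)) ((β + 1 - x) * lagWeight β x) x := by
  have h1 := (Real.hasDerivAt_rpow_const (p := β + 1) (Or.inl hx.ne')).mul
    (Real.hasDerivAt_exp (-x) |>.comp x (hasDerivAt_neg x))
  refine h1.congr_deriv ?_
  simp only [lagWeight, Function.comp, add_sub_cancel_right, Real.rpow_add_one hx.ne']
  ring

theorem tendsto_eval_mul_lagWeight_atTop (β : ℝ) (p : ℝ[X]) :
    Filter.Tendsto (fun x => p.eval x * lagWeight β x) Filter.atTop (nhds 0) := by
  have h : ∀ i ∈ p.support, Filter.Tendsto (fun x : ℝ => p.coeff i * lagWeight (β + i) x)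
      Filter.atTop (nhds (p.coeff i * 0)) := fun i _ => by
    refine Filter.Tendsto.const_mul _ ?_
    exact (tendsto_rpow_mul_exp_neg_mul_atTop_nhds_zero (β + i) 1 one_pos).congr
      fun x => by simp [lagWeight]
  have h2 := tendsto_finsetSum _ h
  simp only [mul_zero, Finset.sum_const_zero] at h2
  refine h2.congr' ?_
  filter_upwards [Filter.eventually_gt_atTop 0] with x hx
  rw [eval_eq_sum, Polynomial.sum, Finset.sum_mul]
  exact Finset.sum_congr rfl fun i _ => by rw [← pow_mul_lagWeight β i hx]; ring

theorem integrableOn_eval_mul_lagWeight {β : ℝ} (hβ : -1 < β) {b : ℝ} (hb : 0 ≤ b) (p : ℝ[X]) :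
    IntegrableOn (fun x => p.eval x * lagWeight β x) (Set.Ioi b) := by
  refine IntegrableOn.mono_set ?_ (Set.Ioi_subset_Ioi hb)
  have h : IntegrableOn (fun x : ℝ => ∑ i ∈ p.support, p.coeff i * lagWeight (β + i) x)
      (Set.Ioi 0) := by
    refine integrable_finsetSum _ fun i _ => Integrable.const_mul ?_ _
    have := Real.GammaIntegral_convergent (s := β + i + 1) (by have := Nat.cast_nonneg (α := ℝ) i; linarith)
    exact this.congr_fun (fun x _ => by simp [lagWeight, mul_comm]) measurableSet_Ioi
  refine h.congr_fun (fun x hx => ?_) measurableSet_Ioi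
  simp only
  rw [eval_eq_sum, Polynomial.sum, Finset.sum_mul]
  exact Finset.sum_congr rfl fun i _ => by rw [← pow_mul_lagWeight β i hx]; ring

/-- The integral of a polynomial against the Laguerre weight over `(b, ∞)`. -/
noncomputable def lagInt (β b : ℝ) (p : ℝ[X]) : ℝ :=
  ∫ x in Set.Ioi b, p.eval x * lagWeight β x

section
variable {β b : ℝ}

theorem lagInt_add (hβ : -1 < β) (hb : 0 ≤ b) (p q : ℝ[X]) :
    lagInt β b (p + q) = lagInt β b p + lagInt β b q := by
  unfold lagInt
  rw [← integral_add (integrableOn_eval_mul_lagWeight hβ hb p)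
    (integrableOn_eval_mul_lagWeight hβ hb q)]
  simp [add_mul]

theorem lagInt_C_mul (c : ℝ) (p : ℝ[X]) : lagInt β b (C c * p) = c * lagInt β b p := by
  unfold lagInt
  rw [← integral_const_mul]
  simp [mul_assoc]

theorem lagInt_sum (hβ : -1 < β) (hb : 0 ≤ b) {ι : Type*} (s : Finset ι) (f : ι → ℝ[X]) :
    lagInt β b (∑ i ∈ s, f i) = ∑ i ∈ s, lagInt β b (f i) := by
  classical
  induction s using Finset.induction_on with
  | empty => simp [lagInt]
  | insert i s hi ih => rw [Finset.sum_insert hi, Finset.sum_insert hi, lagInt_add hβ hb, ih]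

theorem lagInt_sq_pos (hβ : -1 < β) {p : ℝ[X]} (hp : p ≠ 0) : 0 < lagInt β 0 (p * p) := by
  unfold lagInt
  rw [setIntegral_pos_iff_support_of_nonneg_ae]
  · have hsub : Set.Ioi 0 \ {x | p.IsRoot x} ⊆
        (Function.support fun x => (p * p).eval x * lagWeight β x) ∩ Set.Ioi 0 := by
      rintro x ⟨hx, hr⟩
      refine ⟨?_, hx⟩
      simp only [Function.mem_support, eval_mul]
      have : p.eval x ≠ 0 := hr
      have := (lagWeight_pos β hx).ne'
      positivity
    refine lt_of_lt_of_le ?_ (measure_mono hsub)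
    rw [measure_sdiff_null ((finite_setOfPred_isRoot hp).measure_zero _)]
    simp
  · refine ae_restrict_of_forall_mem measurableSet_Ioi fun x hx => ?_
    simp only [eval_mul, Pi.zero_apply]
    exact mul_nonneg (mul_self_nonneg _) (lagWeight_pos β hx).le
  · exact integrableOn_eval_mul_lagWeight hβ le_rfl _

/-- Integration by parts against a Laguerre polynomial. -/
theorem lagInt_derivative_mul_derivative (hβ : -1 < β) (hb : 0 ≤ b) (n : ℕ) (q : ℝ[X])
    (hq : b = 0 ∨ q.eval b = 0) :
    lagInt (β + 1) b (derivative q * derivative (laguerrePoly β n))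
      = n * lagInt β b (q * laguerrePoly β n) := by
  set L := laguerrePoly β n with hL
  set f : ℝ → ℝ := fun x => (q * derivative L).eval x * lagWeight (β + 1) x with hf
  have hode := laguerrePoly_ode β n
  -- The boundary term at b disappears either because the weight x^(β+1) vanishes at 0 (as β + 1 >
  -- 0) or because q does.
  have hfb : f b = 0 := by
    rcases hq with rfl | hq
    · simp [hf, lagWeight, Real.zero_rpow (by linarith : β + 1 ≠ 0)]
    · simp [hf, hq]
  have hder : ∀ x ∈ Set.Ioi b, HasDerivAt f
      ((derivative q * derivative L).eval x * lagWeight (β + 1) x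
        - (C (n : ℝ) * (q * L)).eval x * lagWeight β x) x := by
    intro x hx
    have hx0 : 0 < x := lt_of_le_of_lt hb hx
    refine ((q * derivative L).hasDerivAt x |>.mul
      (hasDerivAt_lagWeight_add_one β hx0)).congr_deriv ?_
    have h := congrArg (eval x) hode
    simp only [eval_add, eval_mul, eval_sub, eval_C, eval_X, eval_zero, ← hL] at h
    simp only [derivative_mul, eval_add, eval_mul, eval_C, lagWeight_add_one β hx0]
    linear_combination (q.eval x * lagWeight β x) * h
  have hi1 := integrableOn_eval_mul_lagWeight (by linarith : -1 < β + 1) hb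
    (derivative q * derivative L)
  have hi2 := integrableOn_eval_mul_lagWeight hβ hb (C (n : ℝ) * (q * L))
  have hcont : Continuous f := (Polynomial.continuous _).mul (continuous_lagWeight (by linarith))
  have key := integral_Ioi_of_hasDerivAt_of_tendsto hcont.continuousWithinAt hder (hi1.sub hi2)
    (tendsto_eval_mul_lagWeight_atTop (β + 1) _)
  rw [hfb, integral_sub hi1 hi2] at key
  have h2 : lagInt β b (C (n : ℝ) * (q * L)) = n * lagInt β b (q * L) := lagInt_C_mul _ _
  unfold lagInt at h2 ⊢
  linarith

/-- Each integration by parts raises the parameter and lowers the index by one. Vanishing of q to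
order j at b removes the boundary terms, so a polynomial truncated at b behaves like a smooth
function on the half-line. -/
theorem lagInt_iterate_derivative (hβ : -1 < β) (hb : 0 ≤ b) (n j : ℕ) (q : ℝ[X])
    (hq : b = 0 ∨ ∀ i < j, (derivative^[i] q).eval b = 0) :
    lagInt (β + j) b (derivative^[j] q * derivative^[j] (laguerrePoly β n))
      = n.descFactorial j * lagInt β b (q * laguerrePoly β n) := by
  induction j generalizing β n q with
  | zero => simp
  | succ j ih =>
    have h0 := lagInt_derivative_mul_derivative hβ hb n q
      (hq.imp_right fun h => h 0 (Nat.succ_pos j))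
    cases n with
    | zero =>
      rw [iterate_derivative_laguerrePoly_of_lt _ (Nat.succ_pos j)]
      simp [lagInt]
    | succ n =>
      rw [derivative_laguerrePoly_succ, mul_neg, ← neg_mul] at h0
      have h1 := ih (β := β + 1) (by linarith) n (-derivative q)
        (hq.imp_right fun h i hi => by
          rw [iterate_derivative_neg, eval_neg, ← Function.iterate_succ_apply,
            h (i + 1) (by omega), neg_zero])
      rw [h0] at h1
      rw [Function.iterate_succ_apply, Function.iterate_succ_apply, derivative_laguerrePoly_succ,
        Nat.succ_descFactorial_succ]
      rw [iterate_derivative_neg] at h1 ⊢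
      rw [neg_mul] at h1
      rw [mul_neg]
      push_cast at h1 ⊢
      rw [show β + (j + 1) = β + 1 + j by ring, h1]
      ring

/-- The Dirichlet form is symmetric, so it equals both m and n times the inner product. -/
theorem lagInt_mul_laguerrePoly_of_ne (hβ : -1 < β) {m n : ℕ} (h : m ≠ n) :
    lagInt β 0 (laguerrePoly β m * laguerrePoly β n) = 0 := by
  have h1 := lagInt_derivative_mul_derivative hβ le_rfl n (laguerrePoly β m) (Or.inl rfl)
  have h2 := lagInt_derivative_mul_derivative hβ le_rfl m (laguerrePoly β n) (Or.inl rfl)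
  rw [mul_comm, h2, mul_comm (laguerrePoly β n)] at h1
  have h3 : ((m : ℝ) - n) * lagInt β 0 (laguerrePoly β m * laguerrePoly β n) = 0 := by
    linear_combination h1
  rcases mul_eq_zero.1 h3 with h4 | h4
  · exact absurd (by exact_mod_cast sub_eq_zero.1 h4) h
  · exact h4

end

/-! ### Completeness of polynomials in L² and Parseval's identity. -/

/-- The measure on `(0, ∞)` with density the Laguerre weight. -/
noncomputable def lagMeasure (β : ℝ) : Measure ℝ :=
  (volume.restrict (Set.Ioi 0)).withDensity fun x => ENNReal.ofReal (lagWeight β x)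

theorem measurable_ofReal_lagWeight (β : ℝ) :
    Measurable fun x => ENNReal.ofReal (lagWeight β x) :=
  (measurable_lagWeight β).ennreal_ofReal

theorem toReal_ofReal_lagWeight (β : ℝ) {x : ℝ} (hx : x ∈ Set.Ioi (0 : ℝ)) :
    (ENNReal.ofReal (lagWeight β x)).toReal = lagWeight β x :=
  ENNReal.toReal_ofReal (lagWeight_pos β hx).le

theorem integrable_lagMeasure_iff {β : ℝ} {g : ℝ → ℝ} :
    Integrable g (lagMeasure β) ↔ IntegrableOn (fun x => g x * lagWeight β x) (Set.Ioi 0) := by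
  rw [lagMeasure, integrable_withDensity_iff_integrable_smul' (measurable_ofReal_lagWeight β)
    (by simp), ← IntegrableOn]
  exact integrableOn_congr_fun (fun x hx => by
    simp only [toReal_ofReal_lagWeight β hx, smul_eq_mul, mul_comm]) measurableSet_Ioi

theorem integral_lagMeasure (β : ℝ) (g : ℝ → ℝ) :
    ∫ x, g x ∂(lagMeasure β) = ∫ x in Set.Ioi 0, g x * lagWeight β x := by
  rw [lagMeasure, integral_withDensity_eq_integral_toReal_smul (measurable_ofReal_lagWeight β)
    (by simp)]
  exact setIntegral_congr_fun measurableSet_Ioi (fun x hx => by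
    simp only [toReal_ofReal_lagWeight β hx, smul_eq_mul, mul_comm])

theorem integrable_exp_lagMeasure {β : ℝ} (hβ : -1 < β) {t : ℝ} (ht : t < 1) :
    Integrable (fun x => Real.exp (t * x)) (lagMeasure β) := by
  rw [integrable_lagMeasure_iff]
  refine (integrableOn_rpow_mul_exp_neg_mul_rpow hβ one_pos (by linarith : 0 < 1 - t)).congr_fun
    (fun x _ => ?_) measurableSet_Ioi
  simp only [lagWeight, Real.rpow_one]
  rw [show -(1 - t) * x = t * x + -x by ring, Real.exp_add]; ring

theorem isFiniteMeasure_lagMeasure {β : ℝ} (hβ : -1 < β) : IsFiniteMeasure (lagMeasure β) := by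
  have := integrable_exp_lagMeasure hβ (t := 0) (by norm_num)
  simp only [zero_mul, Real.exp_zero] at this
  exact (integrable_const_iff_isFiniteMeasure one_ne_zero).1 this

theorem memLp_exp_lagMeasure {β : ℝ} (hβ : -1 < β) {t : ℝ} (ht : t < 1 / 2) :
    MemLp (fun x => Real.exp (t * x)) 2 (lagMeasure β) := by
  rw [memLp_two_iff_integrable_sq (by fun_prop)]
  refine (integrable_exp_lagMeasure hβ (t := 2 * t) (by linarith)).congr (ae_of_all _ fun x => ?_)
  simp only
  rw [← Real.exp_nat_mul]; congr 1; push_cast; ring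

theorem memLp_eval_lagMeasure {β : ℝ} (hβ : -1 < β) (p : ℝ[X]) :
    MemLp (fun x => p.eval x) 2 (lagMeasure β) := by
  rw [memLp_two_iff_integrable_sq p.continuous.aestronglyMeasurable, integrable_lagMeasure_iff]
  refine (integrableOn_eval_mul_lagWeight hβ le_rfl (p ^ 2)).congr_fun (fun x _ => ?_)
    measurableSet_Ioi
  simp

theorem integral_eval_lagMeasure (β : ℝ) (p : ℝ[X]) :
    ∫ x, p.eval x ∂(lagMeasure β) = lagInt β 0 p :=
  integral_lagMeasure β _

open ProbabilityTheory in
/-- Finite measures on the line with exponential moments near `0` are determined by their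
moments. -/
theorem measure_eq_of_moments_eq {μ ν : Measure ℝ} [IsFiniteMeasure μ] [IsFiniteMeasure ν] {δ : ℝ}
    (hδ : 0 < δ) (hμ : ∀ t ∈ Set.Ioo (-δ) δ, Integrable (fun x => Real.exp (t * x)) μ)
    (hν : ∀ t ∈ Set.Ioo (-δ) δ, Integrable (fun x => Real.exp (t * x)) ν)
    (h : ∀ n : ℕ, ∫ x, x ^ n ∂μ = ∫ x, x ^ n ∂ν) : μ = ν := by
  have hsub : ∀ {ρ : Measure ℝ}, (∀ t ∈ Set.Ioo (-δ) δ, Integrable (fun x => Real.exp (t * x)) ρ) →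
      Set.Ioo (-δ) δ ⊆ interior (integrableExpSet id ρ) := fun hρ =>
    interior_maximal (fun t ht => hρ t ht) isOpen_Ioo
  set U : Set ℂ := Complex.re ⁻¹' Set.Ioo (-δ) δ with hU
  have hUc : IsPreconnected U :=
    ((convex_Ioo (-δ) δ).linear_preimage Complex.reLm).isPreconnected
  have h0 : (0 : ℂ) ∈ U := by simp [hU, hδ]
  have hf : AnalyticOnNhd ℂ (complexMGF id μ) U :=
    analyticOnNhd_complexMGF.mono fun z hz => hsub hμ hz
  have hg : AnalyticOnNhd ℂ (complexMGF id ν) U :=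
    analyticOnNhd_complexMGF.mono fun z hz => hsub hν hz
  -- The derivatives at 0 are the moments, so the two functions, analytic on the strip |Re z| < δ,
  -- coincide there. The imaginary axis lies in the strip and carries the characteristic functions.
  have hder : ∀ n, iteratedDeriv n (complexMGF id μ) 0 = iteratedDeriv n (complexMGF id ν) 0 := by
    intro n
    rw [iteratedDeriv_complexMGF (hsub hμ h0), iteratedDeriv_complexMGF (hsub hν h0)]
    simp only [id, zero_mul, Complex.exp_zero, mul_one]
    have := congrArg (fun r : ℝ => (r : ℂ)) (h n)
    simp only [← integral_complex_ofReal] at this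
    simpa using this
  have hev : complexMGF id μ =ᶠ[nhds 0] complexMGF id ν := by
    have h1 := (hf 0 h0).hasFPowerSeriesAt
    have h2 := (hg 0 h0).hasFPowerSeriesAt
    simp only [hder] at h1
    have h3 := h1.sub h2
    rw [sub_self] at h3
    filter_upwards [h3.eventually_eq_zero] with z hz
    exact sub_eq_zero.1 hz
  have heq := hf.eqOn_of_preconnected_of_eventuallyEq hg hUc h0 hev
  refine Measure.ext_of_charFun (funext fun t => ?_)
  rw [← complexMGF_id_mul_I, ← complexMGF_id_mul_I]
  exact heq (by simp [hU, hδ])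

/-- Polynomials are total in `L²` of the Laguerre weight. -/
theorem ae_eq_zero_of_integral_pow_eq_zero {β : ℝ} (hβ : -1 < β) {f : ℝ → ℝ} (hfm : Measurable f)
    (hf : MemLp f 2 (lagMeasure β)) (h : ∀ n : ℕ, ∫ x, f x * x ^ n ∂(lagMeasure β) = 0) :
    f =ᵐ[lagMeasure β] 0 := by
  have := isFiniteMeasure_lagMeasure hβ
  set μ := lagMeasure β
  have key : ∀ g : ℝ → ℝ, MemLp g 2 μ → Integrable (fun x => f x * g x) μ := fun g hg =>
    hf.integrable_mul hg
  have hpow : ∀ n : ℕ, MemLp (fun x : ℝ => x ^ n) 2 μ := fun n => by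
    simpa using memLp_eval_lagMeasure hβ (X ^ n)
  have hfi : Integrable f μ := hf.integrable (by norm_num)
  have hpart : ∀ (f : ℝ → ℝ) (g : ℝ → ℝ), Measurable f → Measurable g →
      Integrable (fun x => f x * g x) μ →
      Integrable (fun x => (ENNReal.ofReal (f x)).toReal * g x) μ := by
    intro f g hf hg hi
    refine hi.mono (by fun_prop) (ae_of_all _ fun x => ?_)
    rw [norm_mul, norm_mul]
    refine mul_le_mul_of_nonneg_right ?_ (norm_nonneg _)
    rw [ENNReal.toReal_ofReal', Real.norm_eq_abs, Real.norm_eq_abs]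
    rcases le_total (f x) 0 with h | h
    · rw [max_eq_right h]; simp
    · rw [max_eq_left h]
  have hneg : ∀ g : ℝ → ℝ, Integrable (fun x => f x * g x) μ →
      Integrable (fun x => (-f x) * g x) μ := fun g hg => by simpa [neg_mul] using hg.neg
  have hmeas1 : Measurable fun x => ENNReal.ofReal (f x) := hfm.ennreal_ofReal
  have hmeas2 : Measurable fun x => ENNReal.ofReal (-f x) := hfm.neg.ennreal_ofReal
  have hfin1 : ∫⁻ x, ENNReal.ofReal (f x) ∂μ ≠ ⊤ := hfi.lintegral_lt_top.ne
  have hfin2 : ∫⁻ x, ENNReal.ofReal (-f x) ∂μ ≠ ⊤ := hfi.neg.lintegral_lt_top.ne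
  have : IsFiniteMeasure (μ.withDensity fun x => ENNReal.ofReal (f x)) :=
    isFiniteMeasure_withDensity hfin1
  have : IsFiniteMeasure (μ.withDensity fun x => ENNReal.ofReal (-f x)) :=
    isFiniteMeasure_withDensity hfin2
  -- The positive and negative parts of f are densities of two finite measures with equal moments.
  -- The bound 1/2 keeps `exp (t * x)` in L², so that its product with f is integrable.
  have heq : μ.withDensity (fun x => ENNReal.ofReal (f x))
      = μ.withDensity fun x => ENNReal.ofReal (-f x) := by
    refine measure_eq_of_moments_eq (δ := 1 / 2) (by norm_num) ?_ ?_ ?_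
    · intro t ht
      rw [integrable_withDensity_iff_integrable_smul' hmeas1 (by simp)]
      exact hpart f _ hfm (by fun_prop) (key _ (memLp_exp_lagMeasure hβ ht.2))
    · intro t ht
      rw [integrable_withDensity_iff_integrable_smul' hmeas2 (by simp)]
      exact hpart (fun x => -f x) _ hfm.neg (by fun_prop)
        (hneg _ (key _ (memLp_exp_lagMeasure hβ ht.2)))
    · intro n
      rw [integral_withDensity_eq_integral_toReal_smul hmeas1 (by simp),
        integral_withDensity_eq_integral_toReal_smul hmeas2 (by simp), ← sub_eq_zero]
      simp only [smul_eq_mul]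
      rw [← integral_sub (hpart f _ hfm (by fun_prop) (key _ (hpow n)))
        (hpart (fun x => -f x) _ hfm.neg (by fun_prop) (hneg _ (key _ (hpow n)))), ← h n]
      refine integral_congr_ae (ae_of_all _ fun x => ?_)
      simp only [ENNReal.toReal_ofReal']
      rcases le_total (f x) 0 with h | h
      · rw [max_eq_right h, max_eq_left (by linarith)]; ring
      · rw [max_eq_left h, max_eq_right (by linarith)]; ring
  have h2 := (withDensity_eq_iff hmeas1.aemeasurable hmeas2.aemeasurable hfin1).1 heq
  filter_upwards [h2] with x hx
  rcases le_total (f x) 0 with h | h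
  · rw [ENNReal.ofReal_of_nonpos h, eq_comm, ENNReal.ofReal_eq_zero] at hx
    simp only [Pi.zero_apply]; linarith
  · rw [ENNReal.ofReal_of_nonpos (by linarith : -f x ≤ 0), ENNReal.ofReal_eq_zero] at hx
    simp only [Pi.zero_apply]; linarith

/-- A linear functional on polynomials vanishing on all `L_n^{(β)}` vanishes. -/
theorem linearMap_eq_zero_of_laguerrePoly (β : ℝ) (φ : ℝ[X] →ₗ[ℝ] ℝ)
    (h : ∀ n, φ (laguerrePoly β n) = 0) : φ = 0 := by
  have key : ∀ n : ℕ, ∀ p : ℝ[X], p.natDegree < n → φ p = 0 := by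
    intro n
    induction n with
    | zero => intro p hp; omega
    | succ n ih =>
      intro p hp
      have hlc : (laguerrePoly β n).coeff n ≠ 0 := by
        rw [coeff_laguerrePoly, lagCoeff_self]; positivity
      set c := p.coeff n / (laguerrePoly β n).coeff n
      have hq : (p - c • laguerrePoly β n).natDegree ≤ n - 1 := by
        rw [natDegree_le_iff_coeff_eq_zero]
        intro i hi
        rw [coeff_sub, coeff_smul, smul_eq_mul]
        rcases lt_trichotomy i n with h1 | h1 | h1
        · omega
        · subst h1
          rw [div_mul_cancel₀ _ hlc, sub_self]
        · rw [coeff_eq_zero_of_natDegree_lt (by omega : p.natDegree < i),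
            coeff_eq_zero_of_natDegree_lt (by rw [natDegree_laguerrePoly]; omega), mul_zero,
            sub_zero]
      have hsplit : φ p = φ (p - c • laguerrePoly β n) + c * φ (laguerrePoly β n) := by
        rw [map_sub, map_smul, smul_eq_mul]; ring
      rw [hsplit, h n, mul_zero, add_zero]
      rcases Nat.eq_zero_or_pos n with rfl | hn
      · have : p - c • laguerrePoly β 0 = 0 := by
          rw [eq_C_of_natDegree_le_zero (by omega : (p - c • laguerrePoly β 0).natDegree ≤ 0)]
          simp only [coeff_sub, coeff_smul, smul_eq_mul]
          rw [div_mul_cancel₀ _ hlc, sub_self, C_0]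
        rw [this, map_zero]
      · exact ih _ (by omega)
  ext n
  exact key (n + 1) _ (by simp)

theorem ae_eq_zero_of_integral_laguerrePoly_eq_zero {β : ℝ} (hβ : -1 < β) {f : ℝ → ℝ}
    (hfm : Measurable f) (hf : MemLp f 2 (lagMeasure β))
    (h : ∀ n : ℕ, ∫ x, f x * (laguerrePoly β n).eval x ∂(lagMeasure β) = 0) :
    f =ᵐ[lagMeasure β] 0 := by
  have hint : ∀ p : ℝ[X], Integrable (fun x => f x * p.eval x) (lagMeasure β) := fun p =>
    hf.integrable_mul (memLp_eval_lagMeasure hβ p)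
  let φ : ℝ[X] →ₗ[ℝ] ℝ :=
    { toFun := fun p => ∫ x, f x * p.eval x ∂(lagMeasure β)
      map_add' := fun p q => by
        rw [← integral_add (hint p) (hint q)]; simp [mul_add]
      map_smul' := fun c p => by
        rw [RingHom.id_apply, smul_eq_mul, ← integral_const_mul]
        refine integral_congr_ae (ae_of_all _ fun x => ?_)
        simp only [eval_smul, smul_eq_mul]; ring }
  have hφ := linearMap_eq_zero_of_laguerrePoly β φ h
  refine ae_eq_zero_of_integral_pow_eq_zero hβ hfm hf fun n => ?_
  have := LinearMap.congr_fun hφ (X ^ n)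
  simpa [φ] using this

/-- Parseval's identity for the Laguerre polynomials. -/
theorem hasSum_laguerrePoly_coeff_sq {β : ℝ} (hβ : -1 < β) {f : ℝ → ℝ}
    (hf : MemLp f 2 (lagMeasure β)) :
    HasSum (fun n => (∫ x, f x * (laguerrePoly β n).eval x ∂(lagMeasure β)) ^ 2
        / lagInt β 0 (laguerrePoly β n * laguerrePoly β n))
      (∫ x, f x ^ 2 ∂(lagMeasure β)) := by
  set μ := lagMeasure β
  set h : ℕ → ℝ := fun n => lagInt β 0 (laguerrePoly β n * laguerrePoly β n) with hh
  have hpos : ∀ n, 0 < h n := fun n => lagInt_sq_pos hβ (laguerrePoly_ne_zero β n)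
  have hL := fun n => memLp_eval_lagMeasure hβ (laguerrePoly β n)
  have hinner : ∀ (u v : ℝ → ℝ) (hu : MemLp u 2 μ) (hv : MemLp v 2 μ),
      inner ℝ hu.toLp hv.toLp = ∫ x, u x * v x ∂μ := by
    intro u v hu hv
    rw [L2.inner_def]
    refine integral_congr_ae ?_
    filter_upwards [hu.coeFn_toLp, hv.coeFn_toLp] with x h1 h2
    rw [h1, h2]; simp [mul_comm]
  let v : ℕ → Lp ℝ 2 μ := fun n => (√(h n))⁻¹ • (hL n).toLp
  have hLL : ∀ m n, inner ℝ (hL m).toLp (hL n).toLp = lagInt β 0 (laguerrePoly β m * laguerrePoly β n) := by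
    intro m n
    rw [hinner, ← integral_eval_lagMeasure]
    simp [μ]
  have hv : Orthonormal ℝ v := by
    rw [orthonormal_iff_ite]
    intro m n
    simp only [v, inner_smul_left, inner_smul_right, hLL]
    split_ifs with hmn
    · subst hmn
      simp only [RCLike.conj_to_real]
      rw [← mul_assoc, ← mul_inv, Real.mul_self_sqrt (hpos m).le]
      exact inv_mul_cancel₀ (hpos m).ne'
    · rw [lagInt_mul_laguerrePoly_of_ne hβ hmn]; simp
  have hbot : (Submodule.span ℝ (Set.range v))ᗮ = ⊥ := by
    rw [Submodule.eq_bot_iff]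
    intro g hg
    rw [Submodule.mem_orthogonal'] at hg
    have h0 : ∀ n, ∫ x, g x * (laguerrePoly β n).eval x ∂μ = 0 := by
      intro n
      have h1 := hg (v n) (Submodule.subset_span ⟨n, rfl⟩)
      simp only [v, inner_smul_right] at h1
      have h2 : inner ℝ g (hL n).toLp = 0 := by
        rcases mul_eq_zero.1 h1 with h3 | h3
        · exact absurd h3 (inv_ne_zero (Real.sqrt_pos.2 (hpos n)).ne')
        · exact h3
      rw [← h2, L2.inner_def]
      refine integral_congr_ae ?_
      filter_upwards [(hL n).coeFn_toLp] with x h1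
      rw [h1]; simp [mul_comm]
    have := ae_eq_zero_of_integral_laguerrePoly_eq_zero hβ (Lp.stronglyMeasurable g).measurable
      (Lp.memLp g) h0
    exact (Lp.eq_zero_iff_ae_eq_zero).2 this
  let b := HilbertBasis.mkOfOrthogonalEqBot hv hbot
  have hb : ∀ n, b n = v n := fun n => congrFun (HilbertBasis.coe_mkOfOrthogonalEqBot hv hbot) n
  have hs := b.hasSum_inner_mul_inner hf.toLp hf.toLp
  rw [hinner] at hs
  have e : ∀ n, (∫ x, f x * (laguerrePoly β n).eval x ∂μ) ^ 2 / h n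
      = inner ℝ hf.toLp (b n) * inner ℝ (b n) hf.toLp := by
    intro n
    rw [real_inner_comm, ← pow_two, hb]
    simp only [v, inner_smul_left]
    rw [real_inner_comm, hinner, mul_pow]
    simp only [RCLike.conj_to_real]
    rw [inv_pow, Real.sq_sqrt (hpos n).le]
    ring
  have e2 : ∫ x, f x ^ 2 ∂μ = ∫ x, f x * f x ∂μ := by simp only [pow_two]
  rw [e2]
  exact hs.congr_fun e

/-! ### Wronskians and Sylvester's determinant identity. -/

theorem derivative_matrix_det {n : Type*} [Fintype n] [DecidableEq n] (M : Matrix n n ℝ[X]) :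
    derivative M.det = ∑ i, (M.updateRow i fun j => derivative (M i j)).det := by
  have h : ∀ M : Matrix n n ℝ[X],
      derivative M.det = ∑ i, (M.updateCol i fun r => derivative (M r i)).det := by
    intro M
    simp only [Matrix.det_apply']
    rw [derivative_sum, Finset.sum_comm]
    refine Finset.sum_congr rfl fun σ _ => ?_
    rw [show ((Equiv.Perm.sign σ : ℤ) : ℝ[X]) = C ((Equiv.Perm.sign σ : ℤ) : ℝ) by simp,
      derivative_C_mul, derivative_prod_finset, Finset.mul_sum]
    refine Finset.sum_congr rfl fun i _ => ?_
    rw [← Finset.mul_prod_erase Finset.univ _ (Finset.mem_univ i), Matrix.updateCol_self,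
      mul_comm (derivative _)]
    congr 2
    refine Finset.prod_congr rfl fun j hj => ?_
    rw [Matrix.updateCol_ne (Finset.ne_of_mem_erase hj)]
  rw [← Matrix.det_transpose, h]
  refine Finset.sum_congr rfl fun i _ => ?_
  rw [← Matrix.det_transpose, Matrix.updateCol_transpose, Matrix.transpose_transpose]
  rfl

/-- The determinant of a bordered `n × n` minor: rows `0, …, n - 1, r` and columns
`0, …, n - 1, c`. -/
noncomputable def borderedDet {K : Type*} [CommRing K] (T : ℕ → ℕ → K) (n r c : ℕ) : K :=
  Matrix.det (Matrix.of fun i j : Fin (n + 1) =>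
    T (if (i : ℕ) < n then i else r) (if (j : ℕ) < n then j else c))

theorem borderedDet_eq {K : Type*} [Field K] (T : ℕ → ℕ → K) (n r c : ℕ)
    (A : Matrix (Fin n) (Fin n) K) (hA : A = Matrix.of fun i j : Fin n => T i j)
    (hdet : A.det ≠ 0) :
    borderedDet T n r c
      = A.det * (T r c - dotProduct (fun j : Fin n => T r j) (A⁻¹.mulVec fun i => T i c)) := by
  have hu : IsUnit A := (Matrix.isUnit_iff_isUnit_det _).2 (isUnit_iff_ne_zero.2 hdet)
  have := hu.invertible
  have hblock : (Matrix.of fun i j : Fin (n + 1) =>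
      T (if (i : ℕ) < n then i else r) (if (j : ℕ) < n then j else c)).submatrix
        (finSumFinEquiv : Fin n ⊕ Fin 1 ≃ Fin (n + 1)) finSumFinEquiv
      = Matrix.fromBlocks A (Matrix.of fun (i : Fin n) (_ : Fin 1) => T i c)
          (Matrix.of fun (_ : Fin 1) (j : Fin n) => T r j) (Matrix.of fun _ _ => T r c) := by
    ext i j
    rcases i with i | i <;> rcases j with j | j <;> simp [hA]
  rw [borderedDet, ← Matrix.det_submatrix_equiv_self finSumFinEquiv, hblock,
    Matrix.det_fromBlocks₁₁, Matrix.det_fin_one, Matrix.invOf_eq_nonsing_inv]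
  congr 1
  simp only [Matrix.sub_apply, Matrix.of_apply, Matrix.mul_assoc]
  congr 1

/-- The Schur complement of the leading n × n block is a 2 × 2 matrix whose entries are bordered
minors divided by the block's determinant; expanding its determinant gives the identity. -/
theorem det_mul_borderedDet_field {K : Type*} [Field K] (T : ℕ → ℕ → K) (n : ℕ)
    (hdet : (Matrix.of fun i j : Fin n => T i j).det ≠ 0) :
    (Matrix.of fun i j : Fin (n + 2) => T i j).det * (Matrix.of fun i j : Fin n => T i j).det
      = borderedDet T n n n * borderedDet T n (n + 1) (n + 1)
        - borderedDet T n n (n + 1) * borderedDet T n (n + 1) n := by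
  set A := Matrix.of fun i j : Fin n => T i j with hA
  have hu : IsUnit A := (Matrix.isUnit_iff_isUnit_det _).2 (isUnit_iff_ne_zero.2 hdet)
  have := hu.invertible
  have hblock : (Matrix.of fun i j : Fin (n + 2) => T i j).submatrix
        (finSumFinEquiv : Fin n ⊕ Fin 2 ≃ Fin (n + 2)) finSumFinEquiv
      = Matrix.fromBlocks A (Matrix.of fun (i : Fin n) (c : Fin 2) => T i (n + c))
          (Matrix.of fun (r : Fin 2) (j : Fin n) => T (n + r) j)
          (Matrix.of fun r c : Fin 2 => T (n + r) (n + c)) := by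
    ext i j
    rcases i with i | i <;> rcases j with j | j <;> simp [hA]
  have hentry : ∀ r c : Fin 2, ((Matrix.of fun r c : Fin 2 => T (n + r) (n + c))
      - (Matrix.of fun (r : Fin 2) (j : Fin n) => T (n + r) j) * ⅟A
        * (Matrix.of fun (i : Fin n) (c : Fin 2) => T i (n + c))) r c
      = T (n + r) (n + c) - dotProduct (fun j : Fin n => T (n + r) j)
          (A⁻¹.mulVec fun i => T i (n + c)) := by
    intro r c
    rw [Matrix.invOf_eq_nonsing_inv, Matrix.mul_assoc]
    rfl
  rw [← Matrix.det_submatrix_equiv_self finSumFinEquiv, hblock, Matrix.det_fromBlocks₁₁,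
    Matrix.det_fin_two, hentry, hentry, hentry, hentry,
    borderedDet_eq T n _ _ A hA hdet, borderedDet_eq T n _ _ A hA hdet,
    borderedDet_eq T n _ _ A hA hdet, borderedDet_eq T n _ _ A hA hdet]
  simp only [Fin.val_zero, Fin.val_one, add_zero]
  ring

/-- The Schur complement needs an inverse, hence the passage through the fraction field. -/
theorem det_mul_borderedDet (T : ℕ → ℕ → ℝ[X]) (n : ℕ)
    (hdet : (Matrix.of fun i j : Fin n => T i j).det ≠ 0) :
    (Matrix.of fun i j : Fin (n + 2) => T i j).det * (Matrix.of fun i j : Fin n => T i j).det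
      = borderedDet T n n n * borderedDet T n (n + 1) (n + 1)
        - borderedDet T n n (n + 1) * borderedDet T n (n + 1) n := by
  let φ := algebraMap ℝ[X] (FractionRing ℝ[X])
  have hφ : Function.Injective φ := IsFractionRing.injective _ _
  have hd : ∀ m, φ (Matrix.of fun i j : Fin m => T i j).det
      = (Matrix.of fun i j : Fin m => φ (T i j)).det := fun m => by
    rw [RingHom.map_det]; rfl
  have hb : ∀ r c, φ (borderedDet T n r c) = borderedDet (fun i j => φ (T i j)) n r c := by
    intro r c
    rw [borderedDet, borderedDet, RingHom.map_det]; rfl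
  apply hφ
  rw [map_mul, map_sub, map_mul, map_mul, hd, hd, hb, hb, hb, hb]
  refine det_mul_borderedDet_field (fun i j => φ (T i j)) n ?_
  rw [← hd]
  exact fun h => hdet (hφ (h.trans (map_zero φ).symm))

/-- The Wronskian of the first `n` members of a sequence of polynomials. -/
noncomputable def seqWronskian (h : ℕ → ℝ[X]) (n : ℕ) : ℝ[X] :=
  wronskianDet fun j : Fin n => h j

theorem seqWronskian_succ_eq_borderedDet (h : ℕ → ℝ[X]) (n c : ℕ) :
    seqWronskian (Function.update h n (h c)) (n + 1)
      = borderedDet (fun i j => derivative^[i] (h j)) n n c := by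
  rw [seqWronskian, wronskianDet, borderedDet]
  congr 1
  ext1 i j
  simp only [Matrix.of_apply]
  have hi : (if (i : ℕ) < n then (i : ℕ) else n) = i := by split_ifs <;> omega
  rw [hi]
  by_cases hj : (j : ℕ) < n
  · rw [if_pos hj, Function.update_of_ne hj.ne]
  · rw [if_neg hj, show (j : ℕ) = n by omega, Function.update_self]

/-- Differentiating any row but the last makes it equal to the next one, so a single term survives.
-/
theorem derivative_seqWronskian_succ (h : ℕ → ℝ[X]) (n c : ℕ) :
    derivative (seqWronskian (Function.update h n (h c)) (n + 1))
      = borderedDet (fun i j => derivative^[i] (h j)) n (n + 1) c := by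
  rw [seqWronskian, wronskianDet, derivative_matrix_det, Finset.sum_eq_single (Fin.last n)]
  · rw [borderedDet]
    congr 1
    ext1 i j
    have hcol : Function.update h n (h c) j = h (if (j : ℕ) < n then j else c) := by
      by_cases hj : (j : ℕ) < n
      · rw [if_pos hj, Function.update_of_ne hj.ne]
      · rw [if_neg hj, show (j : ℕ) = n by omega, Function.update_self]
    by_cases hi : i = Fin.last n
    · subst hi
      simp [Function.iterate_succ_apply', hcol]
    · have hlt : (i : ℕ) < n := by
        have : (i : ℕ) ≠ n := fun h => hi (Fin.ext h)
        omega
      rw [Matrix.updateRow_ne hi]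
      simp [hlt, hcol]
  · intro i _ hi
    have hlt : (i : ℕ) < n := by
      have : (i : ℕ) ≠ n := fun h => hi (Fin.ext h)
      omega
    have hne : i ≠ ⟨i + 1, by omega⟩ := by
      intro h; have := congrArg Fin.val h; simp at this
    refine Matrix.det_zero_of_row_eq hne ?_
    rw [Matrix.updateRow_self, Matrix.updateRow_ne hne.symm]
    funext j
    simp [Function.iterate_succ_apply']
  · simp

/-- The Wronskian of the first `n` members of a sequence together with `f`. -/
noncomputable def crumDet (h : ℕ → ℝ[X]) (n : ℕ) (f : ℝ[X]) : ℝ[X] :=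
  seqWronskian (Function.update h n f) (n + 1)

theorem crumDet_self (h : ℕ → ℝ[X]) (n : ℕ) : crumDet h n (h n) = seqWronskian h (n + 1) := by
  rw [crumDet, Function.update_eq_self]

theorem crumDet_zero (h : ℕ → ℝ[X]) (f : ℝ[X]) : crumDet h 0 f = f := by
  simp [crumDet, seqWronskian, wronskianDet]

theorem seqWronskian_zero (h : ℕ → ℝ[X]) : seqWronskian h 0 = 1 := by
  simp [seqWronskian, wronskianDet]

theorem seqWronskian_congr {h h' : ℕ → ℝ[X]} {n : ℕ} (H : ∀ j < n, h j = h' j) :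
    seqWronskian h n = seqWronskian h' n := by
  unfold seqWronskian
  congr 1
  funext j
  exact H j j.2

/-- Sylvester's identity for Wronskians. -/
theorem crumDet_succ_mul (h : ℕ → ℝ[X]) (n : ℕ) (hn : seqWronskian h n ≠ 0) (f : ℝ[X]) :
    crumDet h (n + 1) f * seqWronskian h n
      = seqWronskian h (n + 1) * derivative (crumDet h n f)
        - derivative (seqWronskian h (n + 1)) * crumDet h n f := by
  set g := Function.update h (n + 1) f with hg
  have e0 : seqWronskian h n = seqWronskian g n :=
    seqWronskian_congr fun j hj => by rw [hg, Function.update_of_ne (by omega)]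
  have e1 : seqWronskian h (n + 1) = seqWronskian (Function.update g n (g n)) (n + 1) := by
    rw [Function.update_eq_self]
    exact seqWronskian_congr fun j hj => by rw [hg, Function.update_of_ne (by omega)]
  have e2 : crumDet h n f = seqWronskian (Function.update g n (g (n + 1))) (n + 1) := by
    refine seqWronskian_congr fun j hj => ?_
    by_cases hjn : j = n
    · subst hjn; simp [hg]
    · simp [hg, Function.update_of_ne hjn, Function.update_of_ne (by omega : j ≠ n + 1)]
  have e3 : crumDet h (n + 1) f = seqWronskian g (n + 2) := rfl
  rw [e0] at hn
  rw [e3, e0, e1, e2, derivative_seqWronskian_succ, derivative_seqWronskian_succ,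
    seqWronskian_succ_eq_borderedDet, seqWronskian_succ_eq_borderedDet]
  have := det_mul_borderedDet (fun i j => derivative^[i] (g j)) n hn
  rw [mul_comm (borderedDet _ n (n + 1) n)]
  exact this

theorem crumDet_eq_updateCol (h : ℕ → ℝ[X]) (n : ℕ) (f : ℝ[X]) :
    crumDet h n f = (Matrix.updateCol (Matrix.of fun i j : Fin (n + 1) =>
      derivative^[(i : ℕ)] (h j)) (Fin.last n) fun i => derivative^[(i : ℕ)] f).det := by
  rw [crumDet, seqWronskian, wronskianDet]
  congr 1
  ext1 i j
  by_cases hj : j = Fin.last n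
  · subst hj; simp
  · have : (j : ℕ) ≠ n := fun h => hj (Fin.ext h)
    rw [Matrix.updateCol_ne hj]
    simp [Function.update_of_ne this]

theorem crumDet_add (h : ℕ → ℝ[X]) (n : ℕ) (f g : ℝ[X]) :
    crumDet h n (f + g) = crumDet h n f + crumDet h n g := by
  simp only [crumDet_eq_updateCol]
  rw [← Matrix.det_updateCol_add]
  congr 2
  funext i
  simp

theorem crumDet_C_mul (h : ℕ → ℝ[X]) (n : ℕ) (c : ℝ) (f : ℝ[X]) :
    crumDet h n (C c * f) = C c * crumDet h n f := by
  simp only [crumDet_eq_updateCol]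
  rw [← Matrix.det_updateCol_smul]
  congr 2
  funext i
  simp

/-! ### Upper bound for the number of positive zeros. -/

theorem eq_zero_of_ae_eval_eq_zero {β u v : ℝ} (hu : 0 ≤ u) (huv : u < v) {p : ℝ[X]}
    (h : ∀ᵐ x ∂(lagMeasure β), x ∈ Set.Ioo u v → p.eval x = 0) : p = 0 := by
  by_contra hp
  rw [lagMeasure, ae_withDensity_iff (measurable_ofReal_lagWeight β),
    ae_restrict_iff' measurableSet_Ioi] at h
  have h2 : ∀ᵐ x, x ∉ Set.Ioo u v := by
    have h3 : ∀ᵐ x : ℝ, x ∉ {x | p.IsRoot x} :=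
      measure_eq_zero_iff_ae_notMem.1 ((finite_setOfPred_isRoot hp).measure_zero _)
    filter_upwards [h, h3] with x h1 h3 hx
    have hx0 : 0 < x := hu.trans_lt hx.1
    refine h3 (h1 hx0 ?_ hx)
    simpa using lagWeight_pos β hx0
  have h4 := measure_eq_zero_iff_ae_notMem.2 h2
  rw [Real.volume_Ioo, ENNReal.ofReal_eq_zero] at h4
  linarith

theorem lagInt_sum_mul_laguerrePoly {α : ℝ} (hα : -1 < α) {ι : Type*} [Fintype ι] [DecidableEq ι]
    {k : ι → ℕ} (hk : Function.Injective k) (c : ι → ℝ) (i : ι) :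
    lagInt α 0 ((∑ j, C (c j) * laguerrePoly α (k j)) * laguerrePoly α (k i))
      = c i * lagInt α 0 (laguerrePoly α (k i) * laguerrePoly α (k i)) := by
  rw [Finset.sum_mul, lagInt_sum hα le_rfl, Finset.sum_eq_single i]
  · rw [mul_assoc, lagInt_C_mul]
  · intro j _ hj
    rw [mul_assoc, lagInt_C_mul, lagInt_mul_laguerrePoly_of_ne hα (hk.ne hj), mul_zero]
  · simp

theorem sum_mul_laguerrePoly_ne_zero {α : ℝ} (hα : -1 < α) {ι : Type*} [Fintype ι]
    {k : ι → ℕ} (hk : Function.Injective k) {c : ι → ℝ} (hc : c ≠ 0) :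
    ∑ j, C (c j) * laguerrePoly α (k j) ≠ 0 := by
  classical
  intro h
  refine hc (funext fun i => ?_)
  have h1 := lagInt_sum_mul_laguerrePoly hα hk c i
  rw [h, zero_mul] at h1
  have h2 : lagInt α 0 (0 : ℝ[X]) = 0 := by simp [lagInt]
  rw [h2] at h1
  exact (mul_eq_zero.1 h1.symm).resolve_right
    (lagInt_sq_pos hα (laguerrePoly_ne_zero α (k i))).ne'

theorem eval_wronskianDet {ℓ : ℕ} (f : Fin ℓ → ℝ[X]) (x : ℝ) :
    (wronskianDet f).eval x
      = (Matrix.of fun i j : Fin ℓ => (derivative^[(i : ℕ)] (f j)).eval x).det := by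
  rw [wronskianDet, ← coe_evalRingHom, RingHom.map_det]
  rfl

/-- At a zero of the Wronskian some nontrivial combination vanishes to order `ℓ`. -/
theorem exists_combination_of_wronskianDet_isRoot {ℓ : ℕ} {f : Fin ℓ → ℝ[X]} {x : ℝ}
    (h : (wronskianDet f).IsRoot x) :
    ∃ c : Fin ℓ → ℝ, c ≠ 0 ∧
      ∀ a < ℓ, (derivative^[a] (∑ j, C (c j) * f j)).eval x = 0 := by
  have h1 : (Matrix.of fun i j : Fin ℓ => (derivative^[(i : ℕ)] (f j)).eval x).det = 0 := by
    rwa [IsRoot, eval_wronskianDet] at h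
  obtain ⟨c, hc, hv⟩ := Matrix.exists_mulVec_eq_zero_iff.2 h1
  refine ⟨c, hc, fun a ha => ?_⟩
  have := congrFun hv ⟨a, ha⟩
  simp only [Matrix.mulVec, dotProduct, Matrix.of_apply, Pi.zero_apply] at this
  rw [← this, iterate_derivative_sum, eval_finsetSum]
  refine Finset.sum_congr rfl fun j _ => ?_
  rw [iterate_derivative_C_mul, eval_mul, eval_C, mul_comm]

/-- Falling factorials are the right basis because j integrations by parts against L_m produce
exactly the factor `m.descFactorial j`. -/
theorem exists_descFactorial_expansion (l : List ℕ) :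
    ∃ p : ℕ → ℝ, (∀ j, l.length < j → p j = 0) ∧
      ∀ m : ℕ, (l.map fun k : ℕ => (m : ℝ) - k).prod
        = ∑ j ∈ Finset.range (l.length + 1), p j * m.descFactorial j := by
  induction l with
  | nil => exact ⟨fun j => if j = 0 then 1 else 0, fun j hj => by simp at hj; simp [hj.ne'],
      by simp⟩
  | cons k l ih =>
    obtain ⟨p, hp0, hp⟩ := ih
    -- These coefficients come from (m - k)(m)_j = (m)_{j+1} + (j - k)(m)_j, with (m)_j the falling
    -- factorial.
    refine ⟨fun j => (if j = 0 then 0 else p (j - 1)) + ((j : ℝ) - k) * p j, fun j hj => ?_,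
      fun m => ?_⟩
    · simp only [List.length_cons] at hj
      simp only
      rw [if_neg (by omega), hp0 (j - 1) (by omega), hp0 j (by omega)]; ring
    · rw [List.map_cons, List.prod_cons, hp, List.length_cons]
      simp only [add_mul, Finset.sum_add_distrib]
      rw [Finset.sum_range_succ' (fun j => (if j = 0 then 0 else p (j - 1)) * (m.descFactorial j : ℝ)),
        Finset.sum_range_succ (fun j => ((j : ℝ) - k) * p j * (m.descFactorial j : ℝ)),
        hp0 (l.length + 1) (by omega)]
      simp only [Nat.add_eq_zero_iff, one_ne_zero, and_false, if_false, Nat.add_sub_cancel, if_true,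
        zero_mul, mul_zero, add_zero]
      rw [← Finset.sum_add_distrib, Finset.mul_sum]
      refine Finset.sum_congr rfl fun j _ => ?_
      have h1 : (m.descFactorial (j + 1) : ℝ) = (m - j) * m.descFactorial j := by
        rw [Nat.descFactorial_succ]
        rcases le_or_gt j m with h | h
        · push_cast [h]; ring
        · rw [Nat.descFactorial_eq_zero_iff_lt.2 h]; simp
      rw [h1]; ring

theorem exists_descFactorial_expansion_prod {ℓ : ℕ} (k : Fin ℓ → ℕ) :
    ∃ p : ℕ → ℝ, ∀ m : ℕ, ∏ i, ((m : ℝ) - k i)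
        = ∑ j ∈ Finset.range (ℓ + 1), p j * m.descFactorial j := by
  obtain ⟨p, -, hp⟩ := exists_descFactorial_expansion (List.ofFn k)
  refine ⟨p, fun m => ?_⟩
  have := hp m
  rw [List.length_ofFn, List.map_ofFn, List.prod_ofFn] at this
  simpa using this

/-- The squared norm of a Laguerre polynomial. -/
noncomputable def lagNorm (α : ℝ) (n : ℕ) : ℝ :=
  lagInt α 0 (laguerrePoly α n * laguerrePoly α n)

theorem lagNorm_pos {α : ℝ} (hα : -1 < α) (n : ℕ) : 0 < lagNorm α n :=
  lagInt_sq_pos hα (laguerrePoly_ne_zero α n)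

theorem lagNorm_add {α : ℝ} (hα : -1 < α) (n j : ℕ) :
    lagNorm (α + j) n = (n + j).descFactorial j * lagNorm α (n + j) := by
  have h := lagInt_iterate_derivative hα le_rfl (n + j) j (laguerrePoly α (n + j)) (Or.inl rfl)
  rw [iterate_derivative_laguerrePoly] at h
  rw [lagNorm, lagNorm, ← h]
  congr 1
  have : ((-1 : ℝ[X]) ^ j) * (-1) ^ j = 1 := by rw [← mul_pow]; simp
  linear_combination (-laguerrePoly (α + j) n * laguerrePoly (α + j) n) * this

section TruncatedSums

variable (Z : Finset ℝ) (a : ℝ → ℝ) (s : ℝ → ℝ[X])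

/-- The function `∑_{z ∈ Z} a_z s_z 1_{(z, ∞)}`. -/
noncomputable def truncSum (x : ℝ) : ℝ :=
  ∑ z ∈ Z, (Set.Ioi z).indicator (fun x => a z * (s z).eval x) x

theorem measurable_truncSum : Measurable (truncSum Z a s) :=
  Finset.measurable_fun_sum _ fun z _ =>
    Measurable.indicator (by fun_prop) measurableSet_Ioi

variable {Z a s}

theorem memLp_truncSum {β : ℝ} (hβ : -1 < β) : MemLp (truncSum Z a s) 2 (lagMeasure β) :=
  memLp_finsetSum _ fun z _ =>
    ((memLp_eval_lagMeasure hβ (s z)).const_mul (a z)).indicator measurableSet_Ioi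

theorem integral_indicator_lagMeasure {β z : ℝ} (hz : 0 ≤ z) (p : ℝ[X]) :
    ∫ x, (Set.Ioi z).indicator (fun x => p.eval x) x ∂(lagMeasure β) = lagInt β z p := by
  rw [integral_lagMeasure, lagInt, ← integral_indicator measurableSet_Ioi,
    ← integral_indicator measurableSet_Ioi]
  congr 1
  funext x
  by_cases h1 : z < x
  · simp [Set.indicator, h1, hz.trans_lt h1]
  · simp [Set.indicator, h1]

theorem integrable_indicator_lagMeasure {β z : ℝ} (hβ : -1 < β) (p : ℝ[X]) :
    Integrable ((Set.Ioi z).indicator (fun x => p.eval x)) (lagMeasure β) := by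
  refine Integrable.indicator ?_ measurableSet_Ioi
  rw [integrable_lagMeasure_iff]
  exact integrableOn_eval_mul_lagWeight hβ le_rfl p

theorem integral_truncSum_mul {β : ℝ} (hβ : -1 < β) (hZ : ∀ z ∈ Z, 0 < z) (p : ℝ[X]) :
    ∫ x, truncSum Z a s x * p.eval x ∂(lagMeasure β) = ∑ z ∈ Z, a z * lagInt β z (s z * p) := by
  have : ∀ x, truncSum Z a s x * p.eval x
      = ∑ z ∈ Z, a z * (Set.Ioi z).indicator (fun x => (s z * p).eval x) x := by
    intro x
    rw [truncSum, Finset.sum_mul]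
    refine Finset.sum_congr rfl fun z _ => ?_
    by_cases h : z < x
    · simp [h, mul_assoc]
    · simp [h]
  simp only [this]
  rw [integral_finsetSum _ fun z _ => (integrable_indicator_lagMeasure hβ _).const_mul _]
  refine Finset.sum_congr rfl fun z hz => ?_
  rw [integral_const_mul, integral_indicator_lagMeasure (hZ z hz).le]

theorem integral_truncSum_sq {β : ℝ} (hβ : -1 < β) (hZ : ∀ z ∈ Z, 0 < z) :
    ∫ x, truncSum Z a s x ^ 2 ∂(lagMeasure β)
      = ∑ z ∈ Z, ∑ z' ∈ Z, a z * a z' * lagInt β (max z z') (s z * s z') := by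
  have : ∀ x, truncSum Z a s x ^ 2
      = ∑ z ∈ Z, ∑ z' ∈ Z, a z * a z' *
          (Set.Ioi (max z z')).indicator (fun x => (s z * s z').eval x) x := by
    intro x
    rw [truncSum, pow_two, Finset.sum_mul_sum]
    refine Finset.sum_congr rfl fun z _ => Finset.sum_congr rfl fun z' _ => ?_
    by_cases h : z < x <;> by_cases h' : z' < x <;> simp [h, h']
    ring
  simp only [this]
  rw [integral_finsetSum _ fun z _ => integrable_finsetSum _ fun z' _ =>
    (integrable_indicator_lagMeasure hβ _).const_mul _]
  refine Finset.sum_congr rfl fun z hz => ?_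
  rw [integral_finsetSum _ fun z' _ => (integrable_indicator_lagMeasure hβ _).const_mul _]
  refine Finset.sum_congr rfl fun z' _ => ?_
  rw [integral_const_mul, integral_indicator_lagMeasure (le_max_of_le_left (hZ z hz).le)]

end TruncatedSums

/-- This is Parseval at parameter α + j for the truncated j-th derivatives. Since s_z vanishes to
order j at z, truncation creates no boundary terms, and the pairings are those of the original
function at index n + j, up to sign and a falling factorial. -/
theorem hasSum_descFactorial_truncSum {α : ℝ} (hα : -1 < α) {Z : Finset ℝ} (hZ : ∀ z ∈ Z, 0 < z)
    (a : ℝ → ℝ) (s : ℝ → ℝ[X]) {j : ℕ}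
    (hs : ∀ z ∈ Z, ∀ i < j, (derivative^[i] (s z)).eval z = 0) :
    HasSum (fun m => (m.descFactorial j : ℝ)
        * (∑ z ∈ Z, a z * lagInt α z (s z * laguerrePoly α m)) ^ 2 / lagNorm α m)
      (∑ z ∈ Z, ∑ z' ∈ Z, a z * a z' *
        lagInt (α + j) (max z z') (derivative^[j] (s z) * derivative^[j] (s z'))) := by
  have hβ : -1 < α + j := by have := Nat.cast_nonneg (α := ℝ) j; linarith
  set c : ℕ → ℝ := fun m => ∑ z ∈ Z, a z * lagInt α z (s z * laguerrePoly α m) with hc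
  have h := hasSum_laguerrePoly_coeff_sq hβ
    (memLp_truncSum (Z := Z) (a := a) (s := fun z => derivative^[j] (s z)) hβ)
  rw [integral_truncSum_sq hβ hZ] at h
  -- The terms with m < j carry a zero falling factorial, so the series may start at m = j.
  rw [← add_zero (∑ z ∈ Z, ∑ z' ∈ Z, _), ← show ∑ m ∈ Finset.range j,
    (m.descFactorial j : ℝ) * c m ^ 2 / lagNorm α m = 0 from Finset.sum_eq_zero fun m hm => by
      rw [Nat.descFactorial_eq_zero_iff_lt.2 (Finset.mem_range.1 hm)]; simp,
    ← hasSum_nat_add_iff j]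
  refine h.congr_fun fun n => ?_
  have hsq : ((-1 : ℝ) ^ j) ^ 2 = 1 := by rw [← pow_mul, mul_comm, pow_mul]; simp
  have h1 : ∫ x, truncSum Z a (fun z => derivative^[j] (s z)) x
      * (laguerrePoly (α + j) n).eval x ∂(lagMeasure (α + j))
      = (-1) ^ j * ((n + j).descFactorial j * c (n + j)) := by
    rw [integral_truncSum_mul hβ hZ, hc]
    simp only [Finset.mul_sum]
    refine Finset.sum_congr rfl fun z hz => ?_
    have h2 := lagInt_iterate_derivative hα (hZ z hz).le (n + j) j (s z) (Or.inr (hs z hz))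
    rw [iterate_derivative_laguerrePoly] at h2
    have h3 : derivative^[j] (s z) * laguerrePoly (α + j) n
        = C ((-1 : ℝ) ^ j) * (derivative^[j] (s z) * ((-1) ^ j * laguerrePoly (α + j) n)) := by
      have : (C ((-1 : ℝ) ^ j)) * (-1 : ℝ[X]) ^ j = 1 := by
        rw [C_pow, C_neg, C_1, ← mul_pow]; simp
      linear_combination (-derivative^[j] (s z) * laguerrePoly (α + j) n) * this
    rw [h3, lagInt_C_mul, h2]
    ring
  have hd : ((n + j).descFactorial j : ℝ) ≠ 0 := by
    rw [Nat.cast_ne_zero, Ne, Nat.descFactorial_eq_zero_iff_lt]; omega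
  have hN := (lagNorm_pos hα (n + j)).ne'
  rw [h1, show lagInt (α + j) 0 (laguerrePoly (α + j) n * laguerrePoly (α + j) n)
    = lagNorm (α + j) n from rfl, lagNorm_add hα, mul_pow, hsq]
  field_simp
  rfl

/-- The number of positive zeros of the Wronskian is at most the number of negative squares. -/
theorem card_le_of_isRoot_wronskianDet {α : ℝ} (hα : -1 < α) {ℓ : ℕ} {k : Fin ℓ → ℕ}
    (hk : Function.Injective k) {Z : Finset ℝ} (hZ : ∀ z ∈ Z, 0 < z)
    (hroot : ∀ z ∈ Z, (wronskianDet fun j => laguerrePoly α (k j)).IsRoot z) {N : Finset ℕ}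
    (hN : ∀ m : ℕ, ∏ i, ((m : ℝ) - k i) < 0 → m ∈ N) : Z.card ≤ N.card := by
  classical
  by_contra! hlt
  have hex : ∀ z : ℝ, ∃ c : Fin ℓ → ℝ, z ∈ Z → c ≠ 0 ∧
      ∀ i < ℓ, (derivative^[i] (∑ j, C (c j) * laguerrePoly α (k j))).eval z = 0 := by
    intro z
    by_cases hz : z ∈ Z
    · obtain ⟨c, h1, h2⟩ := exists_combination_of_wronskianDet_isRoot (hroot z hz)
      exact ⟨c, fun _ => ⟨h1, h2⟩⟩
    · exact ⟨0, fun h => absurd h hz⟩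
  choose c hc using hex
  set s : ℝ → ℝ[X] := fun z => ∑ j, C (c z j) * laguerrePoly α (k j) with hs
  -- a combination orthogonal to the Laguerre polynomials with index in `N`
  obtain ⟨a, ha0, haN⟩ : ∃ a : ℝ → ℝ, (∃ z ∈ Z, a z ≠ 0) ∧
      ∀ m ∈ N, ∑ z ∈ Z, a z * lagInt α z (s z * laguerrePoly α m) = 0 := by
    let Φ : (Z → ℝ) →ₗ[ℝ] (N → ℝ) :=
      LinearMap.pi fun m => ∑ z : Z, lagInt α z (s z * laguerrePoly α m) • LinearMap.proj z
    have hker : LinearMap.ker Φ ≠ ⊥ := LinearMap.ker_ne_bot_of_finrank_lt (by simpa using hlt)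
    obtain ⟨b, hb, hb0⟩ := (Submodule.ne_bot_iff _).1 hker
    obtain ⟨z0, hz0⟩ := Function.ne_iff.1 hb0
    refine ⟨fun z => if h : z ∈ Z then b ⟨z, h⟩ else 0, ⟨z0, z0.2, by simpa using hz0⟩,
      fun m hm => ?_⟩
    have h1 := congrFun (LinearMap.mem_ker.1 hb) ⟨m, hm⟩
    simp only [Φ, LinearMap.pi_apply, LinearMap.sum_apply, LinearMap.smul_apply,
      LinearMap.proj_apply, smul_eq_mul, Pi.zero_apply] at h1
    rw [← Finset.sum_coe_sort, ← h1]
    refine Finset.sum_congr rfl fun z _ => ?_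
    simp [mul_comm]
  set coef : ℕ → ℝ := fun m => ∑ z ∈ Z, a z * lagInt α z (s z * laguerrePoly α m) with hcoef
  obtain ⟨p, hp⟩ := exists_descFactorial_expansion_prod k
  -- All derivatives are integrated back over (z', ∞), with the boundary terms killed by the zero of
  -- s_{z'} at z'; what remains contains P(k_i) = 0. The integral must start at the larger point,
  -- and s_{z'} is the factor vanishing there.
  have hneutral : ∀ z ∈ Z, ∀ z' ∈ Z, z ≤ z' →
      ∑ j ∈ Finset.range (ℓ + 1), p j *
        lagInt (α + j) z' (derivative^[j] (s z') * derivative^[j] (s z)) = 0 := by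
    intro z _ z' hz' _
    have h1 : ∀ j ∈ Finset.range (ℓ + 1),
        p j * lagInt (α + j) z' (derivative^[j] (s z') * derivative^[j] (s z))
        = ∑ i, c z i * lagInt α z' (s z' * laguerrePoly α (k i))
            * (p j * (k i).descFactorial j) := by
      intro j hj
      have hβ : -1 < α + j := by have := Nat.cast_nonneg (α := ℝ) j; linarith
      rw [show derivative^[j] (s z) = ∑ i, C (c z i) * derivative^[j] (laguerrePoly α (k i)) by
        rw [hs, iterate_derivative_sum]
        exact Finset.sum_congr rfl fun i _ => iterate_derivative_C_mul _ _ _,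
        Finset.mul_sum, lagInt_sum hβ (hZ z' hz').le, Finset.mul_sum]
      refine Finset.sum_congr rfl fun i _ => ?_
      rw [mul_left_comm, lagInt_C_mul, lagInt_iterate_derivative hα (hZ z' hz').le _ _ _
        (Or.inr fun i hi => (hc z' hz').2 i (by rw [Finset.mem_range] at hj; omega))]
      ring
    rw [Finset.sum_congr rfl h1, Finset.sum_comm]
    refine Finset.sum_eq_zero fun i _ => ?_
    rw [← Finset.mul_sum, ← hp, Finset.prod_eq_zero (Finset.mem_univ i) (sub_self _), mul_zero]
  have hsum : HasSum (fun m : ℕ => (∏ i, ((m : ℝ) - k i)) * coef m ^ 2 / lagNorm α m) 0 := by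
    have h1 := hasSum_sum (s := Finset.range (ℓ + 1)) fun j hj =>
      (hasSum_descFactorial_truncSum hα hZ a s (j := j) fun z hz i hi =>
        (hc z hz).2 i (by rw [Finset.mem_range] at hj; omega)).mul_left (p j)
    have h2 : ∑ j ∈ Finset.range (ℓ + 1), p j * (∑ z ∈ Z, ∑ z' ∈ Z, a z * a z' *
        lagInt (α + j) (max z z') (derivative^[j] (s z) * derivative^[j] (s z'))) = 0 := by
      simp only [Finset.mul_sum]
      rw [Finset.sum_comm]
      refine Finset.sum_eq_zero fun z hz => ?_
      rw [Finset.sum_comm]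
      refine Finset.sum_eq_zero fun z' hz' => ?_
      rcases le_total z z' with h | h
      · rw [max_eq_right h]
        have := hneutral z hz z' hz' h
        rw [← mul_zero (a z * a z'), ← this, Finset.mul_sum]
        refine Finset.sum_congr rfl fun j _ => ?_
        rw [mul_comm (derivative^[j] (s z))]; ring
      · rw [max_eq_left h]
        have := hneutral z' hz' z hz h
        rw [← mul_zero (a z * a z'), ← this, Finset.mul_sum]
        refine Finset.sum_congr rfl fun j _ => ?_
        ring
    rw [h2] at h1
    refine h1.congr_fun fun m => ?_
    rw [hp, Finset.sum_mul, Finset.sum_div]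
    refine Finset.sum_congr rfl fun j _ => ?_
    ring
  -- With the pairings on N removed, a series of nonnegative terms sums to zero, and P(m) ≠ 0 off
  -- the range of k.
  have hzero : ∀ m, m ∉ Set.range k → coef m = 0 := by
    have hnn : ∀ m : ℕ, 0 ≤ (∏ i, ((m : ℝ) - k i)) * coef m ^ 2 / lagNorm α m := by
      intro m
      rcases lt_or_ge (∏ i, ((m : ℝ) - k i)) 0 with h | h
      · have : coef m = 0 := haN m (hN m h)
        rw [this]; simp
      · exact div_nonneg (mul_nonneg h (sq_nonneg _)) (lagNorm_pos hα m).le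
    have h1 := (hasSum_zero_iff_of_nonneg hnn).1 hsum
    intro m hm
    have h2 := congrFun h1 m
    simp only [Pi.zero_apply, div_eq_zero_iff, mul_eq_zero, (lagNorm_pos hα m).ne', or_false] at h2
    rcases h2 with h2 | h2
    · exfalso
      obtain ⟨i, -, hi⟩ := Finset.prod_eq_zero_iff.1 h2
      exact hm ⟨i, by exact_mod_cast (sub_eq_zero.1 hi).symm⟩
    · exact pow_eq_zero_iff two_ne_zero |>.1 h2
  -- Only the indices k_i survive, so by completeness the truncated sum equals its projection Q
  -- almost everywhere.
  set Q : ℝ[X] := ∑ i, C (coef (k i) / lagNorm α (k i)) * laguerrePoly α (k i) with hQ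
  have hae : (fun x => truncSum Z a s x - Q.eval x) =ᵐ[lagMeasure α] 0 := by
    refine ae_eq_zero_of_integral_laguerrePoly_eq_zero hα
      ((measurable_truncSum Z a s).sub (by fun_prop))
      ((memLp_truncSum hα).sub (memLp_eval_lagMeasure hα Q)) fun m => ?_
    simp only [sub_mul]
    have e1 : Integrable (fun x => truncSum Z a s x * (laguerrePoly α m).eval x) (lagMeasure α) :=
      (memLp_truncSum hα).integrable_mul (memLp_eval_lagMeasure hα _)
    have e2 : Integrable (fun x => Q.eval x * (laguerrePoly α m).eval x) (lagMeasure α) :=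
      (memLp_eval_lagMeasure hα Q).integrable_mul (memLp_eval_lagMeasure hα _)
    rw [integral_sub e1 e2, integral_truncSum_mul hα hZ]
    simp only [← eval_mul]
    rw [integral_eval_lagMeasure]
    change coef m - _ = 0
    by_cases hm : m ∈ Set.range k
    · obtain ⟨i, rfl⟩ := hm
      rw [hQ, lagInt_sum_mul_laguerrePoly hα hk, ← lagNorm,
        div_mul_cancel₀ _ (lagNorm_pos hα _).ne', sub_self]
    · rw [hzero m hm, hQ, Finset.sum_mul, lagInt_sum hα le_rfl, Finset.sum_eq_zero, sub_zero]
      intro i _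
      rw [mul_assoc, lagInt_C_mul, lagInt_mul_laguerrePoly_of_ne hα (fun h => hm ⟨i, h⟩), mul_zero]
  have hS : (Z.filter fun z => a z ≠ 0).Nonempty := by
    obtain ⟨z, hz, hz'⟩ := ha0
    exact ⟨z, Finset.mem_filter.2 ⟨hz, hz'⟩⟩
  -- To the left of z0 the truncated sum is zero, which kills Q; between z0 and the next point of Z
  -- it is the single function a_{z0} s_{z0}.
  obtain ⟨z0, hz0, hmin⟩ := Finset.exists_min_image _ id hS
  rw [Finset.mem_filter] at hz0
  have hlow : ∀ z ∈ Z, z < z0 → a z = 0 := by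
    intro z hz hzz
    by_contra h
    exact absurd (hmin z (Finset.mem_filter.2 ⟨hz, h⟩)) (not_le.2 hzz)
  have hQ0 : Q = 0 := by
    refine eq_zero_of_ae_eval_eq_zero le_rfl (hZ z0 hz0.1) (β := α) ?_
    filter_upwards [hae] with x hx hx0
    have h1 : truncSum Z a s x = 0 := Finset.sum_eq_zero fun z hz => by
      by_cases h : z < x
      · simp [hlow z hz (h.trans hx0.2)]
      · simp [h]
    simp only [h1, Pi.zero_apply, zero_sub, neg_eq_zero] at hx
    exact hx
  obtain ⟨z1, hz1, hgap⟩ : ∃ z1, z0 < z1 ∧ ∀ z ∈ Z, z0 < z → z1 ≤ z := by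
    rcases (Z.filter fun z => z0 < z).eq_empty_or_nonempty with h | h
    · refine ⟨z0 + 1, by linarith, fun z hz hlt => ?_⟩
      exact absurd (Finset.mem_filter.2 ⟨hz, hlt⟩) (h ▸ Finset.notMem_empty z)
    · obtain ⟨z1, h1, h2⟩ := Finset.exists_min_image _ id h
      exact ⟨z1, (Finset.mem_filter.1 h1).2, fun z hz hlt => h2 z (Finset.mem_filter.2 ⟨hz, hlt⟩)⟩
  have hs0 : C (a z0) * s z0 = 0 := by
    refine eq_zero_of_ae_eval_eq_zero (hZ z0 hz0.1).le hz1 (β := α) ?_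
    filter_upwards [hae] with x hx hx0
    have h1 : truncSum Z a s x = a z0 * (s z0).eval x := by
      rw [truncSum, Finset.sum_eq_single z0]
      · simp [hx0.1]
      · intro z hz hne
        rcases lt_or_gt_of_ne hne with h | h
        · simp [hlow z hz h]
        · simp [(hx0.2.trans_le (hgap z hz h)).le]
      · exact fun h => absurd hz0.1 h
    simp only [h1, hQ0, eval_zero, sub_zero, Pi.zero_apply] at hx
    rw [eval_mul, eval_C, hx]
  rcases mul_eq_zero.1 hs0 with h | h
  · exact hz0.2 (C_eq_zero.1 h)
  · exact sum_mul_laguerrePoly_ne_zero hα hk (hc z0 hz0.1).1 h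

/-! ### Rational power series and Darboux transforms. -/

/-- A power series that is the expansion at `0` of a quotient of polynomials. -/
def IsRatSeries (r : PowerSeries ℝ) : Prop :=
  ∃ N D : ℝ[X], D.eval 0 ≠ 0 ∧ r * (D : PowerSeries ℝ) = N

theorem IsRatSeries.coe (p : ℝ[X]) : IsRatSeries (p : PowerSeries ℝ) :=
  ⟨p, 1, by simp, by simp⟩

theorem IsRatSeries.add {r s : PowerSeries ℝ} (hr : IsRatSeries r) (hs : IsRatSeries s) :
    IsRatSeries (r + s) := by
  obtain ⟨N, D, h0, h⟩ := hr
  obtain ⟨N', D', h0', h'⟩ := hs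
  refine ⟨N * D' + N' * D, D * D', by simp [h0, h0'], ?_⟩
  push_cast
  rw [← h, ← h']; ring

theorem IsRatSeries.mul {r s : PowerSeries ℝ} (hr : IsRatSeries r) (hs : IsRatSeries s) :
    IsRatSeries (r * s) := by
  obtain ⟨N, D, h0, h⟩ := hr
  obtain ⟨N', D', h0', h'⟩ := hs
  refine ⟨N * N', D * D', by simp [h0, h0'], ?_⟩
  push_cast
  rw [← h, ← h']; ring

/-- The quotient of Wronskians `Wr[h_0, …, h_{n-1}, f] / Wr[h_0, …, h_{n-1}]` as a power series. -/
noncomputable def crumQuot (h : ℕ → ℝ[X]) (n : ℕ) (f : ℝ[X]) : PowerSeries ℝ :=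
  (crumDet h n f : PowerSeries ℝ) * (seqWronskian h n : PowerSeries ℝ)⁻¹

theorem coe_mul_inv_cancel {p : ℝ[X]} (hp : p.eval 0 ≠ 0) :
    (p : PowerSeries ℝ) * (p : PowerSeries ℝ)⁻¹ = 1 := by
  refine PowerSeries.mul_inv_cancel _ ?_
  rwa [Polynomial.constantCoeff_coe, coeff_zero_eq_eval_zero]

theorem crumQuot_mul {h : ℕ → ℝ[X]} {n : ℕ} (hn : (seqWronskian h n).eval 0 ≠ 0) (f : ℝ[X]) :
    crumQuot h n f * (seqWronskian h n : PowerSeries ℝ) = crumDet h n f := by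
  have := coe_mul_inv_cancel hn
  rw [crumQuot]
  linear_combination (crumDet h n f : PowerSeries ℝ) * this

theorem isRatSeries_crumQuot {h : ℕ → ℝ[X]} {n : ℕ} (hn : (seqWronskian h n).eval 0 ≠ 0)
    (f : ℝ[X]) : IsRatSeries (crumQuot h n f) :=
  ⟨_, _, hn, crumQuot_mul hn f⟩

theorem crumQuot_add (h : ℕ → ℝ[X]) (n : ℕ) (f g : ℝ[X]) :
    crumQuot h n (f + g) = crumQuot h n f + crumQuot h n g := by
  simp [crumQuot, crumDet_add, add_mul]

theorem crumQuot_C_mul (h : ℕ → ℝ[X]) (n : ℕ) (c : ℝ) (f : ℝ[X]) :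
    crumQuot h n (C c * f) = PowerSeries.C c * crumQuot h n f := by
  simp [crumQuot, crumDet_C_mul, mul_assoc]

section DarbouxTransform

local notation "𝔡" => PowerSeries.derivative ℝ

theorem derivative_mul_series (f g : PowerSeries ℝ) : 𝔡 (f * g) = 𝔡 f * g + f * 𝔡 g := by
  rw [Derivation.leibniz, smul_eq_mul, smul_eq_mul]; ring

/-- One Darboux step. -/
theorem crumQuot_succ {h : ℕ → ℝ[X]} {n : ℕ} (hn : (seqWronskian h n).eval 0 ≠ 0)
    (hn' : (seqWronskian h (n + 1)).eval 0 ≠ 0) :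
    ∃ v : PowerSeries ℝ, 𝔡 (crumQuot h n (h n)) = v * crumQuot h n (h n) ∧
      (∃ w, crumQuot h n (h n) * w = 1) ∧
      ∀ f, crumQuot h (n + 1) f = 𝔡 (crumQuot h n f) - v * crumQuot h n f := by
  have hI := coe_mul_inv_cancel hn
  have hJ := coe_mul_inv_cancel hn'
  set I := (seqWronskian h n : PowerSeries ℝ)⁻¹
  set J := (seqWronskian h (n + 1) : PowerSeries ℝ)⁻¹
  set F := (seqWronskian h n : PowerSeries ℝ) with hF
  set E := (seqWronskian h (n + 1) : PowerSeries ℝ) with hE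
  have hu : crumQuot h n (h n) = E * I := by rw [crumQuot, crumDet_self]
  rw [hu]
  -- Here E * I is the seed solution and F * J its inverse, so v is its logarithmic derivative.
  refine ⟨𝔡 (E * I) * (F * J), ?_, ⟨F * J, ?_⟩, fun f => ?_⟩
  · linear_combination (-𝔡 (E * I)) * hI - (𝔡 (E * I)) * F * I * hJ
  · linear_combination hI + F * I * hJ
  · have hs := congrArg (fun p : ℝ[X] => (p : PowerSeries ℝ))
      (crumDet_succ_mul h n (by rintro h0; simp [h0] at hn) f)
    simp only [Polynomial.coe_mul, Polynomial.coe_sub, ← PowerSeries.derivative_coe] at hs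
    rw [crumQuot, crumQuot, derivative_mul_series, derivative_mul_series]
    set A := (crumDet h n f : PowerSeries ℝ)
    set B := (crumDet h (n + 1) f : PowerSeries ℝ)
    change B * F = E * 𝔡 A - 𝔡 E * A at hs
    change B * J = 𝔡 A * I + A * 𝔡 I - (𝔡 E * I + E * 𝔡 I) * (F * J) * (A * I)
    linear_combination (-B * J + I * J * 𝔡 E * A + A * 𝔡 I * E * J) * hI
      + (I * 𝔡 A + A * 𝔡 I) * hJ + I * J * hs

/-- The weighted derivative: `(x^{α+1} e^{-x} r)' = x^α e^{-x} (weightedDeriv α r)`. -/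
noncomputable def weightedDeriv (α : ℝ) (r : PowerSeries ℝ) : PowerSeries ℝ :=
  PowerSeries.X * 𝔡 r + (PowerSeries.C (α + 1) - PowerSeries.X) * r

theorem weightedDeriv_add (α : ℝ) (r s : PowerSeries ℝ) :
    weightedDeriv α (r + s) = weightedDeriv α r + weightedDeriv α s := by
  rw [weightedDeriv, weightedDeriv, weightedDeriv, map_add]; ring

theorem weightedDeriv_C_mul (α c : ℝ) (r : PowerSeries ℝ) :
    weightedDeriv α (PowerSeries.C c * r) = PowerSeries.C c * weightedDeriv α r := by
  rw [weightedDeriv, weightedDeriv, derivative_mul_series, PowerSeries.derivative_C]; ring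

variable {α : ℝ} {k : ℕ → ℕ}

/-- The Darboux transforms of the Laguerre polynomials satisfy a second order equation. -/
theorem crumQuot_ode {n : ℕ}
    (h0 : ∀ j ≤ n, (seqWronskian (fun j => laguerrePoly α (k j)) j).eval 0 ≠ 0) :
    ∃ V : PowerSeries ℝ, ∀ m : ℕ,
      PowerSeries.X * 𝔡 (𝔡 (crumQuot (fun j => laguerrePoly α (k j)) n (laguerrePoly α m)))
      + (PowerSeries.C (α + 1 + n) - PowerSeries.X)
        * 𝔡 (crumQuot (fun j => laguerrePoly α (k j)) n (laguerrePoly α m))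
      + V * crumQuot (fun j => laguerrePoly α (k j)) n (laguerrePoly α m)
      + PowerSeries.C (m : ℝ) * crumQuot (fun j => laguerrePoly α (k j)) n (laguerrePoly α m)
      = 0 := by
  set h : ℕ → ℝ[X] := fun j => laguerrePoly α (k j) with hh
  induction n with
  | zero =>
    refine ⟨0, fun m => ?_⟩
    have := congrArg (fun p : ℝ[X] => (p : PowerSeries ℝ)) (laguerrePoly_ode α m)
    simp only [Polynomial.coe_mul, Polynomial.coe_sub, Polynomial.coe_add, Polynomial.coe_X,
      Polynomial.coe_C, Polynomial.coe_zero, ← PowerSeries.derivative_coe] at this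
    have e : crumQuot h 0 (laguerrePoly α m) = laguerrePoly α m := by
      rw [crumQuot, crumDet_zero, seqWronskian_zero]; simp
    rw [e, Nat.cast_zero, add_zero]
    linear_combination this
  | succ n ih =>
    obtain ⟨V, hV⟩ := ih fun j hj => h0 j (by omega)
    obtain ⟨v, hv, ⟨w, hw⟩, hstep⟩ := crumQuot_succ (h0 n (by omega)) (h0 (n + 1) le_rfl)
    set b : PowerSeries ℝ := PowerSeries.C (α + 1 + n) - PowerSeries.X with hb
    have hb' : (PowerSeries.C (α + 1 + (n + 1 : ℕ)) - PowerSeries.X : PowerSeries ℝ) = b + 1 := by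
      rw [hb]; push_cast; simp only [map_add, map_one]; ring
    have hdb : 𝔡 b = -1 := by rw [hb]; simp
    have hdX : 𝔡 (PowerSeries.X : PowerSeries ℝ) = 1 := PowerSeries.derivative_X
    -- the Riccati equation
    have hric : PowerSeries.X * (𝔡 v + v ^ 2) + b * v + V + PowerSeries.C (k n : ℝ) = 0 := by
      have h1 := hV (k n)
      rw [hv, derivative_mul_series, hv] at h1
      linear_combination w * h1 - (PowerSeries.X * (𝔡 v + v ^ 2) + b * v + V
        + PowerSeries.C (k n : ℝ)) * hw
    refine ⟨𝔡 (b + PowerSeries.X * v) - v * (b + PowerSeries.X * v) - PowerSeries.C (k n : ℝ),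
      fun m => ?_⟩
    rw [hb', hstep]
    set ψ := crumQuot h n (laguerrePoly α m)
    -- The Riccati equation factors the operator: (x∂ + b + xv)(∂ - v)ψ = (k_n - m)ψ. Applying ∂ - v
    -- to both sides swaps the factors and gives the equation for the transform.
    have h2 : PowerSeries.X * 𝔡 (𝔡 ψ - v * ψ) + (b + PowerSeries.X * v) * (𝔡 ψ - v * ψ)
        = (PowerSeries.C (k n : ℝ) - PowerSeries.C (m : ℝ)) * ψ := by
      rw [map_sub, derivative_mul_series]
      linear_combination hV m - ψ * hric
    have h3 := congrArg 𝔡 h2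
    have hdc : 𝔡 (PowerSeries.C (k n : ℝ) - PowerSeries.C (m : ℝ)) = 0 := by simp
    rw [map_add, derivative_mul_series, derivative_mul_series, derivative_mul_series, hdX, hdc] at h3
    linear_combination h3 - v * h2

/-- A Darboux step is ∂ - v. Moving it off the transform of g by parts turns the other side into the
factored operator, which contributes the factor m - k_n. The total derivatives accumulate in R,
which stays rational. -/
theorem exists_crumQuot_mul_eq {n : ℕ}
    (h0 : ∀ j ≤ n, (seqWronskian (fun j => laguerrePoly α (k j)) j).eval 0 ≠ 0) (m : ℕ)
    (g : ℝ[X]) :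
    ∃ R, IsRatSeries R ∧ PowerSeries.X ^ n
        * crumQuot (fun j => laguerrePoly α (k j)) n (laguerrePoly α m)
        * crumQuot (fun j => laguerrePoly α (k j)) n g
      = PowerSeries.C (∏ j ∈ Finset.range n, ((m : ℝ) - k j))
          * ((laguerrePoly α m * g : ℝ[X]) : PowerSeries ℝ) + weightedDeriv α R := by
  set h : ℕ → ℝ[X] := fun j => laguerrePoly α (k j) with hh
  induction n with
  | zero =>
    refine ⟨0, by simpa using IsRatSeries.coe 0, ?_⟩
    simp [crumQuot, crumDet_zero, seqWronskian_zero, weightedDeriv]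
  | succ n ih =>
    obtain ⟨R, hR, hRe⟩ := ih fun j hj => h0 j (by omega)
    obtain ⟨V, hV⟩ := crumQuot_ode (n := n) fun j hj => h0 j (by omega)
    obtain ⟨v, hv, ⟨w, hw⟩, hstep⟩ := crumQuot_succ (h0 n (by omega)) (h0 (n + 1) le_rfl)
    -- The boundary term of one integration by parts; the power of x turns the weight x^(α+1) into
    -- x^(α+1+n).
    set T : PowerSeries ℝ := PowerSeries.X ^ n * crumQuot h n g
      * crumQuot h (n + 1) (laguerrePoly α m) with hT
    refine ⟨T + PowerSeries.C ((m : ℝ) - k n) * R, ?_, ?_⟩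
    · refine IsRatSeries.add (IsRatSeries.mul (IsRatSeries.mul ?_ ?_) ?_) (IsRatSeries.mul ?_ hR)
      · simpa using IsRatSeries.coe (X ^ n)
      · exact isRatSeries_crumQuot (h0 n (by omega)) g
      · exact isRatSeries_crumQuot (h0 (n + 1) le_rfl) _
      · rw [← Polynomial.coe_C]; exact IsRatSeries.coe _
    · rw [weightedDeriv_add, weightedDeriv_C_mul, Finset.prod_range_succ, map_mul]
      have hric : PowerSeries.X * (𝔡 v + v ^ 2) + (PowerSeries.C (α + 1 + n) - PowerSeries.X) * v
          + V + PowerSeries.C (k n : ℝ) = 0 := by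
        have h1 := hV (k n)
        change _ * 𝔡 (𝔡 (crumQuot h n (h n))) + _ * 𝔡 (crumQuot h n (h n))
          + _ * crumQuot h n (h n) + _ * crumQuot h n (h n) = 0 at h1
        rw [hv, derivative_mul_series, hv] at h1
        linear_combination w * h1 - (PowerSeries.X * (𝔡 v + v ^ 2)
          + (PowerSeries.C (α + 1 + n) - PowerSeries.X) * v + V
          + PowerSeries.C (k n : ℝ)) * hw
      have hVm := hV m
      have hXn : PowerSeries.X * 𝔡 ((PowerSeries.X : PowerSeries ℝ) ^ n)
          = PowerSeries.C (n : ℝ) * PowerSeries.X ^ n := by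
        rw [PowerSeries.derivative_pow, PowerSeries.derivative_X]
        cases n with
        | zero => simp
        | succ n => simp [pow_succ]; ring
      rw [hT, weightedDeriv, derivative_mul_series, derivative_mul_series, hstep, hstep,
        map_sub 𝔡, derivative_mul_series v, map_sub PowerSeries.C]
      simp only [map_add] at hric hVm ⊢
      set ψ := crumQuot h n (laguerrePoly α m)
      set χ := crumQuot h n g
      rw [← sub_eq_zero] at hRe
      linear_combination (PowerSeries.C (m : ℝ) - PowerSeries.C (k n : ℝ)) * hRe
        - PowerSeries.X ^ n * χ * hVm + PowerSeries.X ^ n * χ * ψ * hric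
        - χ * (𝔡 ψ - v * ψ) * hXn

end DarbouxTransform

/-! ### Lower bound for the number of positive zeros. -/

theorem IsRatSeries.exists_coprime {r : PowerSeries ℝ} (hr : IsRatSeries r) :
    ∃ N D : ℝ[X], D.eval 0 ≠ 0 ∧ IsCoprime N D ∧ r * (D : PowerSeries ℝ) = N := by
  obtain ⟨N, D, h0, h⟩ := hr
  have hD : D ≠ 0 := by rintro rfl; simp at h0
  set d := EuclideanDomain.gcd N D with hd
  have e1 : d * (N / d) = N := EuclideanDomain.mul_div_cancel' (by
    intro h; exact hD (EuclideanDomain.gcd_eq_zero_iff.1 h).2) (EuclideanDomain.gcd_dvd_left _ _)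
  have e2 : d * (D / d) = D := EuclideanDomain.mul_div_cancel' (by
    intro h; exact hD (EuclideanDomain.gcd_eq_zero_iff.1 h).2) (EuclideanDomain.gcd_dvd_right _ _)
  have hd0 : d ≠ 0 := by rintro h; rw [h, zero_mul] at e2; exact hD e2.symm
  refine ⟨N / d, D / d, ?_, ⟨EuclideanDomain.gcdA N D, EuclideanDomain.gcdB N D, ?_⟩, ?_⟩
  · intro h1
    apply h0
    rw [← e2, eval_mul, h1, mul_zero]
  · apply mul_left_cancel₀ hd0
    have := EuclideanDomain.gcd_eq_gcd_ab N D
    rw [← hd] at this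
    linear_combination EuclideanDomain.gcdA N D * e1 + EuclideanDomain.gcdB N D * e2 - this
  · have hd0' : (d : PowerSeries ℝ) ≠ 0 := by
      intro h; exact hd0 (Polynomial.coe_injective ℝ (h.trans Polynomial.coe_zero.symm))
    apply mul_left_cancel₀ hd0'
    rw [← Polynomial.coe_mul, e1, ← h, mul_left_comm, ← Polynomial.coe_mul, e2]

theorem isRatSeries_sum {ι : Type*} (s : Finset ι) (R : ι → PowerSeries ℝ)
    (h : ∀ i ∈ s, IsRatSeries (R i)) : IsRatSeries (∑ i ∈ s, R i) := by
  classical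
  induction s using Finset.induction_on with
  | empty => simpa using IsRatSeries.coe 0
  | insert i s hi ih =>
    rw [Finset.sum_insert hi]
    exact (h i (Finset.mem_insert_self _ _)).add
      (ih fun j hj => h j (Finset.mem_insert_of_mem hj))

section LowerBound

variable {α : ℝ} {k : ℕ → ℕ}

/-- The bilinear identity is summed over m with g = y and cleared of denominators, so that it can be
evaluated at any real x and not only as a series at 0. Writing R = N / D in lowest terms makes its
poles the zeros of D. -/
theorem exists_crumDet_sq_eq {n : ℕ}
    (h0 : ∀ j ≤ n, (seqWronskian (fun j => laguerrePoly α (k j)) j).eval 0 ≠ 0)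
    (s : Finset ℕ) (a : ℕ → ℝ) (y Py : ℝ[X]) (hy : y = ∑ m ∈ s, C (a m) * laguerrePoly α m)
    (hPy : Py = ∑ m ∈ s, C (a m * ∏ j ∈ Finset.range n, ((m : ℝ) - k j)) * laguerrePoly α m) :
    ∃ N D : ℝ[X], D.eval 0 ≠ 0 ∧ IsCoprime N D ∧
      X ^ n * crumDet (fun j => laguerrePoly α (k j)) n y ^ 2 * D ^ 2
        = seqWronskian (fun j => laguerrePoly α (k j)) n ^ 2 *
          (y * Py * D ^ 2 + (X * (derivative N * D - N * derivative D)
            + (C (α + 1) - X) * (N * D))) := by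
  set h : ℕ → ℝ[X] := fun j => laguerrePoly α (k j) with hh
  have hex := fun m => exists_crumQuot_mul_eq h0 m y
  choose R hR hRe using hex
  have hsum : crumQuot h n y
      = ∑ m ∈ s, PowerSeries.C (a m) * crumQuot h n (laguerrePoly α m) := by
    rw [hy]
    clear hy hPy hRe hR R
    classical
    induction s using Finset.induction_on with
    | empty =>
      have := crumQuot_C_mul h n 0 0
      simpa using this
    | insert i s hi ih =>
      rw [Finset.sum_insert hi, Finset.sum_insert hi, crumQuot_add, crumQuot_C_mul, ih]
  have hwd : ∀ s : Finset ℕ, weightedDeriv α (∑ m ∈ s, PowerSeries.C (a m) * R m)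
      = ∑ m ∈ s, PowerSeries.C (a m) * weightedDeriv α (R m) := by
    intro s
    classical
    induction s using Finset.induction_on with
    | empty => simp [weightedDeriv]
    | insert i s hi ih =>
      rw [Finset.sum_insert hi, Finset.sum_insert hi, weightedDeriv_add, weightedDeriv_C_mul, ih]
  have key : PowerSeries.X ^ n * crumQuot h n y * crumQuot h n y
      = ((Py * y : ℝ[X]) : PowerSeries ℝ)
        + weightedDeriv α (∑ m ∈ s, PowerSeries.C (a m) * R m) := by
    rw [hwd]
    nth_rw 1 [hsum]
    rw [Finset.mul_sum, Finset.sum_mul, hPy, Finset.sum_mul, ← Polynomial.coeToPowerSeries.ringHom_apply,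
      map_sum, ← Finset.sum_add_distrib]
    refine Finset.sum_congr rfl fun m _ => ?_
    rw [Polynomial.coeToPowerSeries.ringHom_apply, C_mul]
    have := hRe m
    push_cast at this ⊢
    linear_combination PowerSeries.C (a m) * this
  obtain ⟨N, D, hD0, hcop, hND⟩ := (isRatSeries_sum s (fun m => PowerSeries.C (a m) * R m)
    fun m _ => IsRatSeries.mul (by rw [← Polynomial.coe_C]; exact IsRatSeries.coe _)
      (hR m)).exists_coprime
  refine ⟨N, D, hD0, hcop, Polynomial.coe_injective ℝ ?_⟩
  set Rs := ∑ m ∈ s, PowerSeries.C (a m) * R m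
  have hder : PowerSeries.derivative ℝ Rs * D + Rs * PowerSeries.derivative ℝ (D : PowerSeries ℝ)
      = PowerSeries.derivative ℝ (N : PowerSeries ℝ) := by
    rw [← hND, derivative_mul_series]
  have hA := crumQuot_mul (h0 n le_rfl) y
  push_cast
  rw [← PowerSeries.derivative_coe, ← PowerSeries.derivative_coe, ← hA, ← hder, ← hND]
  rw [weightedDeriv] at key
  push_cast at key
  simp only [map_add, map_one] at key ⊢
  set F := (seqWronskian h n : PowerSeries ℝ)
  linear_combination F ^ 2 * (D : PowerSeries ℝ) ^ 2 * key

/-- A pole of N / D of order p would give its derivative a pole of order p + 1, which no other term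
can cancel once A / F is regular at x. Algebraically, (X - x)^p would divide D', whose order at x is
only p - 1. -/
theorem not_isRoot_of_simple {F A D N Q : ℝ[X]} {β : ℝ} {n : ℕ} {x : ℝ} (hx : 0 < x)
    (hF : F ≠ 0) (hsimple : F.IsRoot x → F.rootMultiplicity x = 1)
    (hA : F.IsRoot x → A.IsRoot x) (hcop : IsCoprime N D) (hD : D ≠ 0)
    (h : X ^ n * A ^ 2 * D ^ 2 = F ^ 2 * (Q * D ^ 2 + (X * (derivative N * D - N * derivative D)
      + (C β - X) * (N * D)))) : ¬ D.IsRoot x := by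
  intro hDx
  -- The common factor e is X - x at a zero of F and 1 elsewhere; simplicity leaves F₁ nonzero at x.
  obtain ⟨F₁, A₁, e, hF₁, hFe, hAe⟩ : ∃ F₁ A₁ e : ℝ[X], ¬ F₁.IsRoot x ∧ F = e * F₁ ∧ A = e * A₁ := by
    by_cases hr : F.IsRoot x
    · obtain ⟨q, hq⟩ := dvd_iff_isRoot.2 hr
      obtain ⟨p, hp⟩ := dvd_iff_isRoot.2 (hA hr)
      refine ⟨q, p, X - C x, fun hqx => ?_, hq, hp⟩
      have h2 : (X - C x) ^ 2 ∣ F := by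
        obtain ⟨q', hq'⟩ := dvd_iff_isRoot.2 hqx
        exact ⟨q', by rw [hq, hq']; ring⟩
      have := (le_rootMultiplicity_iff hF).2 h2
      rw [hsimple hr] at this
      omega
    · exact ⟨F, A, 1, hr, by simp, by simp⟩
  have he : e ≠ 0 := by rintro rfl; simp at hFe; exact hF hFe
  have h1 : X ^ n * A₁ ^ 2 * D ^ 2 = F₁ ^ 2 * (Q * D ^ 2
      + (X * (derivative N * D - N * derivative D) + (C β - X) * (N * D))) := by
    apply mul_left_cancel₀ (pow_ne_zero 2 he)
    rw [hFe, hAe] at h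
    linear_combination h
  have hDD : D ∣ (F₁ ^ 2 * X * N) * derivative D := by
    refine ⟨F₁ ^ 2 * (Q * D + X * derivative N + (C β - X) * N) - X ^ n * A₁ ^ 2 * D, ?_⟩
    linear_combination h1
  set p := D.rootMultiplicity x with hp
  have hp1 : 0 < p := (rootMultiplicity_pos hD).2 hDx
  have hprime : Prime (X - C x) := prime_X_sub_C x
  have h2 : (X - C x) ^ p ∣ (F₁ ^ 2 * X * N) * derivative D :=
    (pow_rootMultiplicity_dvd D x).trans hDD
  have hNx : ¬ (X - C x) ∣ N := by
    intro hN
    have := hcop.isUnit_of_dvd' hN (dvd_iff_isRoot.2 hDx)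
    exact hprime.not_isUnit this
  have h3 : ¬ (X - C x) ∣ F₁ ^ 2 * X * N := by
    intro hdvd
    rcases hprime.dvd_or_dvd hdvd with h4 | h4
    · rcases hprime.dvd_or_dvd h4 with h5 | h5
      · exact hF₁ (dvd_iff_isRoot.1 (hprime.dvd_of_dvd_pow h5))
      · have := dvd_iff_isRoot.1 h5
        simp only [IsRoot, eval_X] at this
        exact hx.ne' this
    · exact hNx h4
  have h4 : (X - C x) ^ p ∣ derivative D := hprime.pow_dvd_of_dvd_mul_left p h3 h2
  have hD' : derivative D ≠ 0 := by
    intro h0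
    have hdeg := derivative_eq_zero.1 h0
    rw [eq_C_of_natDegree_eq_zero hdeg] at hDx hD
    simp only [IsRoot, eval_C] at hDx
    rw [hDx] at hD
    simp at hD
  have h5 := (le_rootMultiplicity_iff hD').2 h4
  rw [derivative_rootMultiplicity_of_root hDx] at h5
  omega

theorem exists_pos_le_abs_eval {D : ℝ[X]} (h : ∀ x, 0 ≤ x → D.eval x ≠ 0) :
    ∃ c > 0, ∀ x, 0 ≤ x → c ≤ |D.eval x| := by
  rcases Nat.eq_zero_or_pos D.natDegree with hd | hd
  · rw [eq_C_of_natDegree_eq_zero hd] at h ⊢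
    have h0 := h 0 le_rfl
    simp only [eval_C] at h0 ⊢
    exact ⟨|D.coeff 0|, abs_pos.2 h0, fun x _ => le_rfl⟩
  · have ht := D.abs_tendsto_atTop (natDegree_pos_iff_degree_pos.1 hd)
    obtain ⟨M, hM⟩ := Filter.eventually_atTop.1 (ht.eventually_ge_atTop 1)
    have hne : (Set.Icc 0 (max M 0)).Nonempty := ⟨0, le_rfl, le_max_right _ _⟩
    obtain ⟨z, hz, hmin⟩ := isCompact_Icc.exists_isMinOn hne
      (D.continuous.abs.continuousOn (s := Set.Icc 0 (max M 0)))
    refine ⟨min 1 |D.eval z|, lt_min one_pos (abs_pos.2 (h z hz.1)), fun x hx => ?_⟩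
    rcases le_total x (max M 0) with hxM | hxM
    · exact (min_le_right _ _).trans (hmin ⟨hx, hxM⟩)
    · exact (min_le_left _ _).trans (hM x ((le_max_left _ _).trans hxM))

/-- The identity exhibits Q plus a weighted total derivative as a square times x^n. The total
derivative integrates to zero, since x^(α+1) e^{-x} N / D vanishes at 0 and at infinity. -/
theorem lagInt_nonneg_of_identity {F A D N Q : ℝ[X]} (hα : -1 < α) {n : ℕ} (hF : F ≠ 0)
    (hD : ∀ x, 0 ≤ x → D.eval x ≠ 0)
    (h : X ^ n * A ^ 2 * D ^ 2 = F ^ 2 * (Q * D ^ 2 + (X * (derivative N * D - N * derivative D)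
      + (C (α + 1) - X) * (N * D)))) : 0 ≤ lagInt α 0 Q := by
  set T := X * (derivative N * D - N * derivative D) + (C (α + 1) - X) * (N * D) with hT
  obtain ⟨c, hc, hcD⟩ := exists_pos_le_abs_eval hD
  have hnn : ∀ x, 0 ≤ x → 0 ≤ (Q * D ^ 2 + T).eval x := by
    -- The sign is read off where F does not vanish and extends to [0,∞) by density.
    have hcl : closure {x : ℝ | F.eval x ≠ 0 ∧ 0 < x} ⊆ {x | 0 ≤ (Q * D ^ 2 + T).eval x} := by
      refine closure_minimal ?_ (isClosed_le continuous_const (Polynomial.continuous _))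
      rintro x ⟨hx, hx0⟩
      have h1 := congrArg (eval x) h
      simp only [eval_mul, eval_pow, eval_X] at h1
      have h2 : 0 ≤ F.eval x ^ 2 * (Q * D ^ 2 + T).eval x := by
        rw [← h1]; positivity
      exact nonneg_of_mul_nonneg_right h2 (by positivity)
    intro x hx
    apply hcl
    have hdense : Dense {x : ℝ | F.eval x ≠ 0} := by
      have : {x : ℝ | F.eval x ≠ 0} = {x | F.IsRoot x}ᶜ := rfl
      rw [this]
      exact (finite_setOfPred_isRoot hF).countable.dense_compl ℝ
    have hsub : Set.Ioi (0 : ℝ) ⊆ closure {x : ℝ | F.eval x ≠ 0 ∧ 0 < x} := by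
      have := hdense.open_subset_closure_inter (isOpen_Ioi (a := (0 : ℝ)))
      rw [Set.inter_comm] at this
      exact this
    have := closure_minimal hsub isClosed_closure
    rw [closure_Ioi] at this
    exact this hx
  have hbound : ∀ x, 0 ≤ x → |(D.eval x)⁻¹| ≤ c⁻¹ := fun x hx => by
    rw [abs_inv]; exact inv_anti₀ hc (hcD x hx)
  set G : ℝ → ℝ := fun x => lagWeight (α + 1) x * (N.eval x / D.eval x) with hG
  have hder : ∀ x ∈ Set.Ioi (0 : ℝ), HasDerivAt G
      (T.eval x * lagWeight α x * ((D.eval x)⁻¹) ^ 2) x := by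
    intro x hx
    have hx0 : 0 < x := hx
    refine ((hasDerivAt_lagWeight_add_one α hx0).mul
      ((N.hasDerivAt x).div (D.hasDerivAt x) (hD x hx0.le))).congr_deriv ?_
    rw [lagWeight_add_one α hx0, hT]
    simp only [eval_add, eval_mul, eval_sub, eval_C, eval_X, Pi.div_apply]
    have := hD x hx0.le
    field_simp
    ring
  have hint : IntegrableOn (fun x => T.eval x * lagWeight α x * ((D.eval x)⁻¹) ^ 2)
      (Set.Ioi 0) := by
    refine (integrableOn_eval_mul_lagWeight hα le_rfl T).mul_bdd (c := (c⁻¹) ^ 2) ?_ ?_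
    · exact Measurable.aestronglyMeasurable (by fun_prop)
    · refine ae_restrict_of_forall_mem measurableSet_Ioi fun x hx => ?_
      rw [Real.norm_eq_abs, abs_pow]
      exact pow_le_pow_left₀ (abs_nonneg _) (hbound x (le_of_lt hx)) 2
  have hlim : Filter.Tendsto G Filter.atTop (nhds 0) := by
    have h1 := (tendsto_eval_mul_lagWeight_atTop (α + 1) N).abs.mul_const (c⁻¹)
    rw [abs_zero, zero_mul] at h1
    refine squeeze_zero_norm' ?_ h1
    filter_upwards [Filter.eventually_ge_atTop 0] with x hx
    simp only [hG]
    rw [Real.norm_eq_abs, div_eq_mul_inv, ← mul_assoc, abs_mul, mul_comm (lagWeight _ _)]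
    exact mul_le_mul_of_nonneg_left (hbound x hx) (abs_nonneg _)
  have hcont : ContinuousWithinAt G (Set.Ici 0) 0 := by
    refine ((continuous_lagWeight (by linarith)).continuousAt.mul ?_).continuousWithinAt
    exact N.continuous.continuousAt.div D.continuous.continuousAt (hD 0 le_rfl)
  have hG0 : G 0 = 0 := by
    simp [hG, lagWeight, Real.zero_rpow (by linarith : α + 1 ≠ 0)]
  have hI := integral_Ioi_of_hasDerivAt_of_tendsto hcont hder hint hlim
  rw [hG0, sub_zero] at hI
  have hQ := integrableOn_eval_mul_lagWeight hα le_rfl Q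
  have h3 : lagInt α 0 Q = ∫ x in Set.Ioi 0, (Q.eval x * lagWeight α x
      + T.eval x * lagWeight α x * ((D.eval x)⁻¹) ^ 2) := by
    rw [integral_add hQ hint, hI, add_zero, lagInt]
  rw [h3]
  refine setIntegral_nonneg measurableSet_Ioi fun x hx => ?_
  have h4 := hnn x (le_of_lt hx)
  have h5 : Q.eval x * lagWeight α x + T.eval x * lagWeight α x * ((D.eval x)⁻¹) ^ 2
      = (Q * D ^ 2 + T).eval x * lagWeight α x * ((D.eval x)⁻¹) ^ 2 := by
    have := hD x (le_of_lt hx)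
    simp only [eval_add, eval_mul, eval_pow]
    field_simp
  rw [h5]
  have := lagWeight_pos α hx
  positivity

/-- If the positive zeros of the Wronskian are simple, there are at least as many of them as
negative squares. -/
theorem card_le_of_simple_seqWronskian (hα : -1 < α) {n : ℕ}
    (h0 : ∀ j ≤ n, (seqWronskian (fun j => laguerrePoly α (k j)) j).eval 0 ≠ 0)
    {Z : Finset ℝ}
    (hZ : ∀ z, 0 < z → (seqWronskian (fun j => laguerrePoly α (k j)) n).IsRoot z → z ∈ Z ∧
      (seqWronskian (fun j => laguerrePoly α (k j)) n).rootMultiplicity z = 1)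
    {N : Finset ℕ} (hN : ∀ m ∈ N, ∏ j ∈ Finset.range n, ((m : ℝ) - k j) < 0) :
    N.card ≤ Z.card := by
  classical
  by_contra! hlt
  set h : ℕ → ℝ[X] := fun j => laguerrePoly α (k j) with hh
  have hF : seqWronskian h n ≠ 0 := by
    intro hF
    have := h0 n le_rfl
    rw [hF] at this
    simp at this
  -- These are |Z| linear conditions on |N| > |Z| unknowns: the numerator of A y is to vanish on Z.
  obtain ⟨a, ⟨m0, hm0, ham0⟩, haZ⟩ : ∃ a : ℕ → ℝ, (∃ m ∈ N, a m ≠ 0) ∧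
      ∀ z ∈ Z, ∑ m ∈ N, a m * (crumDet h n (laguerrePoly α m)).eval z = 0 := by
    let Φ : (N → ℝ) →ₗ[ℝ] (Z → ℝ) :=
      LinearMap.pi fun z => ∑ m : N, (crumDet h n (laguerrePoly α m)).eval (z : ℝ)
        • LinearMap.proj m
    have hker : LinearMap.ker Φ ≠ ⊥ := LinearMap.ker_ne_bot_of_finrank_lt (by simpa using hlt)
    obtain ⟨b, hb, hb0⟩ := (Submodule.ne_bot_iff _).1 hker
    obtain ⟨z0, hz0⟩ := Function.ne_iff.1 hb0
    refine ⟨fun z => if h : z ∈ N then b ⟨z, h⟩ else 0, ⟨z0, z0.2, by simpa using hz0⟩,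
      fun m hm => ?_⟩
    have h1 := congrFun (LinearMap.mem_ker.1 hb) ⟨m, hm⟩
    simp only [Φ, LinearMap.pi_apply, LinearMap.sum_apply, LinearMap.smul_apply,
      LinearMap.proj_apply, smul_eq_mul, Pi.zero_apply] at h1
    rw [← Finset.sum_coe_sort, ← h1]
    refine Finset.sum_congr rfl fun z _ => ?_
    simp [mul_comm]
  set y : ℝ[X] := ∑ m ∈ N, C (a m) * laguerrePoly α m with hy
  set Py : ℝ[X] := ∑ m ∈ N, C (a m * ∏ j ∈ Finset.range n, ((m : ℝ) - k j)) * laguerrePoly α m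
    with hPy
  have hAy : crumDet h n y = ∑ m ∈ N, C (a m) * crumDet h n (laguerrePoly α m) := by
    rw [hy]
    generalize N = s
    induction s using Finset.induction_on with
    | empty => simpa using crumDet_C_mul h n 0 0
    | insert i s hi ih =>
      rw [Finset.sum_insert hi, Finset.sum_insert hi, crumDet_add, crumDet_C_mul, ih]
  obtain ⟨Nu, D, hD0, hcop, hid⟩ := exists_crumDet_sq_eq h0 N a y Py hy hPy
  have hDne : D ≠ 0 := by rintro rfl; simp at hD0
  have hD : ∀ x, 0 ≤ x → D.eval x ≠ 0 := by
    intro x hx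
    rcases hx.eq_or_lt with rfl | hx
    · exact hD0
    · refine not_isRoot_of_simple hx hF (fun hr => (hZ x hx hr).2) (fun hr => ?_) hcop hDne hid
      rw [IsRoot, hAy, eval_finsetSum, ← haZ x (hZ x hx hr).1]
      simp
  have hnn := lagInt_nonneg_of_identity hα hF hD hid
  have hval : lagInt α 0 (y * Py)
      = ∑ m ∈ N, (∏ j ∈ Finset.range n, ((m : ℝ) - k j)) * (a m ^ 2 * lagNorm α m) := by
    rw [hPy, Finset.mul_sum, lagInt_sum hα le_rfl]
    refine Finset.sum_congr rfl fun m hm => ?_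
    rw [mul_left_comm, lagInt_C_mul, hy, Finset.sum_mul, lagInt_sum hα le_rfl,
      Finset.sum_eq_single m]
    · rw [mul_assoc (C (a m)), lagInt_C_mul, lagNorm]; ring
    · intro j _ hj
      rw [mul_assoc, lagInt_C_mul, lagInt_mul_laguerrePoly_of_ne hα hj, mul_zero]
    · exact fun h => absurd hm h
  rw [hval] at hnn
  refine absurd hnn (not_le.2 (Finset.sum_neg' (fun m hm => ?_) ⟨m0, hm0, ?_⟩))
  · have := lagNorm_pos hα m
    exact mul_nonpos_of_nonpos_of_nonneg (hN m hm).le (by positivity)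
  · have := lagNorm_pos hα m0
    exact mul_neg_of_neg_of_pos (hN m0 hm0) (by positivity)

end LowerBound

/-! ### Positivity of binomial determinants. -/

theorem det_sum_columns {R : Type*} [CommRing R] {n : ℕ} (A : Fin n → Finset ℕ)
    (v : Fin n → Fin n → ℕ → R) :
    (Matrix.of fun r c : Fin n => ∑ s ∈ A c, v r c s).det
      = ∑ σ ∈ Fintype.piFinset A, (Matrix.of fun r c : Fin n => v r c (σ c)).det := by
  have h := (Matrix.detRowAlternating (n := Fin n) (R := R)).toMultilinearMap.map_sum_finset
    (fun c s r => v r c s) A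
  simp only [AlternatingMap.coe_multilinearMap] at h
  rw [← Matrix.det_transpose]
  have e1 : (Matrix.of fun r c : Fin n => ∑ s ∈ A c, v r c s).transpose
      = fun c => ∑ s ∈ A c, fun r => v r c s := by
    ext c r; simp [Finset.sum_apply]
  rw [e1]
  refine Eq.trans h (Finset.sum_congr rfl fun σ _ => ?_)
  rw [← Matrix.det_transpose]
  rfl

theorem sum_Ico_choose (a b i : ℕ) (hab : a ≤ b) :
    (∑ s ∈ Finset.Ico a b, (s.choose i : ℝ)) = b.choose (i + 1) - a.choose (i + 1) := by
  induction b, hab using Nat.le_induction with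
  | base => simp
  | succ b hb ih =>
    rw [Finset.sum_Ico_succ_top hb, ih, Nat.choose_succ_succ]; push_cast; ring

/-- The determinant of the binomial matrix with rows indexed by `i` and columns by `k`. -/
noncomputable def chooseDet {n : ℕ} (k i : Fin n → ℕ) : ℝ :=
  (Matrix.of fun r c : Fin n => ((k c).choose (i r) : ℝ)).det

/-- The columns of the binomial matrix telescope. -/
theorem chooseDet_succ_rows {n : ℕ} {k i : Fin (n + 1) → ℕ} (hk : StrictMono k) :
    chooseDet k (fun r => i r + 1)
      = ∑ σ ∈ Fintype.piFinset fun c : Fin (n + 1) =>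
          Finset.Ico ((Fin.cons 0 (fun c : Fin n => k c.castSucc) : Fin (n + 1) → ℕ) c) (k c),
        chooseDet σ i := by
  unfold chooseDet
  rw [← det_sum_columns (fun c : Fin (n + 1) =>
          Finset.Ico ((Fin.cons 0 (fun c : Fin n => k c.castSucc) : Fin (n + 1) → ℕ) c) (k c))
          (fun r _ s => ((s.choose (i r) : ℕ) : ℝ))]
  refine Matrix.det_eq_of_forall_col_eq_smul_add_pred (fun _ => 1) (fun r => ?_) fun r c => ?_
  · simp only [Matrix.of_apply, Fin.cons_zero]
    rw [sum_Ico_choose _ _ _ (Nat.zero_le _)]; simp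
  · simp only [Matrix.of_apply, Fin.cons_succ]
    rw [sum_Ico_choose _ _ _ (hk (Fin.castSucc_lt_succ)).le]; ring

/-- Subtracting neighbouring columns turns the row of ones into (1, 0, …, 0); the remaining entries
are hockey-stick sums, expanded by multilinearity. -/
theorem chooseDet_cons_zero {n : ℕ} {k : Fin (n + 1) → ℕ} {i : Fin n → ℕ} (hk : StrictMono k) :
    chooseDet k (Fin.cons 0 fun r => i r + 1)
      = ∑ σ ∈ Fintype.piFinset fun c : Fin n => Finset.Ico (k c.castSucc) (k c.succ),
        chooseDet σ i := by
  unfold chooseDet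
  rw [← det_sum_columns (fun c : Fin n => Finset.Ico (k c.castSucc) (k c.succ))
          (fun r _ s => ((s.choose (i r) : ℕ) : ℝ))]
  set B : Matrix (Fin (n + 1)) (Fin (n + 1)) ℝ := Matrix.of fun r c =>
    Fin.cases ((k 0).choose ((Fin.cons 0 fun r => i r + 1 : Fin (n + 1) → ℕ) r) : ℝ)
      (fun c => ((k c.succ).choose ((Fin.cons 0 fun r => i r + 1 : Fin (n + 1) → ℕ) r) : ℝ)
        - (k c.castSucc).choose ((Fin.cons 0 fun r => i r + 1 : Fin (n + 1) → ℕ) r)) c with hB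
  rw [Matrix.det_eq_of_forall_col_eq_smul_add_pred (B := B) (fun _ => 1) (fun r => by simp [hB])
    fun r c => by simp [hB]]
  rw [Matrix.det_succ_row_zero, Fin.sum_univ_succ, Finset.sum_eq_zero]
  · simp only [Fin.val_zero, pow_zero, one_mul, add_zero]
    have : B 0 0 = 1 := by simp [hB]
    rw [this, one_mul]
    congr 1
    ext r c
    simp only [Matrix.submatrix_apply, Fin.succAbove_zero, hB, Matrix.of_apply, Fin.cases_succ,
      Fin.cons_succ]
    rw [sum_Ico_choose _ _ _ (hk (Fin.castSucc_lt_succ)).le]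
  · intro c _
    simp [hB]

/-- Induction on the size and on the first row index: telescoping lowers all row indices by one and,
when the first is 0, also removes a row. The new column indices interlace k, hence are again
strictly increasing, so every term is nonnegative. -/
theorem chooseDet_nonneg_and_pos {n : ℕ} : ∀ {k i : Fin n → ℕ}, StrictMono k → StrictMono i →
    0 ≤ chooseDet k i ∧ ((∀ j, i j ≤ k j) → 0 < chooseDet k i) := by
  induction n with
  | zero => intro k i _ _; simp [chooseDet]
  | succ n ih =>
    have key : ∀ d : ℕ, ∀ {k i : Fin (n + 1) → ℕ}, i 0 = d → StrictMono k → StrictMono i →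
        0 ≤ chooseDet k i ∧ ((∀ j, i j ≤ k j) → 0 < chooseDet k i) := by
      intro d
      induction d with
      | zero =>
        intro k i hi0 hk hi
        have hpos : ∀ r : Fin n, 0 < i r.succ := fun r =>
          (Nat.zero_le _).trans_lt (hi (Fin.succ_pos r))
        have hi' : i = Fin.cons 0 fun r : Fin n => (i r.succ - 1) + 1 := by
          funext r
          refine Fin.cases ?_ (fun r => ?_) r
          · simp [hi0]
          · have := hpos r
            simp only [Fin.cons_succ]; omega
        have him : StrictMono fun r : Fin n => i r.succ - 1 := fun a b hab => by
          have h1 := hi (Fin.succ_lt_succ_iff.2 hab)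
          have h2 := hpos a
          show i a.succ - 1 < i b.succ - 1
          omega
        have hσ : ∀ σ ∈ Fintype.piFinset fun c : Fin n => Finset.Ico (k c.castSucc) (k c.succ),
            StrictMono σ := by
          intro σ hσ a b hab
          rw [Fintype.mem_piFinset] at hσ
          have h1 := (Finset.mem_Ico.1 (hσ a)).2
          have h2 := (Finset.mem_Ico.1 (hσ b)).1
          have h3 : k a.succ ≤ k b.castSucc := hk.monotone (by
            rw [Fin.le_def]; simp only [Fin.val_succ, Fin.val_castSucc]; exact hab)
          omega
        rw [hi', chooseDet_cons_zero hk]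
        refine ⟨Finset.sum_nonneg fun σ h => (ih (hσ σ h) him).1, fun hle => ?_⟩
        -- The largest admissible choice inherits domination over the lowered rows, so its term is
        -- positive.
        have hmem : (fun c : Fin n => k c.succ - 1) ∈
            Fintype.piFinset fun c : Fin n => Finset.Ico (k c.castSucc) (k c.succ) := by
          rw [Fintype.mem_piFinset]
          intro c
          have := hk (Fin.castSucc_lt_succ (i := c))
          rw [Finset.mem_Ico]; omega
        refine Finset.sum_pos' (fun σ h => (ih (hσ σ h) him).1) ⟨_, hmem, ?_⟩
        refine (ih (hσ _ hmem) him).2 fun j => ?_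
        have h1 := hle j.succ
        simp only [Fin.cons_succ] at h1
        omega
      | succ d ihd =>
        intro k i hi0 hk hi
        have hpos : ∀ r : Fin (n + 1), 0 < i r := fun r => by
          have := hi.monotone (Fin.zero_le r); omega
        have hi' : i = fun r => (i r - 1) + 1 := by
          funext r; have := hpos r; omega
        have him : StrictMono fun r => i r - 1 := fun a b hab => by
          have h1 := hi hab
          have h2 := hpos a
          show i a - 1 < i b - 1
          omega
        have hσ : ∀ σ ∈ Fintype.piFinset fun c : Fin (n + 1) =>
            Finset.Ico ((Fin.cons 0 (fun c : Fin n => k c.castSucc) : Fin (n + 1) → ℕ) c) (k c),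
            StrictMono σ := by
          intro σ hσ
          rw [Fin.strictMono_iff_lt_succ]
          intro a
          rw [Fintype.mem_piFinset] at hσ
          have h1 := (Finset.mem_Ico.1 (hσ a.castSucc)).2
          have h2 := (Finset.mem_Ico.1 (hσ a.succ)).1
          simp only [Fin.cons_succ] at h2
          omega
        rw [hi', chooseDet_succ_rows hk]
        have hi0' : (fun r => i r - 1) 0 = d := by simp only [hi0]; omega
        refine ⟨Finset.sum_nonneg fun σ h => (ihd hi0' (hσ σ h) him).1, fun hle => ?_⟩
        have hmem : (fun c => k c - 1) ∈ Fintype.piFinset fun c : Fin (n + 1) =>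
            Finset.Ico ((Fin.cons 0 (fun c : Fin n => k c.castSucc) : Fin (n + 1) → ℕ) c) (k c) := by
          rw [Fintype.mem_piFinset]
          intro c
          refine Fin.cases ?_ (fun c => ?_) c
          · have h0 : i 0 - 1 + 1 ≤ k 0 := hle 0
            show k 0 - 1 ∈ Finset.Ico 0 (k 0)
            rw [Finset.mem_Ico]; omega
          · have := hk (Fin.castSucc_lt_succ (i := c))
            rw [Finset.mem_Ico, Fin.cons_succ]; omega
        refine Finset.sum_pos' (fun σ h => (ihd hi0' (hσ σ h) him).1) ⟨_, hmem, ?_⟩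
        refine (ihd hi0' (hσ _ hmem) him).2 fun j => ?_
        have h1 := hle j
        simp only at h1 ⊢
        omega
    intro k i hk hi
    exact key _ rfl hk hi

theorem chooseDet_pos {n : ℕ} {k i : Fin n → ℕ} (hk : StrictMono k) (hi : StrictMono i)
    (h : ∀ j, i j ≤ k j) : 0 < chooseDet k i :=
  (chooseDet_nonneg_and_pos hk hi).2 h

/-! ### The Wronskian as an explicit polynomial in x and α. -/

/-- The coefficient of `x ^ i` in `L_k^{(α)}` without its factor depending on `α`. -/
noncomputable def signedChoose (i k : ℕ) : ℝ := (-1) ^ i * (k.choose i : ℝ) / k.factorial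

/-- The Wronskian of the monomials with exponents `σ`, at `1`. -/
noncomputable def descDet {n : ℕ} (σ : Fin n → ℕ) : ℝ :=
  (Matrix.of fun r c : Fin n => ((σ c).descFactorial r : ℝ)).det

/-- The polynomial `∏ (X + s + 1)` over `i ≤ s < N`. -/
noncomputable def shiftedFactor (N i : ℕ) : ℝ[X] := ∏ s ∈ Finset.Ico i N, (X + C ((s : ℝ) + 1))

theorem val_le_of_strictMono {n : ℕ} {σ : Fin n → ℕ} (hσ : StrictMono σ) (j : Fin n) :
    (j : ℕ) ≤ σ j := by
  obtain ⟨j, hj⟩ := j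
  induction j with
  | zero => exact Nat.zero_le _
  | succ j ih =>
    exact (ih (by omega)).trans_lt (hσ (by simp [Fin.lt_def] : (⟨j, _⟩ : Fin n) < ⟨j + 1, hj⟩))

theorem descDet_pos {n : ℕ} {σ : Fin n → ℕ} (hσ : StrictMono σ) : 0 < descDet σ := by
  have h : descDet σ = (∏ r : Fin n, ((r : ℕ).factorial : ℝ)) * chooseDet σ fun r => r := by
    unfold descDet chooseDet
    rw [← Matrix.det_mul_column]
    congr 1
    ext r c
    simp [Nat.descFactorial_eq_factorial_mul_choose]
  rw [h]
  refine mul_pos (Finset.prod_pos fun r _ => by positivity)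
    (chooseDet_pos hσ (fun a b hab => hab) fun j => ?_)
  exact val_le_of_strictMono hσ j

theorem descDet_eq_zero {n : ℕ} {σ : Fin n → ℕ} (hσ : ¬ Function.Injective σ) :
    descDet σ = 0 := by
  simp only [Function.Injective, not_forall] at hσ
  obtain ⟨a, b, hab, hne⟩ := hσ
  exact Matrix.det_zero_of_column_eq hne fun r => by simp [hab]

theorem descDet_comp {n : ℕ} (σ : Fin n → ℕ) (π : Equiv.Perm (Fin n)) :
    descDet (σ ∘ π) = (Equiv.Perm.sign π : ℤ) * descDet σ := by
  unfold descDet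
  rw [← Matrix.det_permute']
  rfl

/-- The product over i ≤ s < k is completed to i ≤ s < N, after which the dependence on α involves
the exponent i alone. This is why the expansion can be grouped by exponent sets. -/
theorem lagCoeff_mul_shiftedFactor {N k i : ℕ} (α : ℝ) (hk : k ≤ N) :
    lagCoeff α k i * (shiftedFactor N k).eval α
      = signedChoose i k * (shiftedFactor N i).eval α := by
  unfold lagCoeff signedChoose shiftedFactor
  split_ifs with h
  · simp only [eval_prod, eval_add, eval_X, eval_C]
    rw [← Finset.prod_Ico_consecutive _ h hk, Nat.cast_choose ℝ h]
    have h1 : ((k.factorial : ℕ) : ℝ) ≠ 0 := by positivity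
    simp only [add_assoc]
    field_simp
  · rw [Nat.choose_eq_zero_of_lt (not_le.1 h)]; simp

/-- Scaling row r by X^r makes the exponents constant along columns; where σ c - r truncates, the
falling factorial is zero. -/
theorem X_pow_mul_det_descFactorial {n : ℕ} (σ : Fin n → ℕ) :
    (X : ℝ[X]) ^ (∑ r ∈ Finset.range n, r)
        * (Matrix.of fun r c : Fin n =>
            C ((σ c).descFactorial r : ℝ) * (X : ℝ[X]) ^ (σ c - r)).det
      = C (descDet σ) * X ^ (∑ c, σ c) := by
  have h1 : (X : ℝ[X]) ^ (∑ r ∈ Finset.range n, r) = ∏ r : Fin n, X ^ (r : ℕ) := by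
    rw [Finset.prod_pow_eq_pow_sum, Fin.sum_univ_eq_sum_range (fun r => r)]
  rw [h1, ← Matrix.det_mul_column, ← Finset.prod_pow_eq_pow_sum, mul_comm]
  unfold descDet
  rw [RingHom.map_det, ← Matrix.det_mul_row]
  congr 1
  ext r c : 2
  simp only [Matrix.of_apply, RingHom.mapMatrix_apply, Matrix.map_apply]
  rcases le_or_gt (r : ℕ) (σ c) with h | h
  · rw [mul_left_comm, ← pow_add, Nat.add_sub_cancel' h, mul_comm]
  · simp [Nat.descFactorial_of_lt h]

theorem X_pow_mul_wronskianDet_laguerrePoly {n N : ℕ} {k : Fin n → ℕ} (α : ℝ)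
    (hk : ∀ c, k c ≤ N) :
    X ^ (∑ r ∈ Finset.range n, r)
        * (C (∏ c, (shiftedFactor N (k c)).eval α) * wronskianDet fun c => laguerrePoly α (k c))
      = ∑ σ ∈ Fintype.piFinset fun _ : Fin n => Finset.range (N + 1),
          C (((∏ c, signedChoose (σ c) (k c)) * descDet σ)
            * ∏ c, (shiftedFactor N (σ c)).eval α) * X ^ (∑ c, σ c) := by
  have hL : ∀ c, laguerrePoly α (k c)
      = ∑ s ∈ Finset.range (N + 1), C (lagCoeff α (k c) s) * X ^ s := by
    intro c
    rw [Polynomial.as_sum_range' (laguerrePoly α (k c)) (N + 1)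
      (by rw [natDegree_laguerrePoly]; exact Nat.lt_succ_of_le (hk c))]
    simp only [coeff_laguerrePoly, C_mul_X_pow_eq_monomial]
  have hW : (wronskianDet fun c => laguerrePoly α (k c))
      = (Matrix.of fun r c : Fin n => ∑ s ∈ Finset.range (N + 1),
          C (lagCoeff α (k c) s) * (C ((s.descFactorial r : ℕ) : ℝ) * X ^ (s - r))).det := by
    unfold wronskianDet
    congr 1
    refine Matrix.ext fun r c => ?_
    simp only [Matrix.of_apply]
    rw [hL c, Polynomial.iterate_derivative_sum (r : ℕ) (Finset.range (N + 1))]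
    refine Finset.sum_congr rfl fun s _ => ?_
    rw [Polynomial.iterate_derivative_C_mul, Polynomial.iterate_derivative_X_pow_eq_C_mul]
  rw [hW, det_sum_columns (fun _ => Finset.range (N + 1))
    (fun r c s => C (lagCoeff α (k c) s) * (C ((s.descFactorial r : ℕ) : ℝ) * X ^ (s - r))),
    Finset.mul_sum, Finset.mul_sum]
  refine Finset.sum_congr rfl fun σ _ => ?_
  have h2 : (Matrix.of fun r c : Fin n => C (lagCoeff α (k c) (σ c))
        * (C (((σ c).descFactorial r : ℕ) : ℝ) * (X : ℝ[X]) ^ (σ c - r))).det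
      = C (∏ c, lagCoeff α (k c) (σ c)) * (Matrix.of fun r c : Fin n =>
            C ((σ c).descFactorial r : ℝ) * (X : ℝ[X]) ^ (σ c - r)).det := by
    rw [map_prod, ← Matrix.det_mul_row]; rfl
  have h3 : (∏ c, (shiftedFactor N (k c)).eval α) * ∏ c, lagCoeff α (k c) (σ c)
      = (∏ c, signedChoose (σ c) (k c)) * ∏ c, (shiftedFactor N (σ c)).eval α := by
    rw [← Finset.prod_mul_distrib, ← Finset.prod_mul_distrib]
    exact Finset.prod_congr rfl fun c _ => by
      rw [mul_comm, lagCoeff_mul_shiftedFactor α (hk c)]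
  rw [h2, ← mul_assoc (C _) (C _), ← C_mul, h3, mul_left_comm, X_pow_mul_det_descFactorial,
    ← mul_assoc, ← C_mul]
  congr 2
  ring

/-- The coefficient belonging to the exponent set `I` in the expansion of the Wronskian. -/
noncomputable def wronskianKappa (N : ℕ) {n : ℕ} (k : Fin n → ℕ) (I : Finset ℕ) : ℝ :=
  ∑ σ ∈ (Fintype.piFinset fun _ : Fin n => Finset.range (N + 1)) with
    Finset.univ.image σ = I, (∏ c, signedChoose (σ c) (k c)) * descDet σ

/-- The Wronskian of Laguerre polynomials as a polynomial in `x` over `ℝ[α]`, denominators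
cleared. -/
noncomputable def wronskianPencil (N : ℕ) {n : ℕ} (k : Fin n → ℕ) : ℝ[X][X] :=
  ∑ I ∈ (Finset.range (N + 1)).powersetCard n,
    monomial (∑ i ∈ I, i - ∑ r ∈ Finset.range n, r)
      (C (wronskianKappa N k I) * ∏ i ∈ I, shiftedFactor N i)

theorem sum_Ico_le_sum {c n : ℕ} {I : Finset ℕ} (hc : ∀ i ∈ I, c ≤ i) (hn : I.card = n) :
    ∑ s ∈ Finset.range n, (c + s) ≤ ∑ i ∈ I, i
      ∧ (∑ i ∈ I, i = ∑ s ∈ Finset.range n, (c + s) → I = Finset.Ico c (c + n)) := by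
  induction n generalizing I with
  | zero => rw [Finset.card_eq_zero] at hn; subst hn; simp
  | succ n ih =>
    have hne : I.Nonempty := Finset.card_pos.1 (by omega)
    set M := I.max' hne with hM
    have hMI : M ∈ I := Finset.max'_mem _ _
    have hsub : I ⊆ Finset.Ico c (M + 1) := fun i hi =>
      Finset.mem_Ico.2 ⟨hc i hi, Nat.lt_succ_of_le (Finset.le_max' _ _ hi)⟩
    have hcard := Finset.card_le_card hsub
    rw [Nat.card_Ico, hn] at hcard
    obtain ⟨h1, h2⟩ := ih (I := I.erase M) (fun i hi => hc i (Finset.mem_of_mem_erase hi))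
      (by rw [Finset.card_erase_of_mem hMI]; omega)
    have h3 := Finset.sum_erase_add I (fun i => i) hMI
    rw [Finset.sum_range_succ]
    refine ⟨by omega, fun h => Finset.eq_of_subset_of_card_le ?_ (by simp [hn])⟩
    intro i hi
    have := Finset.le_max' _ _ hi
    have := hc i hi
    rw [Finset.mem_Ico]
    omega

theorem sum_range_le_sum {n : ℕ} {I : Finset ℕ} (hn : I.card = n) :
    ∑ s ∈ Finset.range n, s ≤ ∑ i ∈ I, i
      ∧ (∑ i ∈ I, i = ∑ s ∈ Finset.range n, s → I = Finset.range n) := by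
  have := sum_Ico_le_sum (c := 0) (fun i _ => Nat.zero_le i) hn
  simpa using this

/-- The expansion is grouped by the image I of σ; terms with repeated exponents drop out because
their monomial Wronskian is zero. -/
theorem wronskianPencil_map {n N : ℕ} {k : Fin n → ℕ} (α : ℝ) (hk : ∀ c, k c ≤ N) :
    (wronskianPencil N k).map (evalRingHom α)
      = C (∏ c, (shiftedFactor N (k c)).eval α) * wronskianDet fun c => laguerrePoly α (k c) := by
  have hX : (X : ℝ[X]) ^ (∑ r ∈ Finset.range n, r) ≠ 0 := pow_ne_zero _ X_ne_zero
  refine mul_left_cancel₀ hX ?_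
  rw [X_pow_mul_wronskianDet_laguerrePoly α hk]
  set S := Fintype.piFinset fun _ : Fin n => Finset.range (N + 1)
  have hinj : ∀ σ ∈ S, σ ∉ S.filter Function.Injective →
      C (((∏ c, signedChoose (σ c) (k c)) * descDet σ)
            * ∏ c, (shiftedFactor N (σ c)).eval α) * (X : ℝ[X]) ^ (∑ c, σ c) = 0 := by
    intro σ hσ hn
    rw [Finset.mem_filter, not_and] at hn
    rw [descDet_eq_zero (hn hσ)]; simp
  rw [← Finset.sum_subset (Finset.filter_subset _ _) hinj]
  rw [← Finset.sum_fiberwise_of_maps_to (s := S.filter Function.Injective)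
    (t := (Finset.range (N + 1)).powersetCard n) (g := fun σ => Finset.univ.image σ)]
  · unfold wronskianPencil
    rw [Polynomial.map_sum, Finset.mul_sum]
    refine Finset.sum_congr rfl fun I hI => ?_
    obtain ⟨hI1, hI2⟩ := Finset.mem_powersetCard.1 hI
    rw [Polynomial.map_monomial, ← C_mul_X_pow_eq_monomial, mul_left_comm, ← pow_add,
      Nat.add_sub_cancel' (sum_range_le_sum hI2).1]
    have h1 : ∀ σ ∈ (S.filter Function.Injective).filter (fun σ => Finset.univ.image σ = I),
        C (((∏ c, signedChoose (σ c) (k c)) * descDet σ)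
            * ∏ c, (shiftedFactor N (σ c)).eval α) * (X : ℝ[X]) ^ (∑ c, σ c)
        = C ((∏ c, signedChoose (σ c) (k c)) * descDet σ)
            * (C (∏ i ∈ I, (shiftedFactor N i).eval α) * X ^ (∑ i ∈ I, i)) := by
      intro σ hσ
      rw [Finset.mem_filter, Finset.mem_filter] at hσ
      obtain ⟨⟨-, hi⟩, rfl⟩ := hσ
      rw [Finset.prod_image fun a _ b _ h => hi h, Finset.sum_image fun a _ b _ h => hi h, C_mul,
        mul_assoc]
    rw [Finset.sum_congr rfl h1, ← Finset.sum_mul, ← map_sum, ← mul_assoc, ← C_mul]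
    congr 2
    simp only [coe_evalRingHom, eval_mul, eval_C, eval_prod]
    congr 1
    unfold wronskianKappa
    symm
    rw [Finset.filter_filter]
    refine Finset.sum_subset (fun σ hσ => ?_) fun σ hσ hn => ?_
    · simp only [Finset.mem_filter] at hσ ⊢
      exact ⟨hσ.1, hσ.2.2⟩
    · simp only [Finset.mem_filter] at hσ hn
      rw [descDet_eq_zero fun hi => hn ⟨hσ.1, hi, hσ.2⟩, mul_zero]
  · intro σ hσ
    rw [Finset.mem_filter, Fintype.mem_piFinset] at hσ
    rw [Finset.mem_powersetCard]
    refine ⟨fun i hi => ?_, ?_⟩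
    · obtain ⟨c, -, rfl⟩ := Finset.mem_image.1 hi
      exact hσ.1 c
    · rw [Finset.card_image_of_injective _ hσ.2]; simp

theorem exists_of_wronskianKappa_ne_zero {n N : ℕ} {k : Fin n → ℕ} {I : Finset ℕ}
    (h : wronskianKappa N k I ≠ 0) :
    ∃ σ : Fin n → ℕ, Function.Injective σ ∧ Finset.univ.image σ = I ∧ ∀ c, σ c ≤ k c := by
  obtain ⟨σ, hσ, hne⟩ := Finset.exists_ne_zero_of_sum_ne_zero h
  refine ⟨σ, ?_, (Finset.mem_filter.1 hσ).2, fun c => ?_⟩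
  · by_contra hi
    rw [descDet_eq_zero hi, mul_zero] at hne
    exact hne rfl
  · have h1 := Finset.prod_ne_zero_iff.1 (left_ne_zero_of_mul hne) c (Finset.mem_univ c)
    by_contra hlt
    refine h1 ?_
    simp [signedChoose, Nat.choose_eq_zero_of_lt (not_le.1 hlt)]

/-- The sum over orderings of the exponent set factors as a signed, rescaled binomial determinant
times a monomial Wronskian, both nonzero by positivity. -/
theorem wronskianKappa_ne_zero {n N : ℕ} {k i : Fin n → ℕ} (hk : StrictMono k)
    (hkN : ∀ c, k c ≤ N) (hi : StrictMono i) (hik : ∀ c, i c ≤ k c) :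
    wronskianKappa N k (Finset.univ.image i) ≠ 0 := by
  have h1 : wronskianKappa N k (Finset.univ.image i)
      = ∑ π : Equiv.Perm (Fin n), (∏ c, signedChoose (i (π c)) (k c)) * descDet (i ∘ π) := by
    symm
    unfold wronskianKappa
    refine Finset.sum_of_injOn (fun π => i ∘ π) ?_ ?_ ?_ ?_
    · intro π _ π' _ h
      exact Equiv.ext fun c => hi.injective (congrFun h c)
    · intro π _
      simp only [Finset.coe_filter, Set.mem_ofPred_eq, Fintype.mem_piFinset, Finset.mem_range]
      refine ⟨fun c => Nat.lt_succ_of_le ((hik _).trans (hkN _)), ?_⟩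
      ext x
      simp only [Finset.mem_image, Finset.mem_univ, true_and, Function.comp]
      exact ⟨fun ⟨a, ha⟩ => ⟨_, ha⟩, fun ⟨a, ha⟩ => ⟨π.symm a, by simpa using ha⟩⟩
    · intro σ hσ hn
      have hσ2 := (Finset.mem_filter.1 hσ).2
      have hni : ¬ Function.Injective σ := by
        intro hinj
        have hex : ∀ c, ∃ d, i d = σ c := fun c => by
          have : σ c ∈ Finset.univ.image σ := Finset.mem_image_of_mem _ (Finset.mem_univ c)
          rw [hσ2] at this
          obtain ⟨d, -, hd⟩ := Finset.mem_image.1 this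
          exact ⟨d, hd⟩
        choose π hπ using hex
        have hπi : Function.Injective π := fun a b hab => hinj (by rw [← hπ a, ← hπ b, hab])
        refine hn ⟨Equiv.ofBijective π (Finite.injective_iff_bijective.1 hπi),
          by simp, ?_⟩
        funext c
        simp [hπ c]
      rw [descDet_eq_zero hni, mul_zero]
    · intro π _
      rfl
  have h2 : wronskianKappa N k (Finset.univ.image i)
      = (Matrix.of fun r c : Fin n => signedChoose (i r) (k c)).det * descDet i := by
    rw [h1, Matrix.det_apply', Finset.sum_mul]
    refine Finset.sum_congr rfl fun π _ => ?_
    rw [descDet_comp]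
    simp only [Matrix.of_apply]
    ring
  have h3 : (Matrix.of fun r c : Fin n => signedChoose (i r) (k c)).det
      = (∏ r, (-1 : ℝ) ^ i r) * ((∏ c, ((k c).factorial : ℝ)⁻¹) * chooseDet k i) := by
    unfold chooseDet
    rw [← Matrix.det_mul_row, ← Matrix.det_mul_column]
    congr 1
    ext r c
    simp only [signedChoose, Matrix.of_apply]
    ring
  rw [h2, h3]
  refine mul_ne_zero (mul_ne_zero ?_ (mul_ne_zero ?_ (chooseDet_pos hk hi hik).ne'))
    (descDet_pos hi).ne'
  · exact Finset.prod_ne_zero_iff.2 fun r _ => pow_ne_zero _ (by norm_num)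
  · exact Finset.prod_ne_zero_iff.2 fun c _ => by positivity

/-! ### Newton polygons through weighted substitutions. -/

/-- The substitution `x ↦ x τ ^ p`, `ε ↦ ε τ ^ q` from `ℝ[ε][x]` to `ℝ[x][ε][τ]`. -/
noncomputable def weightHom (p q : ℕ) : ℝ[X][X] →+* ℝ[X][X][X] :=
  eval₂RingHom (S := ℝ[X][X][X]) (eval₂RingHom (S := ℝ[X][X][X])
    ((C : ℝ[X][X] →+* ℝ[X][X][X]).comp ((C : ℝ[X] →+* ℝ[X][X]).comp (C : ℝ →+* ℝ[X])))
    (C X * X ^ q)) (C (C X) * X ^ p)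

theorem weightHom_monomial (p q i b : ℕ) (a : ℝ) :
    weightHom p q (monomial i (monomial b a))
      = monomial (p * i + q * b) (monomial b (monomial i a)) := by
  simp only [weightHom, coe_eval₂RingHom, eval₂_monomial, RingHom.comp_apply]
  simp only [← C_mul_X_pow_eq_monomial, map_mul, map_pow, pow_add]
  ring

/-- The power of τ records the weight p i + q b, so the trailing coefficient in τ is the part of F
on a face of its Newton polygon. Multiplicativity of trailing coefficients then does the work of
Minkowski sums. -/
theorem coeff_weightHom (p q : ℕ) (F : ℝ[X][X]) (m b i : ℕ) :
    (((weightHom p q F).coeff m).coeff b).coeff i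
      = if p * i + q * b = m then (F.coeff i).coeff b else 0 := by
  induction F using Polynomial.induction_on' with
  | add F G hF hG => simp only [map_add, coeff_add, hF, hG]; split_ifs <;> simp
  | monomial i' f =>
    induction f using Polynomial.induction_on' with
    | add f g hf hg => simp only [map_add, coeff_add, hf, hg]; split_ifs <;> simp
    | monomial b' a =>
      rw [weightHom_monomial]
      by_cases hi : i' = i
      · by_cases hb : b' = b
        · subst hi hb
          by_cases hm : p * i' + q * b' = m <;> simp [coeff_monomial, hm]
        · subst hi
          rw [coeff_monomial]
          split_ifs <;> simp [coeff_monomial, hb]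
      · by_cases hb : b' = b
        · by_cases hm : p * i' + q * b = m <;> simp [coeff_monomial, hi, hb, hm]
        · by_cases hm : p * i' + q * b' = m <;> simp [coeff_monomial, hi, hb, hm]

theorem weightHom_ne_zero {p q : ℕ} {F : ℝ[X][X]} (hF : F ≠ 0) : weightHom p q F ≠ 0 := by
  intro h
  refine hF (Polynomial.ext fun i => Polynomial.ext fun b => ?_)
  have := coeff_weightHom p q F (p * i + q * b) b i
  rw [h] at this
  simpa using this.symm

theorem exists_of_trailingCoeff_weightHom {p q b : ℕ} {F : ℝ[X][X]}
    (hb : (weightHom p q F).trailingCoeff.coeff b ≠ 0) :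
    ∃ i, (F.coeff i).coeff b ≠ 0
      ∧ ∀ i' b', (F.coeff i').coeff b' ≠ 0 → p * i + q * b ≤ p * i' + q * b' := by
  obtain ⟨i, hi⟩ : ∃ i, ((weightHom p q F).trailingCoeff.coeff b).coeff i ≠ 0 := by
    by_contra! h
    exact hb (Polynomial.ext fun i => by simpa using h i)
  rw [trailingCoeff, coeff_weightHom] at hi
  by_cases hm : p * i + q * b = (weightHom p q F).natTrailingDegree
  · rw [if_pos hm] at hi
    refine ⟨i, hi, fun i' b' h => ?_⟩
    rw [hm]
    refine natTrailingDegree_le_of_ne_zero fun h0 => h ?_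
    have := coeff_weightHom p q F (p * i' + q * b') b' i'
    rw [h0] at this
    simpa using this.symm
  · rw [if_neg hm] at hi
    exact absurd rfl hi

theorem trailingCoeff_weightHom_coeff_ne_zero {p q i b : ℕ} {F : ℝ[X][X]}
    (h : (F.coeff i).coeff b ≠ 0)
    (hmin : ∀ i' b', (F.coeff i').coeff b' ≠ 0 → p * i + q * b ≤ p * i' + q * b') :
    (weightHom p q F).trailingCoeff.coeff b ≠ 0 := by
  have hc := coeff_weightHom p q F (p * i + q * b) b i
  rw [if_pos rfl] at hc
  have hF : F ≠ 0 := by rintro rfl; simp at h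
  have hm : (weightHom p q F).natTrailingDegree = p * i + q * b := by
    refine le_antisymm (natTrailingDegree_le_of_ne_zero fun h0 => h ?_) ?_
    · rw [h0] at hc; simpa using hc.symm
    · refine le_natTrailingDegree (weightHom_ne_zero hF) fun m hm => ?_
      refine Polynomial.ext fun b' => Polynomial.ext fun i' => ?_
      rw [coeff_weightHom]
      split_ifs with hw
      · by_contra hne
        have := hmin i' b' (by simpa using hne)
        omega
      · simp
  intro h0
  rw [trailingCoeff, hm] at h0
  rw [h0] at hc
  exact h (by simpa using hc.symm)

/-- If `G ^ 2` divides `F` and the Newton polygon of `G` has an edge of finite negative slope at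
its vertex on the `ε`-axis, then some edge of `F` has height at least two. -/
theorem exists_long_edge_of_sq_mul {F G H : ℝ[X][X]} (hF : F = G ^ 2 * H) (hF0 : F ≠ 0)
    (h00 : (G.coeff 0).coeff 0 = 0) (h0 : G.coeff 0 ≠ 0) (hx : ∃ i, (G.coeff i).coeff 0 ≠ 0) :
    ∃ p q i₁ b₁ i₂ b₂ : ℕ, 0 < p ∧ 0 < q ∧ (F.coeff i₁).coeff b₁ ≠ 0 ∧ (F.coeff i₂).coeff b₂ ≠ 0 ∧
      (∀ i b, (F.coeff i).coeff b ≠ 0 → p * i₁ + q * b₁ ≤ p * i + q * b) ∧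
      (∀ i b, (F.coeff i).coeff b ≠ 0 → p * i₂ + q * b₂ ≤ p * i + q * b) ∧ b₁ + 2 ≤ b₂ := by
  set a := (G.coeff 0).natTrailingDegree with ha
  have ha0 : (G.coeff 0).coeff a ≠ 0 := by
    have := trailingCoeff_nonzero_iff_nonzero.2 h0
    rwa [trailingCoeff] at this
  have hapos : 0 < a := by
    rcases Nat.eq_zero_or_pos a with h | h
    · rw [h] at ha0; exact absurd h00 ha0
    · exact h
  have halt : ∀ j < a, (G.coeff 0).coeff j = 0 := fun j hj =>
    coeff_eq_zero_of_lt_natTrailingDegree hj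
  set S : Finset (ℕ × ℕ) := (Finset.range (G.natDegree + 1) ×ˢ Finset.range a).filter
    fun z => (G.coeff z.1).coeff z.2 ≠ 0 with hS
  have hmemS : ∀ i j, (G.coeff i).coeff j ≠ 0 → j < a → (i, j) ∈ S := by
    intro i j h hj
    rw [hS, Finset.mem_filter, Finset.mem_product, Finset.mem_range, Finset.mem_range]
    refine ⟨⟨Nat.lt_succ_of_le (le_natDegree_of_ne_zero fun h' => h ?_), hj⟩, h⟩
    rw [h']; simp
  have hSpos : ∀ z ∈ S, 0 < z.1 ∧ z.2 < a ∧ (G.coeff z.1).coeff z.2 ≠ 0 := by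
    rintro ⟨i, j⟩ hz
    rw [hS, Finset.mem_filter, Finset.mem_product, Finset.mem_range, Finset.mem_range] at hz
    refine ⟨Nat.pos_of_ne_zero ?_, hz.1.2, hz.2⟩
    rintro rfl
    exact hz.2 (halt _ hz.1.2)
  obtain ⟨i₀, hi₀⟩ := hx
  -- The steepest descent from the vertex (0, a) picks an edge; the weights a - j and i are constant
  -- along it and no smaller on the rest of the support.
  obtain ⟨⟨i, j⟩, hz, hmax⟩ := S.exists_max_image (fun z => ((a : ℚ) - z.2) / z.1)
    ⟨_, hmemS i₀ 0 hi₀ hapos⟩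
  obtain ⟨hi, hj, hij⟩ := hSpos _ hz
  simp only at hi hj hij hmax
  set p := a - j with hp
  set q := i with hq
  have hppos : 0 < p := by omega
  have hminG : ∀ i' b', (G.coeff i').coeff b' ≠ 0 → q * a ≤ p * i' + q * b' := by
    intro i' b' h
    rcases le_or_gt a b' with hb | hb
    · exact (Nat.mul_le_mul_left q hb).trans (Nat.le_add_left _ _)
    · have hm := hmemS _ _ h hb
      have hi' := (hSpos _ hm).1
      have h1 := hmax _ hm
      simp only at h1 hi'
      rw [div_le_div_iff₀ (by exact_mod_cast hi') (by exact_mod_cast hi)] at h1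
      have h2 : (p : ℚ) = a - j := by rw [hp, Nat.cast_sub hj.le]
      rw [← h2] at h1
      have : (q : ℚ) * a ≤ p * i' + q * b' := by linarith
      exact_mod_cast this
  have hwij : p * i + q * j = q * a := by
    have : p + j = a := by omega
    rw [← this]; ring
  have hta : (weightHom p q G).trailingCoeff.coeff a ≠ 0 :=
    trailingCoeff_weightHom_coeff_ne_zero (i := 0) ha0 fun i' b' h => by
      simpa using hminG i' b' h
  have htj : (weightHom p q G).trailingCoeff.coeff j ≠ 0 :=
    trailingCoeff_weightHom_coeff_ne_zero (i := i) hij fun i' b' h => by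
      rw [hwij]; exact hminG i' b' h
  set g := (weightHom p q G).trailingCoeff with hg
  -- The face part of G contains both ε^a and ε^j with j < a, so that of G² spans at least two in ε,
  -- and the cofactor can only add to the span.
  have hg1 : g.natTrailingDegree < g.natDegree :=
    (natTrailingDegree_le_of_ne_zero htj).trans_lt (hj.trans_le (le_natDegree_of_ne_zero hta))
  have hH0 : H ≠ 0 := by rintro rfl; simp at hF; exact hF0 hF
  have hG0 : G ≠ 0 := by rintro rfl; simp at h0
  have hg0 : g ≠ 0 := trailingCoeff_nonzero_iff_nonzero.2 (weightHom_ne_zero hG0)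
  set h := (weightHom p q H).trailingCoeff with hh
  have hh0 : h ≠ 0 := trailingCoeff_nonzero_iff_nonzero.2 (weightHom_ne_zero hH0)
  have hf : (weightHom p q F).trailingCoeff = g * g * h := by
    rw [hF, map_mul, map_pow, pow_two, trailingCoeff_mul, trailingCoeff_mul]
  set f := (weightHom p q F).trailingCoeff with hfdef
  have hf0 : f ≠ 0 := trailingCoeff_nonzero_iff_nonzero.2 (weightHom_ne_zero hF0)
  have hd : f.natDegree = g.natDegree + g.natDegree + h.natDegree := by
    rw [hf, natDegree_mul (mul_ne_zero hg0 hg0) hh0, natDegree_mul hg0 hg0]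
  have ht : f.natTrailingDegree
      = g.natTrailingDegree + g.natTrailingDegree + h.natTrailingDegree := by
    rw [hf, natTrailingDegree_mul (mul_ne_zero hg0 hg0) hh0, natTrailingDegree_mul hg0 hg0]
  have hle := h.natTrailingDegree_le_natDegree
  obtain ⟨i₁, hi₁, hm₁⟩ := exists_of_trailingCoeff_weightHom (p := p) (q := q) (F := F)
    (b := f.natTrailingDegree) (by
      have := trailingCoeff_nonzero_iff_nonzero.2 hf0
      rwa [trailingCoeff] at this)
  obtain ⟨i₂, hi₂, hm₂⟩ := exists_of_trailingCoeff_weightHom (p := p) (q := q) (F := F)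
    (b := f.natDegree) (by
      have := leadingCoeff_ne_zero.2 hf0
      rwa [leadingCoeff] at this)
  exact ⟨p, q, i₁, _, i₂, _, hppos, hi, hi₁, hi₂, hm₁, hm₂, by omega⟩

/-- If the total degree of a polynomial is attained on the `ε`-axis, then the same holds for its
factors. -/
theorem natDegree_coeff_zero_of_dvd {F G : ℝ[X][X]} {D : ℕ} (hGF : G ∣ F)
    (hD : (F.coeff 0).coeff D ≠ 0)
    (hmax : ∀ i b, (F.coeff i).coeff b ≠ 0 → i + b ≤ D) {i b : ℕ} (hG : (G.coeff i).coeff b ≠ 0) :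
    i + b ≤ (G.coeff 0).natDegree := by
  obtain ⟨H, hH⟩ := hGF
  have hF0 : F ≠ 0 := by rintro rfl; simp at hD
  have hdeg : ∀ {P : ℝ[X][X]} {i b : ℕ}, (P.coeff i).coeff b ≠ 0 →
      i + b ≤ (weightHom 1 1 P).natDegree := by
    intro P i b h
    refine le_natDegree_of_ne_zero fun h0 => h ?_
    have := coeff_weightHom 1 1 P (i + b) b i
    rw [h0] at this
    simpa using this.symm
  have hFD : (weightHom 1 1 F).natDegree = D := by
    refine le_antisymm (natDegree_le_iff_coeff_eq_zero.2 fun m hm => ?_) (by simpa using hdeg hD)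
    refine Polynomial.ext fun b' => Polynomial.ext fun i' => ?_
    rw [coeff_weightHom]
    split_ifs with hw
    · by_contra hne
      have := hmax i' b' (by simpa using hne)
      omega
    · simp
  -- Setting x = 0 in the top homogeneous form leaves at most one power of ε. It is nonzero for F,
  -- hence for every factor of F.
  have hev : ∀ P : ℝ[X][X], ∀ b, (((weightHom 1 1 P).leadingCoeff).map (evalRingHom 0)).coeff b ≠ 0 →
      b = (weightHom 1 1 P).natDegree ∧ (P.coeff 0).coeff b ≠ 0 := by
    intro P b h
    rw [coeff_map, coe_evalRingHom, ← coeff_zero_eq_eval_zero, leadingCoeff, coeff_weightHom] at h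
    split_ifs at h with hw
    · exact ⟨by omega, h⟩
    · exact absurd rfl h
  have hlF : ((weightHom 1 1 F).leadingCoeff).map (evalRingHom 0) ≠ 0 := by
    intro h0
    have h1 := congrArg (fun P => P.coeff D) h0
    simp only [coeff_map, coe_evalRingHom, ← coeff_zero_eq_eval_zero, leadingCoeff,
      coeff_weightHom, hFD, coeff_zero] at h1
    simp at h1
    exact hD h1
  rw [hH, map_mul, leadingCoeff_mul, Polynomial.map_mul] at hlF
  have hlG := left_ne_zero_of_mul hlF
  obtain ⟨b', hb'⟩ : ∃ b', ((((weightHom 1 1 G).leadingCoeff).map (evalRingHom 0))).coeff b' ≠ 0 := by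
    by_contra! h
    exact hlG (Polynomial.ext fun i => by simpa using h i)
  obtain ⟨h1, h2⟩ := hev G b' hb'
  have h3 := hdeg hG
  have h4 := le_natDegree_of_ne_zero h2
  omega

/-! ### The Newton polygon of the Wronskian at α = -c. -/

theorem shiftedFactor_monic (N i : ℕ) : (shiftedFactor N i).Monic :=
  monic_prod_of_monic _ _ fun _ _ => monic_X_add_C _

theorem natDegree_shiftedFactor (N i : ℕ) : (shiftedFactor N i).natDegree = N - i := by
  unfold shiftedFactor
  rw [natDegree_prod_of_monic _ _ fun _ _ => monic_X_add_C _]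
  simp only [natDegree_X_add_C, Finset.sum_const, Nat.card_Ico, smul_eq_mul, mul_one]

theorem coeff_wronskianPencil {N n : ℕ} (k : Fin n → ℕ) (m : ℕ) :
    (wronskianPencil N k).coeff m
      = ∑ I ∈ (Finset.range (N + 1)).powersetCard n with
          ∑ i ∈ I, i = m + ∑ r ∈ Finset.range n, r,
        C (wronskianKappa N k I) * ∏ i ∈ I, shiftedFactor N i := by
  unfold wronskianPencil
  rw [finsetSum_coeff, Finset.sum_filter]
  refine Finset.sum_congr rfl fun I hI => ?_
  have := (sum_range_le_sum (Finset.mem_powersetCard.1 hI).2).1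
  rw [coeff_monomial]
  exact if_congr (by omega) rfl rfl

/-- Among n-element sets only {0, …, n - 1} has the minimal sum, so a single term is free of x. -/
theorem coeff_zero_wronskianPencil {N n : ℕ} {k : Fin n → ℕ} (hk : StrictMono k)
    (hkN : ∀ c, k c ≤ N) :
    ∃ κ : ℝ, κ ≠ 0 ∧ (wronskianPencil N k).coeff 0
      = C κ * ∏ i ∈ Finset.range n, shiftedFactor N i := by
  have him : Finset.univ.image (fun j : Fin n => (j : ℕ)) = Finset.range n := by
    ext x
    simp only [Finset.mem_image, Finset.mem_univ, true_and, Finset.mem_range]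
    exact ⟨fun ⟨j, hj⟩ => hj ▸ j.2, fun h => ⟨⟨x, h⟩, rfl⟩⟩
  refine ⟨wronskianKappa N k (Finset.range n), ?_, ?_⟩
  · rw [← him]
    exact wronskianKappa_ne_zero hk hkN (fun a b h => h) (val_le_of_strictMono hk)
  · rw [coeff_wronskianPencil]
    refine Finset.sum_eq_single_of_mem (Finset.range n) ?_ fun I hI hne => ?_
    · rw [Finset.mem_filter, Finset.mem_powersetCard]
      refine ⟨⟨fun x hx => ?_, Finset.card_range n⟩, by rw [zero_add]⟩
      have h1 := Finset.mem_range.1 hx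
      have h2 := val_le_of_strictMono hk ⟨x, h1⟩
      have h3 := hkN ⟨x, h1⟩
      rw [Finset.mem_range]
      simp only at h2
      omega
    · rw [Finset.mem_filter, Finset.mem_powersetCard, zero_add] at hI
      exact absurd ((sum_range_le_sum hI.1.2).2 hI.2) hne

theorem shiftedFactor_eval_pos {α : ℝ} (hα : -1 < α) (N i : ℕ) :
    0 < (shiftedFactor N i).eval α := by
  unfold shiftedFactor
  rw [eval_prod]
  refine Finset.prod_pos fun s _ => ?_
  have : (0 : ℝ) ≤ s := Nat.cast_nonneg s
  simp only [eval_add, eval_X, eval_C]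
  linarith

theorem wronskianDet_laguerrePoly_eval_zero_ne_zero {α : ℝ} (hα : -1 < α) {n : ℕ} {k : Fin n → ℕ}
    (hk : StrictMono k) : (wronskianDet fun c => laguerrePoly α (k c)).eval 0 ≠ 0 := by
  set N := ∑ c, k c
  have hkN : ∀ c, k c ≤ N := fun c =>
    Finset.single_le_sum (f := k) (fun _ _ => Nat.zero_le _) (Finset.mem_univ c)
  obtain ⟨κ, hκ, h⟩ := coeff_zero_wronskianPencil hk hkN
  have h1 := congrArg (fun P => P.coeff 0) (wronskianPencil_map α hkN)
  simp only [coeff_map, h, coeff_C_mul, coe_evalRingHom, eval_mul, eval_C, eval_prod] at h1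
  rw [← coeff_zero_eq_eval_zero]
  intro h0
  rw [h0, mul_zero] at h1
  exact (mul_ne_zero hκ (Finset.prod_ne_zero_iff.2 fun i _ =>
    (shiftedFactor_eval_pos hα N i).ne')) h1

/-- A larger exponent sum raises the x-degree and lowers the α-degree by the same amount, so every I
has the same bound for the total degree. -/
theorem wronskianPencil_totalDegree {N n : ℕ} {k : Fin n → ℕ} (hk : StrictMono k)
    (hkN : ∀ c, k c ≤ N) :
    ∃ D, (((wronskianPencil N k).coeff 0).coeff D ≠ 0) ∧
      ∀ i b, ((wronskianPencil N k).coeff i).coeff b ≠ 0 → i + b ≤ D := by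
  obtain ⟨κ, hκ, h⟩ := coeff_zero_wronskianPencil hk hkN
  have hmon : ∀ I : Finset ℕ, (∏ i ∈ I, shiftedFactor N i).Monic := fun I =>
    monic_prod_of_monic _ _ fun i _ => shiftedFactor_monic N i
  have hdeg : ∀ I : Finset ℕ, (∏ i ∈ I, shiftedFactor N i).natDegree = ∑ i ∈ I, (N - i) :=
    fun I => by
      rw [natDegree_prod_of_monic _ _ fun i _ => shiftedFactor_monic N i]
      exact Finset.sum_congr rfl fun i _ => natDegree_shiftedFactor N i
  have hsum : ∀ I : Finset ℕ, I ⊆ Finset.range (N + 1) →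
      ∑ i ∈ I, i + ∑ i ∈ I, (N - i) = I.card * N := fun I hI => by
    rw [← Finset.sum_add_distrib, Finset.sum_congr rfl (g := fun _ => N), Finset.sum_const,
      smul_eq_mul]
    intro i hi
    have := Finset.mem_range.1 (hI hi)
    omega
  refine ⟨∑ i ∈ Finset.range n, (N - i), ?_, fun m b hmb => ?_⟩
  · rw [h, coeff_C_mul]
    have := (hmon (Finset.range n)).coeff_natDegree
    rw [hdeg] at this
    rw [this, mul_one]
    exact hκ
  · rw [coeff_wronskianPencil, finsetSum_coeff] at hmb
    obtain ⟨I, hI, hne⟩ := Finset.exists_ne_zero_of_sum_ne_zero hmb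
    rw [Finset.mem_filter, Finset.mem_powersetCard] at hI
    rw [coeff_C_mul] at hne
    have h1 := le_natDegree_of_ne_zero (right_ne_zero_of_mul hne)
    rw [hdeg] at h1
    have h2 := hsum I hI.1.1
    have h3 := hsum (Finset.range n) fun x hx => by
      have h1 := Finset.mem_range.1 hx
      have h2 := val_le_of_strictMono hk ⟨x, h1⟩
      have h3 := hkN ⟨x, h1⟩
      rw [Finset.mem_range]
      simp only at h2
      omega
    rw [hI.1.2] at h2
    rw [Finset.card_range] at h3
    omega

/-- At α = ε - c only the factor with s = c - 1 is divisible by ε, and it occurs for i exactly when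
i < c. -/
theorem prod_shiftedFactor_comp {N c : ℕ} (hc : 0 < c) (hcN : c ≤ N) (I : Finset ℕ) :
    ∃ R : ℝ[X], R.coeff 0 ≠ 0 ∧ (∏ i ∈ I, shiftedFactor N i).comp (X - C (c : ℝ))
      = X ^ (I.filter (· < c)).card * R := by
  have key : ∀ i, ∃ R : ℝ[X], R.coeff 0 ≠ 0 ∧
      (shiftedFactor N i).comp (X - C (c : ℝ)) = (if i < c then X else 1) * R := by
    intro i
    have hcomp : (shiftedFactor N i).comp (X - C (c : ℝ))
        = ∏ s ∈ Finset.Ico i N, (X + C ((s : ℝ) + 1 - c)) := by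
      unfold shiftedFactor
      rw [prod_comp]
      refine Finset.prod_congr rfl fun s _ => ?_
      simp only [add_comp, X_comp, C_comp, C_sub, C_add]
      ring
    refine ⟨∏ s ∈ (Finset.Ico i N).erase (c - 1), (X + C ((s : ℝ) + 1 - c)), ?_, ?_⟩
    · rw [coeff_zero_prod, Finset.prod_ne_zero_iff]
      intro s hs h0
      have hne := Finset.ne_of_mem_erase hs
      simp only [coeff_add, coeff_X_zero, coeff_C_zero, zero_add] at h0
      have : ((s + 1 : ℕ) : ℝ) = (c : ℝ) := by push_cast; linarith
      have := Nat.cast_injective this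
      omega
    · rw [hcomp]
      split_ifs with h
      · rw [← Finset.mul_prod_erase _ _ (Finset.mem_Ico.2 ⟨(by omega : i ≤ c - 1), by omega⟩)]
        congr 1
        rw [Nat.cast_sub hc]
        simp
      · rw [Finset.erase_eq_of_notMem, one_mul]
        rw [Finset.mem_Ico]; omega
  choose R hR0 hR using key
  refine ⟨∏ i ∈ I, R i, ?_, ?_⟩
  · rw [coeff_zero_prod]
    exact Finset.prod_ne_zero_iff.2 fun i _ => hR0 i
  · rw [prod_comp, Finset.prod_congr rfl fun i _ => hR i, Finset.prod_mul_distrib,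
      ← Finset.prod_filter, Finset.prod_const]

/-- With u elements below c, the cheapest set packs them at 0 and the others at c; the gap of length
c - u is paid for by n - u elements. -/
theorem sum_of_card_filter_lt {n c u : ℕ} {I : Finset ℕ} (hI : I.card = n)
    (hu : (I.filter (· < c)).card = u) :
    u ≤ n ∧ u ≤ c ∧ ∑ r ∈ Finset.range n, r + (n - u) * (c - u) ≤ ∑ i ∈ I, i ∧
      (∑ i ∈ I, i = ∑ r ∈ Finset.range n, r + (n - u) * (c - u) →
        I = Finset.range u ∪ Finset.Ico c (c + (n - u))) := by
  have hun : u ≤ n := by rw [← hu, ← hI]; exact Finset.card_filter_le _ _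
  have huc : u ≤ c := by
    rw [← hu]
    refine (Finset.card_le_card fun i hi => ?_).trans (Finset.card_range c).le
    exact Finset.mem_range.2 (Finset.mem_filter.1 hi).2
  have hv : (I.filter (¬ · < c)).card = n - u := by
    have := Finset.card_filter_add_card_filter_not (s := I) (· < c)
    omega
  obtain ⟨h1, h1'⟩ := sum_range_le_sum hu
  obtain ⟨h2, h2'⟩ := sum_Ico_le_sum (c := c)
    (fun i hi => not_lt.1 (Finset.mem_filter.1 hi).2) hv
  have hs := Finset.sum_filter_add_sum_filter_not I (· < c) fun i => i
  obtain ⟨v, rfl⟩ := Nat.exists_eq_add_of_le hun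
  obtain ⟨w, rfl⟩ := Nat.exists_eq_add_of_le huc
  rw [Nat.add_sub_cancel_left] at *
  have h3 : ∑ r ∈ Finset.range (u + v), r + v * w
      = ∑ r ∈ Finset.range u, r + ∑ s ∈ Finset.range v, (u + w + s) := by
    rw [Finset.sum_range_add, Finset.sum_add_distrib, Finset.sum_add_distrib]
    simp only [Finset.sum_const, Finset.card_range, smul_eq_mul]
    ring
  rw [Nat.add_sub_cancel_left]
  refine ⟨hun, huc, by omega, fun h => ?_⟩
  rw [← h1' (by omega), ← h2' (by omega), Finset.filter_union_filter_not_eq]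

theorem wronskianKappa_gap_ne_zero {N n c u : ℕ} {k : Fin n → ℕ} (hk : StrictMono k)
    (hkN : ∀ j, k j ≤ N) (hun : u ≤ n) (huc : u ≤ c)
    (hu : (Finset.univ.filter fun j => k j < c).card ≤ u) :
    wronskianKappa N k (Finset.range u ∪ Finset.Ico c (c + (n - u))) ≠ 0 := by
  set i : Fin n → ℕ := fun j => if (j : ℕ) < u then j else c + (j - u) with hi
  have him : Finset.univ.image i = Finset.range u ∪ Finset.Ico c (c + (n - u)) := by
    ext x
    simp only [Finset.mem_image, Finset.mem_univ, true_and, Finset.mem_union, Finset.mem_range,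
      Finset.mem_Ico, hi]
    constructor
    · rintro ⟨j, rfl⟩
      have := j.2
      split_ifs <;> omega
    · rintro (h | h)
      · exact ⟨⟨x, by omega⟩, if_pos h⟩
      · refine ⟨⟨u + (x - c), by omega⟩, ?_⟩
        simp only
        rw [if_neg (by omega)]
        omega
  have hmono : StrictMono i := by
    intro a b hab
    have : (a : ℕ) < b := hab
    simp only [hi]
    split_ifs <;> omega
  have hlarge : ∀ m (hm : u + m < n), c + m ≤ k ⟨u + m, hm⟩ := by
    intro m
    induction m with
    | zero =>
      intro hm
      by_contra! hlt
      have hsub : Finset.Iic (⟨u, hm⟩ : Fin n) ⊆ Finset.univ.filter fun j => k j < c := by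
        intro j hj
        rw [Finset.mem_filter]
        exact ⟨Finset.mem_univ _, (hk.monotone (Finset.mem_Iic.1 hj)).trans_lt hlt⟩
      have := Finset.card_le_card hsub
      rw [Fin.card_Iic] at this
      simp only at this
      omega
    | succ m ih =>
      intro hm
      have h1 := ih (by omega)
      have h2 : k ⟨u + m, by omega⟩ < k ⟨u + (m + 1), hm⟩ := hk (by simp [Fin.lt_def])
      omega
  rw [← him]
  refine wronskianKappa_ne_zero hk hkN hmono fun j => ?_
  simp only [hi]
  split_ifs with h
  · exact val_le_of_strictMono hk j
  · have hj : u + ((j : ℕ) - u) = j := by omega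
    have := hlarge (j - u) (by rw [hj]; exact j.2)
    simp only [hj] at this
    exact this

/-- Here u counts the exponents below c in a contributing set; σ ≤ k sends every index with k_j < c
to such an exponent. -/
theorem exists_of_coeff_wronskianPencil_comp {N n c m b : ℕ} {k : Fin n → ℕ} (hc : 0 < c)
    (hcN : c ≤ N) (h : (((wronskianPencil N k).coeff m).comp (X - C (c : ℝ))).coeff b ≠ 0) :
    ∃ u, (Finset.univ.filter fun j => k j < c).card ≤ u ∧ u ≤ n ∧ u ≤ c ∧ u ≤ b
      ∧ (n - u) * (c - u) ≤ m := by
  rw [coeff_wronskianPencil, ← coe_compRingHom_apply, map_sum, finsetSum_coeff] at h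
  obtain ⟨I, hI, hne⟩ := Finset.exists_ne_zero_of_sum_ne_zero h
  rw [Finset.mem_filter, Finset.mem_powersetCard] at hI
  obtain ⟨R, hR0, hR⟩ := prod_shiftedFactor_comp hc hcN I
  rw [coe_compRingHom_apply, mul_comp, C_comp, coeff_C_mul, hR] at hne
  obtain ⟨σ, hσi, hσI, hσk⟩ := exists_of_wronskianKappa_ne_zero (left_ne_zero_of_mul hne)
  obtain ⟨h1, h2, h3, -⟩ := sum_of_card_filter_lt hI.1.2 (c := c) rfl
  refine ⟨_, ?_, h1, h2, ?_, by omega⟩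
  · refine Finset.card_le_card_of_injOn σ (fun j hj => ?_) hσi.injOn
    have hj' := (Finset.mem_filter.1 hj).2
    refine Finset.mem_filter.2 ⟨hσI ▸ Finset.mem_image_of_mem _ (Finset.mem_univ j), ?_⟩
    exact (hσk j).trans_lt hj'
  · by_contra! hlt
    exact right_ne_zero_of_mul hne (by rw [coeff_X_pow_mul', if_neg (by omega)])

/-- Only the packed set reaches this monomial: fewer exponents below c need a larger power of x,
more of them a larger power of ε. -/
theorem coeff_wronskianPencil_comp_ne_zero {N n c u : ℕ} {k : Fin n → ℕ} (hk : StrictMono k)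
    (hkN : ∀ j, k j ≤ N) (hc : 0 < c) (hcN : c ≤ N) (hun : u ≤ n) (huc : u ≤ c)
    (hu : (Finset.univ.filter fun j => k j < c).card ≤ u) :
    (((wronskianPencil N k).coeff ((n - u) * (c - u))).comp (X - C (c : ℝ))).coeff u ≠ 0 := by
  have hκ := wronskianKappa_gap_ne_zero hk hkN hun huc hu
  set I₀ := Finset.range u ∪ Finset.Ico c (c + (n - u)) with hI₀
  have hdisj : Disjoint (Finset.range u) (Finset.Ico c (c + (n - u))) := by
    rw [Finset.disjoint_left]
    intro x hx hx'
    have := Finset.mem_range.1 hx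
    have := (Finset.mem_Ico.1 hx').1
    omega
  have hcard : I₀.card = n := by
    rw [hI₀, Finset.card_union_of_disjoint hdisj, Finset.card_range, Nat.card_Ico]; omega
  have hfil : I₀.filter (· < c) = Finset.range u := by
    ext x
    simp only [hI₀, Finset.mem_filter, Finset.mem_union, Finset.mem_range, Finset.mem_Ico]
    omega
  have hsub : I₀ ⊆ Finset.range (N + 1) := by
    obtain ⟨σ, -, hσI, hσk⟩ := exists_of_wronskianKappa_ne_zero hκ
    intro x hx
    rw [← hσI] at hx
    obtain ⟨j, -, rfl⟩ := Finset.mem_image.1 hx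
    exact Finset.mem_range.2 (Nat.lt_succ_of_le ((hσk j).trans (hkN j)))
  have hsum : ∑ i ∈ I₀, i = (n - u) * (c - u) + ∑ r ∈ Finset.range n, r := by
    obtain ⟨v, rfl⟩ := Nat.exists_eq_add_of_le hun
    obtain ⟨w, rfl⟩ := Nat.exists_eq_add_of_le huc
    have hadd : ∀ a, ∑ s ∈ Finset.range v, (a + s) = v * a + ∑ s ∈ Finset.range v, s := fun a => by
      rw [Finset.sum_add_distrib, Finset.sum_const, Finset.card_range, smul_eq_mul]
    rw [hI₀, Finset.sum_union hdisj, Finset.sum_Ico_eq_sum_range, Finset.sum_range_add]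
    simp only [Nat.add_sub_cancel_left, hadd]
    ring
  rw [coeff_wronskianPencil, ← coe_compRingHom_apply, map_sum, finsetSum_coeff,
    Finset.sum_eq_single_of_mem I₀ (by
      rw [Finset.mem_filter, Finset.mem_powersetCard]; exact ⟨⟨hsub, hcard⟩, hsum⟩)]
  · obtain ⟨R, hR0, hR⟩ := prod_shiftedFactor_comp hc hcN I₀
    rw [coe_compRingHom_apply, mul_comp, C_comp, coeff_C_mul, hR, hfil, Finset.card_range, coeff_X_pow_mul', if_pos le_rfl,
      Nat.sub_self]
    exact mul_ne_zero hκ hR0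
  · intro I hI hne
    rw [Finset.mem_filter, Finset.mem_powersetCard] at hI
    obtain ⟨R, hR0, hR⟩ := prod_shiftedFactor_comp hc hcN I
    rw [coe_compRingHom_apply, mul_comp, C_comp, coeff_C_mul, hR, coeff_X_pow_mul']
    obtain ⟨h1, h2, h3, h4⟩ := sum_of_card_filter_lt hI.1.2 (c := c) rfl
    split_ifs with hle
    · exfalso
      rcases hle.lt_or_eq with hlt | heq
      · have := Nat.mul_lt_mul'' (Nat.sub_lt_sub_left (hlt.trans_le hun) hlt)
          (Nat.sub_lt_sub_left (hlt.trans_le huc) hlt)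
        omega
      · rw [heq] at h4
        exact hne (h4 (by omega))
    · rw [mul_zero]

/-- The function u ↦ (n - u)(c - u) has second difference 2, so the point at u₁ + 1 lies strictly
below a chord of height two or more. -/
theorem lattice_edge_height_le {n c u₁ u₂ p q : ℕ} (hp : 0 < p) (hn₁ : u₂ ≤ n) (hc₁ : u₂ ≤ c)
    (h12 : u₁ + 2 ≤ u₂)
    (h : p * ((n - u₁) * (c - u₁)) + q * u₁ ≤ p * ((n - (u₁ + 1)) * (c - (u₁ + 1))) + q * (u₁ + 1))
    (h' : p * ((n - u₂) * (c - u₂)) + q * u₂ ≤ p * ((n - u₁) * (c - u₁)) + q * u₁) : False := by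
  obtain ⟨d, rfl⟩ := Nat.exists_eq_add_of_le h12
  obtain ⟨v, rfl⟩ := Nat.exists_eq_add_of_le hn₁
  obtain ⟨w, rfl⟩ := Nat.exists_eq_add_of_le hc₁
  have e1 : u₁ + 2 + d + v - u₁ = 2 + d + v := by omega
  have e2 : u₁ + 2 + d + w - u₁ = 2 + d + w := by omega
  have e3 : u₁ + 2 + d + v - (u₁ + 1) = 1 + d + v := by omega
  have e4 : u₁ + 2 + d + w - (u₁ + 1) = 1 + d + w := by omega
  rw [e1, e2, e3, e4] at h
  rw [e1, e2, Nat.add_sub_cancel_left, Nat.add_sub_cancel_left] at h'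
  have h1 : p * (2 * d + v + w + 3) ≤ q := by nlinarith
  have h2 : (d + 2) * q ≤ p * ((d + 2) * (d + 2 + v + w)) := by nlinarith
  have h3 : q ≤ p * (d + 2 + v + w) := by
    have : (d + 2) * q ≤ (d + 2) * (p * (d + 2 + v + w)) := by linarith
    exact Nat.le_of_mul_le_mul_left this (by omega)
  nlinarith

theorem not_sq_dvd_wronskianPencil {N n : ℕ} {k : Fin n → ℕ} (hk : StrictMono k)
    (hkN : ∀ j, k j ≤ N) {G H : ℝ[X][X]} (hprim : G.IsPrimitive) (hG : G.natDegree ≠ 0) :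
    wronskianPencil N k ≠ G ^ 2 * H := by
  intro hF
  obtain ⟨κ, hκ, hcoeff⟩ := coeff_zero_wronskianPencil hk hkN
  have hne0 : (wronskianPencil N k).coeff 0 ≠ 0 := by
    rw [hcoeff]
    exact mul_ne_zero (C_ne_zero.2 hκ)
      (monic_prod_of_monic _ _ fun i _ => shiftedFactor_monic N i).ne_zero
  have hGdvd : G ∣ wronskianPencil N k := ⟨G * H, by rw [hF]; ring⟩
  have hG0dvd : G.coeff 0 ∣ (wronskianPencil N k).coeff 0 := by
    rw [hF, mul_coeff_zero, pow_two, mul_coeff_zero, mul_assoc]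
    exact dvd_mul_right _ _
  obtain ⟨D, hD, hmax⟩ := wronskianPencil_totalDegree hk hkN
  have hGne : G ≠ 0 := by rintro rfl; simp at hG
  -- The leading coefficient in x supplies a monomial of positive total degree, which the x-free
  -- coefficient must match.
  have hdeg : (G.coeff 0).natDegree ≠ 0 := by
    have hl := leadingCoeff_ne_zero.2 hGne
    obtain ⟨b, hb⟩ : ∃ b, G.leadingCoeff.coeff b ≠ 0 := by
      by_contra! h
      exact hl (Polynomial.ext fun i => by simpa using h i)
    have := natDegree_coeff_zero_of_dvd hGdvd hD hmax hb
    omega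
  -- A nonconstant divisor of a product of real linear factors has a real root.
  obtain ⟨ρ, hρ⟩ : ∃ ρ, (G.coeff 0).eval ρ = 0 := by
    refine Splits.exists_eval_eq_zero (Splits.of_dvd ?_ hne0 hG0dvd) fun h => hdeg ?_
    · rw [hcoeff]
      refine Splits.mul (Splits.C _) (Splits.prod fun i _ => Splits.prod fun s _ => ?_)
      exact Splits.X_add_C _
    · exact natDegree_eq_zero_iff_degree_le_zero.2 h.le
  obtain ⟨c, hc, hcN, rfl⟩ : ∃ c : ℕ, 0 < c ∧ c ≤ N ∧ ρ = -(c : ℝ) := by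
    have h0 : ((wronskianPencil N k).coeff 0).eval ρ = 0 := eval_eq_zero_of_dvd_of_eval_eq_zero hG0dvd hρ
    rw [hcoeff, eval_mul, eval_C, eval_prod] at h0
    obtain ⟨i, -, hi⟩ := Finset.prod_eq_zero_iff.1 ((mul_eq_zero.1 h0).resolve_left hκ)
    unfold shiftedFactor at hi
    rw [eval_prod] at hi
    obtain ⟨s, hs, hs0⟩ := Finset.prod_eq_zero_iff.1 hi
    simp only [eval_add, eval_X, eval_C] at hs0
    refine ⟨s + 1, Nat.succ_pos _, (Finset.mem_Ico.1 hs).2, ?_⟩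
    push_cast
    linarith
  set φ : ℝ[X] →+* ℝ[X] := compRingHom (X - C (c : ℝ)) with hφ
  have hφa : ∀ P : ℝ[X], φ P = P.comp (X - C (c : ℝ)) := fun P => by
    rw [hφ, coe_compRingHom_apply]
  have hφ0 : ∀ P : ℝ[X], (φ P).coeff 0 = P.eval (-(c : ℝ)) := fun P => by
    rw [hφa, coeff_zero_eq_eval_zero, eval_comp]; simp
  have hφi : ∀ P : ℝ[X], P ≠ 0 → φ P ≠ 0 := fun P hP h => by
    have h1 := congrArg (fun Q => Q.comp (X + C (c : ℝ))) h
    simp only [hφa, comp_assoc, sub_comp, X_comp, C_comp, add_sub_cancel_right, comp_X,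
      zero_comp] at h1
    exact hP h1
  have hF' : (wronskianPencil N k).map φ = (G.map φ) ^ 2 * H.map φ := by
    rw [hF, Polynomial.map_mul, Polynomial.map_pow]
  have hcF : ∀ m, ((wronskianPencil N k).map φ).coeff m
      = ((wronskianPencil N k).coeff m).comp (X - C (c : ℝ)) := fun m => by
    rw [coeff_map, hφa]
  obtain ⟨p, q, i₁, b₁, i₂, b₂, hp, hq, hn₁, hn₂, hm₁, hm₂, hb⟩ :=
    exists_long_edge_of_sq_mul hF'
      (fun h => hφi _ hne0 (by rw [← coeff_map, h, coeff_zero]))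
      (by rw [coeff_map, hφ0, hρ])
      (by
        rw [coeff_map]
        exact hφi _ fun h => hdeg (by rw [h, natDegree_zero]))
      (by
        -- If G vanished identically at ε = 0, then α + c would divide it, against primitivity.
        by_contra! h
        have hdvd : C (X + C (c : ℝ)) ∣ G := by
          rw [C_dvd_iff_dvd_coeff]
          intro i
          have h1 := h i
          rw [coeff_map, hφ0] at h1
          have h2 := dvd_iff_isRoot.2 h1
          rwa [C_neg, sub_neg_eq_add] at h2
        have := natDegree_eq_zero_of_isUnit (hprim _ hdvd)
        rw [natDegree_X_add_C] at this
        exact one_ne_zero this)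
  -- Every monomial dominates one of the points ((n - u)(c - u), u) in both coordinates, and that
  -- point is in the support; since both weights are positive, a minimiser must coincide with it.
  have hvert : ∀ i b, (((wronskianPencil N k).map φ).coeff i).coeff b ≠ 0 →
      (∀ i' b', (((wronskianPencil N k).map φ).coeff i').coeff b' ≠ 0 →
        p * i + q * b ≤ p * i' + q * b') →
      (Finset.univ.filter fun j => k j < c).card ≤ b ∧ b ≤ n ∧ b ≤ c ∧ i = (n - b) * (c - b) := by
    intro i b hib hmin
    rw [hcF] at hib
    obtain ⟨u, h1, h2, h3, h4, h5⟩ := exists_of_coeff_wronskianPencil_comp hc hcN hib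
    have h6 := hmin ((n - u) * (c - u)) u (by
      rw [hcF]; exact coeff_wronskianPencil_comp_ne_zero hk hkN hc hcN h2 h3 h1)
    have h7 := Nat.mul_le_mul_left p h5
    have h8 := Nat.mul_le_mul_left q h4
    have h9 : b ≤ u := Nat.le_of_mul_le_mul_left (by omega : q * b ≤ q * u) hq
    have h10 : u = b := le_antisymm h4 h9
    subst h10
    have h11 : i ≤ (n - u) * (c - u) :=
      Nat.le_of_mul_le_mul_left (by omega : p * i ≤ p * ((n - u) * (c - u))) hp
    exact ⟨h1, h2, h3, le_antisymm h11 h5⟩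
  obtain ⟨h1, h2, h3, rfl⟩ := hvert _ _ hn₁ hm₁
  obtain ⟨h1', h2', h3', rfl⟩ := hvert _ _ hn₂ hm₂
  refine lattice_edge_height_le hp h2' h3' hb (hm₁ _ _ ?_) (hm₂ _ _ hn₁)
  rw [hcF]
  exact coeff_wronskianPencil_comp_ne_zero hk hkN hc hcN (by omega) (by omega) (by omega)

/-! ### Separability for generic α. -/

/-- In characteristic zero it suffices to exclude square factors over ℝ(α), and Gauss's lemma
replaces such a factor by a primitive one over ℝ[α]. -/
theorem wronskianPencil_map_separable {N n : ℕ} {k : Fin n → ℕ} (hk : StrictMono k)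
    (hkN : ∀ j, k j ≤ N) :
    ((wronskianPencil N k).map (algebraMap ℝ[X] (FractionRing ℝ[X]))).Separable := by
  obtain ⟨κ, hκ, hcoeff⟩ := coeff_zero_wronskianPencil hk hkN
  have hne0 : wronskianPencil N k ≠ 0 := by
    intro h
    rw [h, coeff_zero] at hcoeff
    exact mul_ne_zero (C_ne_zero.2 hκ)
      (monic_prod_of_monic _ _ fun i _ => shiftedFactor_monic N i).ne_zero hcoeff.symm
  have hinj : Function.Injective (algebraMap ℝ[X] (FractionRing ℝ[X])) :=
    IsFractionRing.injective _ _
  have : CharZero (FractionRing ℝ[X]) := charZero_of_injective_algebraMap hinj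
  rw [PerfectField.separable_iff_squarefree]
  intro g hg
  have hFK : (wronskianPencil N k).map (algebraMap ℝ[X] (FractionRing ℝ[X])) ≠ 0 :=
    (Polynomial.map_ne_zero_iff hinj).2 hne0
  have hg0 : g ≠ 0 := by rintro rfl; rw [zero_mul, zero_dvd_iff] at hg; exact hFK hg
  obtain ⟨inst⟩ := (inferInstance : Nonempty (NormalizedGCDMonoid ℝ[X]))
  obtain ⟨b, hb, hbg⟩ := IsLocalization.integerNormalization_spec (nonZeroDivisors ℝ[X]) g
  set P := IsLocalization.integerNormalization (nonZeroDivisors ℝ[X]) g with hP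
  have hb0 : b ≠ 0 := nonZeroDivisors.ne_zero hb
  have hP0 : P ≠ 0 := by
    rw [hP, Ne, IsLocalization.integerNormalization_eq_zero_iff le_rfl]; exact hg0
  have hb0' : algebraMap ℝ[X] (FractionRing ℝ[X]) b ≠ 0 := (map_ne_zero_iff _ hinj).2 hb0
  have hcont : algebraMap ℝ[X] (FractionRing ℝ[X]) P.content ≠ 0 :=
    (map_ne_zero_iff _ hinj).2 (by rwa [Ne, content_eq_zero_iff])
  have hass : Associated (P.primPart.map (algebraMap ℝ[X] (FractionRing ℝ[X]))) g := by
    have h1 : C (algebraMap ℝ[X] (FractionRing ℝ[X]) P.content)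
        * P.primPart.map (algebraMap ℝ[X] (FractionRing ℝ[X]))
        = C (algebraMap ℝ[X] (FractionRing ℝ[X]) b) * g := by
      rw [← map_C, ← Polynomial.map_mul, ← eq_C_content_mul_primPart, hbg, Algebra.smul_def]
      rfl
    have hu : IsUnit (C (algebraMap ℝ[X] (FractionRing ℝ[X]) P.content)) :=
      isUnit_C.2 (isUnit_iff_ne_zero.2 hcont)
    have hu' : IsUnit (C (algebraMap ℝ[X] (FractionRing ℝ[X]) b)) :=
      isUnit_C.2 (isUnit_iff_ne_zero.2 hb0')
    rw [← associated_isUnit_mul_left_iff hu, h1]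
    exact associated_unit_mul_left _ _ hu'
  have hprim := P.isPrimitive_primPart
  have hdvd : (P.primPart.map (algebraMap ℝ[X] (FractionRing ℝ[X])))
      * P.primPart.map (algebraMap ℝ[X] (FractionRing ℝ[X]))
      ∣ (wronskianPencil N k).map (algebraMap ℝ[X] (FractionRing ℝ[X])) :=
    (mul_dvd_mul hass.dvd hass.dvd).trans hg
  obtain ⟨Q, hQ⟩ := hprim.dvd_of_fraction_map_dvd_fraction_map (dvd_of_mul_left_dvd hdvd)
  rw [hQ, Polynomial.map_mul] at hdvd
  have hdvd2 := (mul_dvd_mul_iff_left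
    ((Polynomial.map_ne_zero_iff hinj).2 hprim.ne_zero)).1 hdvd
  obtain ⟨H, hH⟩ := hprim.dvd_of_fraction_map_dvd_fraction_map hdvd2
  by_contra hnu
  refine not_sq_dvd_wronskianPencil (H := H) hk hkN hprim (fun h => hnu ?_)
    (by rw [hQ, hH]; ring)
  rw [← hass.isUnit_iff]
  refine Polynomial.isUnit_iff_degree_eq_zero.2 ?_
  rw [degree_map_eq_of_injective hinj, degree_eq_natDegree hprim.ne_zero, h]
  rfl

/-- D is a common denominator of a Bézout relation between the pencil and its x-derivative; wherever
it is nonzero, the relation specialises. -/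
theorem exists_forall_wronskianDet_laguerrePoly_separable {n : ℕ} {k : Fin n → ℕ}
    (hk : StrictMono k) :
    ∃ D : ℝ[X], D ≠ 0 ∧ ∀ α : ℝ, -1 < α → D.eval α ≠ 0 →
      (wronskianDet fun j => laguerrePoly α (k j)).Separable := by
  set N := ∑ c, k c
  have hkN : ∀ c, k c ≤ N := fun c =>
    Finset.single_le_sum (f := k) (fun _ _ => Nat.zero_le _) (Finset.mem_univ c)
  obtain ⟨a, b, hab⟩ := wronskianPencil_map_separable hk hkN
  set F := wronskianPencil N k with hF
  have hinj : Function.Injective (algebraMap ℝ[X] (FractionRing ℝ[X])) :=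
    IsFractionRing.injective _ _
  obtain ⟨d, hd, hda⟩ := IsLocalization.integerNormalization_spec (nonZeroDivisors ℝ[X]) a
  obtain ⟨e, he, heb⟩ := IsLocalization.integerNormalization_spec (nonZeroDivisors ℝ[X]) b
  set A := IsLocalization.integerNormalization (nonZeroDivisors ℝ[X]) a
  set B := IsLocalization.integerNormalization (nonZeroDivisors ℝ[X]) b
  have hAB : C e * A * F + C d * B * derivative F = C (d * e) := by
    apply Polynomial.map_injective _ hinj
    rw [Algebra.smul_def] at hda heb
    simp only [Polynomial.map_add, Polynomial.map_mul, map_C, hda, heb, ← derivative_map, map_mul]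
    have e1 : ∀ r : ℝ[X], algebraMap ℝ[X] (FractionRing ℝ[X])[X] r
      = C (algebraMap ℝ[X] (FractionRing ℝ[X]) r) := fun r => rfl
    rw [e1, e1]
    linear_combination (C (algebraMap ℝ[X] (FractionRing ℝ[X]) d)
      * C (algebraMap ℝ[X] (FractionRing ℝ[X]) e)) * hab
  refine ⟨d * e, mul_ne_zero (nonZeroDivisors.ne_zero hd) (nonZeroDivisors.ne_zero he),
    fun α hα hDα => ?_⟩
  have hs : (F.map (evalRingHom α)).Separable := by
    have h1 := congrArg (Polynomial.map (evalRingHom α)) hAB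
    simp only [Polynomial.map_add, Polynomial.map_mul, map_C, ← derivative_map,
      coe_evalRingHom] at h1
    refine ⟨C ((d * e).eval α)⁻¹ * (C (e.eval α) * A.map (evalRingHom α)),
      C ((d * e).eval α)⁻¹ * (C (d.eval α) * B.map (evalRingHom α)), ?_⟩
    have h2 : C ((d * e).eval α)⁻¹ * C ((d * e).eval α) = 1 := by
      rw [← C_mul, inv_mul_cancel₀ hDα, C_1]
    linear_combination C ((d * e).eval α)⁻¹ * h1 + h2
  rw [hF, wronskianPencil_map α hkN] at hs
  exact hs.of_mul_right

/-! ### Counting the negative values of P. -/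

/-- The naturals at which `∏ j < n, (m - K j)` is negative. -/
noncomputable def negSet (K : ℕ → ℕ) (n : ℕ) : Finset ℕ :=
  (Finset.range (K n)).filter fun m : ℕ => ∏ j ∈ Finset.range n, ((m : ℝ) - K j) < 0

theorem prod_sub_nonneg {K : ℕ → ℕ} {n m : ℕ} (hm : ∀ j < n, K j ≤ m) :
    0 ≤ ∏ j ∈ Finset.range n, ((m : ℝ) - K j) :=
  Finset.prod_nonneg fun j hj => sub_nonneg.2 (by exact_mod_cast hm j (Finset.mem_range.1 hj))

theorem mem_negSet {K : ℕ → ℕ} (hK : StrictMono K) {n m : ℕ} :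
    m ∈ negSet K n ↔ ∏ j ∈ Finset.range n, ((m : ℝ) - K j) < 0 := by
  rw [negSet, Finset.mem_filter, Finset.mem_range, and_iff_right_iff_imp]
  intro h
  by_contra! hle
  exact h.not_ge (prod_sub_nonneg fun j hj => (hK hj).le.trans hle)

/-- The naturals below K n split by the sign of the product over j < n: the negative ones form
`negSet K n`, the zeros are the n values K j, and the positive ones become negative on multiplying
by m - K n. -/
theorem card_negSet_succ {K : ℕ → ℕ} (hK : StrictMono K) (n : ℕ) :
    (negSet K (n + 1)).card + (negSet K n).card + n = K n := by
  have h1 : negSet K (n + 1)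
      = (Finset.range (K n)).filter fun m : ℕ => 0 < ∏ j ∈ Finset.range n, ((m : ℝ) - K j) := by
    ext m
    rw [mem_negSet hK, Finset.mem_filter, Finset.mem_range, Finset.prod_range_succ]
    rcases lt_or_ge m (K n) with h | h
    · have : (m : ℝ) - K n < 0 := sub_neg.2 (by exact_mod_cast h)
      rw [mul_neg_iff]
      constructor
      · rintro (h' | h')
        · exact ⟨h, h'.1⟩
        · exact absurd h'.2 this.not_gt
      · exact fun h' => Or.inl ⟨h'.2, this⟩
    · have h2 : (0 : ℝ) ≤ (m : ℝ) - K n := sub_nonneg.2 (by exact_mod_cast h)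
      have h3 := prod_sub_nonneg (n := n) (m := m) fun j hj => (hK hj).le.trans h
      constructor
      · exact fun h' => absurd h' (mul_nonneg h3 h2).not_gt
      · exact fun h' => absurd h'.1 h.not_gt
  have h2 : ((Finset.range (K n)).filter fun m : ℕ => ∏ j ∈ Finset.range n, ((m : ℝ) - K j) = 0)
      = (Finset.range n).image K := by
    ext m
    rw [Finset.mem_filter, Finset.mem_range, Finset.mem_image, Finset.prod_eq_zero_iff]
    constructor
    · rintro ⟨-, j, hj, h⟩
      exact ⟨j, hj, by exact_mod_cast (sub_eq_zero.1 h).symm⟩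
    · rintro ⟨j, hj, rfl⟩
      exact ⟨hK (Finset.mem_range.1 hj), j, hj, sub_self _⟩
  have h3 := Finset.card_image_of_injective (Finset.range n) hK.injective
  rw [← h2, Finset.card_range] at h3
  have h4 := Finset.card_filter_add_card_filter_not (s := Finset.range (K n))
    fun m : ℕ => ∏ j ∈ Finset.range n, ((m : ℝ) - K j) < 0
  have h5 := Finset.card_filter_add_card_filter_not
    (s := (Finset.range (K n)).filter fun m : ℕ => ¬ ∏ j ∈ Finset.range n, ((m : ℝ) - K j) < 0)
    fun m : ℕ => ∏ j ∈ Finset.range n, ((m : ℝ) - K j) = 0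
  rw [Finset.filter_filter, Finset.filter_filter] at h5
  rw [Finset.card_range] at h4
  have h6 : ((Finset.range (K n)).filter fun m : ℕ => ¬ ∏ j ∈ Finset.range n, ((m : ℝ) - K j) < 0
      ∧ ∏ j ∈ Finset.range n, ((m : ℝ) - K j) = 0)
      = (Finset.range (K n)).filter fun m : ℕ => ∏ j ∈ Finset.range n, ((m : ℝ) - K j) = 0 :=
    Finset.filter_congr fun m _ => ⟨fun h => h.2, fun h => ⟨h.not_lt, h⟩⟩
  have h7 : ((Finset.range (K n)).filter fun m : ℕ => ¬ ∏ j ∈ Finset.range n, ((m : ℝ) - K j) < 0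
      ∧ ¬ ∏ j ∈ Finset.range n, ((m : ℝ) - K j) = 0)
      = (Finset.range (K n)).filter fun m : ℕ => 0 < ∏ j ∈ Finset.range n, ((m : ℝ) - K j) :=
    Finset.filter_congr fun m _ => by rw [not_lt]; exact ⟨fun h => lt_of_le_of_ne h.1 (Ne.symm h.2),
      fun h => ⟨h.le, h.ne'⟩⟩
  rw [h6, h7, ← h1] at h5
  have h8 : ((Finset.range (K n)).filter fun m : ℕ => ∏ j ∈ Finset.range n, ((m : ℝ) - K j) < 0)
    = negSet K n := rfl
  rw [h8] at h4
  omega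

theorem card_negSet {μ : ℕ → ℕ} (hμ : Monotone μ) (n : ℕ) :
    ((negSet (fun j => μ j + j) n).card : ℤ)
      = ∑ j ∈ Finset.range n, (-1 : ℤ) ^ (n - (j + 1)) * μ j := by
  have hK : StrictMono fun j => μ j + j := hμ.add_strictMono strictMono_id
  induction n with
  | zero => simp [negSet]
  | succ n ih =>
    have h1 : (negSet (fun j => μ j + j) (n + 1)).card + (negSet (fun j => μ j + j) n).card + n
        = μ n + n := card_negSet_succ hK n
    have h2 : ∑ j ∈ Finset.range n, (-1 : ℤ) ^ (n + 1 - (j + 1)) * μ j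
        = -∑ j ∈ Finset.range n, (-1 : ℤ) ^ (n - (j + 1)) * μ j := by
      rw [← Finset.sum_neg_distrib]
      refine Finset.sum_congr rfl fun j hj => ?_
      have := Finset.mem_range.1 hj
      rw [show n + 1 - (j + 1) = n - (j + 1) + 1 by omega, pow_succ]
      ring
    rw [Finset.sum_range_succ, h2, ← ih, Nat.sub_self, pow_zero, one_mul]
    omega

/-! ### Combining the bounds and discarding a null set of parameters. -/

theorem laguerreWronskian_roots_of_separable {α : ℝ} (hα : -1 < α) {ℓ : ℕ} {lam : Fin ℓ → ℕ}
    (hlam : Monotone lam) (hsep : (laguerreWronskian α lam).Separable) :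
    (∀ x : ℝ, 0 < x → (laguerreWronskian α lam).IsRoot x →
        (laguerreWronskian α lam).rootMultiplicity x = 1) ∧
      {x : ℝ | 0 < x ∧ (laguerreWronskian α lam).IsRoot x}.Finite ∧
      (({x : ℝ | 0 < x ∧ (laguerreWronskian α lam).IsRoot x}.ncard : ℕ) : ℤ) =
        ∑ j : Fin ℓ, (-1 : ℤ) ^ (ℓ - ((j : ℕ) + 1)) * (lam j : ℤ) := by
  -- The sequence lemmas index by ℕ; continuing λ with its total sum keeps it monotone.
  set μ : ℕ → ℕ := fun j => if h : j < ℓ then lam ⟨j, h⟩ else ∑ i, lam i with hμdef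
  have hμ : Monotone μ := by
    intro a b hab
    simp only [hμdef]
    split_ifs with h1 h2 h2
    · exact hlam hab
    · exact Finset.single_le_sum (f := lam) (fun _ _ => Nat.zero_le _) (Finset.mem_univ _)
    · omega
    · exact le_rfl
  have hμlam : ∀ j : Fin ℓ, μ j = lam j := fun j => dif_pos j.2
  have hK : StrictMono fun j => μ j + j := hμ.add_strictMono strictMono_id
  set W := laguerreWronskian α lam with hW
  have hseq : seqWronskian (fun j => laguerrePoly α (μ j + j)) ℓ = W := by
    rw [hW, seqWronskian, laguerreWronskian]
    simp only [hμlam]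
  have hW0 : W ≠ 0 := hsep.ne_zero
  have hsimple : ∀ x, W.IsRoot x → W.rootMultiplicity x = 1 := fun x hx =>
    le_antisymm (rootMultiplicity_le_one_of_separable hsep x) ((rootMultiplicity_pos hW0).2 hx)
  set Z : Finset ℝ := W.roots.toFinset.filter (0 < ·) with hZ
  have hmem : ∀ x, x ∈ Z ↔ 0 < x ∧ W.IsRoot x := fun x => by
    rw [hZ, Finset.mem_filter, Multiset.mem_toFinset, mem_roots hW0, and_comm]
  have hset : {x : ℝ | 0 < x ∧ W.IsRoot x} = Z := by
    ext x; simp [hmem]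
  have hupper : Z.card ≤ (negSet (fun j => μ j + j) ℓ).card := by
    refine card_le_of_isRoot_wronskianDet hα (k := fun j : Fin ℓ => lam j + j)
      (fun a b hab => ?_) (fun z hz => ((hmem z).1 hz).1) (fun z hz => ((hmem z).1 hz).2) ?_
    · have : μ a + a = μ b + b := by rw [hμlam, hμlam]; exact hab
      exact Fin.ext (hK.injective this)
    · intro m hm
      rw [mem_negSet hK, ← Fin.prod_univ_eq_prod_range fun j => (m : ℝ) - ((μ j + j : ℕ) : ℝ)]
      simpa only [hμlam] using hm
  have hlower : (negSet (fun j => μ j + j) ℓ).card ≤ Z.card := by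
    refine card_le_of_simple_seqWronskian (k := fun j => μ j + j) hα (n := ℓ) (fun j _ => ?_)
      (fun z hz hr => ?_) fun m hm => (mem_negSet hK).1 hm
    · exact wronskianDet_laguerrePoly_eval_zero_ne_zero hα (k := fun i : Fin j => μ i + i)
        fun a b hab => hK hab
    · rw [hseq] at hr ⊢
      exact ⟨(hmem z).2 ⟨hz, hr⟩, hsimple z hr⟩
  refine ⟨fun x _ hx => hsimple x hx, hset ▸ Z.finite_toSet, ?_⟩
  rw [hset, Set.ncard_coe_finset, le_antisymm hupper hlower, card_negSet hμ,
    ← Fin.sum_univ_eq_sum_range fun j => (-1 : ℤ) ^ (ℓ - (j + 1)) * (μ j : ℤ)]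
  simp only [hμlam]

theorem ae_laguerreWronskian_separable {ℓ : ℕ} {lam : Fin ℓ → ℕ} (hlam : Monotone lam) :
    ∀ᵐ α : ℝ ∂volume, -1 < α → (laguerreWronskian α lam).Separable := by
  obtain ⟨D, hD, h⟩ := exists_forall_wronskianDet_laguerrePoly_separable
    (k := fun j : Fin ℓ => lam j + j) (hlam.add_strictMono fun _ _ h => h)
  have hfin : (D.roots.toFinset : Set ℝ).Finite := Finset.finite_toSet _
  filter_upwards [compl_mem_ae_iff.2 (hfin.measure_zero volume)] with α hα hα1
  refine h α hα1 fun h0 => hα ?_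
  rw [Finset.mem_coe, Multiset.mem_toFinset, mem_roots hD]
  exact h0

/-- For almost every `α > -1`, for every partition `lam_1 ≤ … ≤ lam_ℓ`: all zeros of the Wronskian
in `(0, ∞)` are simple, and their number is `∑_j (-1)^(ℓ - j) lam_j` (`j` from `1` to `ℓ`). -/
theorem corollary1p6 :
    ∀ᵐ α : ℝ ∂volume, -1 < α →
      ∀ (ℓ : ℕ) (lam : Fin ℓ → ℕ), Monotone lam →
        (∀ x : ℝ, 0 < x → (laguerreWronskian α lam).IsRoot x →
          (laguerreWronskian α lam).rootMultiplicity x = 1) ∧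
        {x : ℝ | 0 < x ∧ (laguerreWronskian α lam).IsRoot x}.Finite ∧
        (({x : ℝ | 0 < x ∧ (laguerreWronskian α lam).IsRoot x}.ncard : ℕ) : ℤ) =
          ∑ j : Fin ℓ, (-1 : ℤ) ^ (ℓ - ((j : ℕ) + 1)) * (lam j : ℤ) := by
  -- The partitions form a countable family, so one null set serves all of them.
  have h : ∀ᵐ α : ℝ ∂volume, ∀ (ℓ : ℕ) (lam : Fin ℓ → ℕ), Monotone lam → -1 < α →
      (laguerreWronskian α lam).Separable := by
    rw [ae_all_iff]
    intro ℓ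
    rw [ae_all_iff]
    intro lam
    by_cases hm : Monotone lam
    · filter_upwards [ae_laguerreWronskian_separable hm] with α hα _ using hα
    · exact Filter.Eventually.of_forall fun α h => absurd h hm
  filter_upwards [h] with α hα h1 ℓ lam hm
  exact laguerreWronskian_roots_of_separable h1 hm (hα ℓ lam hm h1)
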